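/- **Symbols.** Let $x_1,x_2,\dots$ be variables and $x_{i\to j}=\prod_{r=i}^{j-1}x_r$ for $i<j$. Let $\mathbb H^{\mathrm{symb}}$ be the free commutative $\mathbb Q$-algebra on symbols $[x_r]_0$ $(r\ge 1)$ and $[x_{i_1\to i_2},\dots,x_{i_d\to i_{d+1}}]_{n_1,\dots,n_d}$ ($d\ge1$, $1\le i_1<\dots<i_{d+1}$, $n_s\ge 1$), and let $\overline{\mathbb H}^{\mathrm{symb}}$ be the free commutative $\mathbb Q$-algebra on these symbols and the inverted symbols $[x_{i_d\to i_{d+1}}^{-1},\dots,x_{i_1\to i_2}^{-1}]_{n_d,\dots,n_1}$. Put $[x_{i\to j}]_0=-[x_{i\to j}^{-1}]_0=\sum_{r=i}^{j-1}[x_r]_0$, $[1]_0=0$, $[y_1,\dots,y_d|t_1,\dots,t_d]=\sum_{n_s\ge1}[y_1,\dots,y_d]_{n_1,\dots,n_d}\,t_1^{n_1-1}\cdots t_d^{n_d-1}$, $[\emptyset|\emptyset]=1$, $\exp([y]_0t)=\sum_{n\ge0}[y]_0^nt^n/n!$ and $y_{i\to j}=\prod_{r=i}^{j-1}y_r$.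 Let $\overline\Delta\colon\overline{\mathbb H}^{\mathrm{symb}}\to\overline{\mathbb H}^{\mathrm{symb}}\otimes\overline{\mathbb H}^{\mathrm{symb}}$ be the algebra homomorphism for which the $[x_r]_0$ are primitive and, for each regular or inverted argument list $y_1,\dots,y_d$ as above, $$\overline\Delta[y_1,\dots,y_d|t_1,\dots,t_d]=\sum\,[y_{i_1\to i_2},\dots,y_{i_k\to i_{k+1}}|t_{j_1},\dots,t_{j_k}]\otimes[y_1,\dots,y_{i_1-1}|t_1,\dots,t_{i_1-1}]\prod_{\alpha=1}^kR_\alpha,$$ $$R_\alpha=(-1)^{j_\alpha-i_\alpha}\exp([y_{i_\alpha\to i_{\alpha+1}}]_0t_{j_\alpha})\,[y_{j_\alpha-1}^{-1},\dots,y_{i_\alpha}^{-1}|t_{j_\alpha}-t_{j_\alpha-1},\dots,t_{j_\alpha}-t_{i_\alpha}]\,[y_{j_\alpha+1},\dots,y_{i_{\alpha+1}-1}|t_{j_\alpha+1}-t_{j_\alpha},\dots,t_{i_{\alpha+1}-1}-t_{j_\alpha}],$$ summed over $k\ge 0$ and $1\le i_1\le j_1<i_2\le j_2<\dots<i_k\le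 j_k<i_{k+1}=d+1$. Let $\mathrm{INV}\colon\overline{\mathbb H}^{\mathrm{symb}}\to\mathbb H^{\mathrm{symb}}$ be the algebra homomorphism that fixes the non-inverted symbols and is given on inverted symbols, recursively in $d$, with $(y_1,\dots,y_d)$ a non-inverted argument list, by $$\begin{aligned}\mathrm{INV}[y_d^{-1},\dots,y_1^{-1}|{-t_d},\dots,-t_1]&=\sum_{j=0}^{d-1}(-1)^{d-1+j}\,\mathrm{INV}[y_j^{-1},\dots,y_1^{-1}|{-t_j},\dots,-t_1]\,[y_{j+1},\dots,y_d|t_{j+1},\dots,t_d]\\&+\sum_{j=1}^d\frac{(-1)^{d-1+j}}{t_j}\Big(\mathrm{INV}[y_{j-1}^{-1},\dots,y_1^{-1}|{-t_{j-1}},\dots,-t_1]\,[y_{j+1},\dots,y_d|t_{j+1},\dots,t_d]\\&\quad-\mathrm{INV}[y_{j-1}^{-1},\dots,y_1^{-1}|t_j-t_{j-1},\dots,t_j-t_1]\exp([y_{1\to d+1}]_0t_j)\,[y_{j+1},\dots,y_d|t_{j+1}-t_j,\dots,t_d-t_j]\Big).\end{aligned}$$ The coproduct of $\mathbb H^{\mathrm{symb}}$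 is $\Delta=(\mathrm{INV}\otimes\mathrm{INV})\circ\overline\Delta|_{\mathbb H^{\mathrm{symb}}}$. **Contraction systems.** A contraction system $X$ consists of sets $X_1,X_2,\dots$ and, for every strictly increasing $\mathbf i=(i_1,\dots,i_{d+1})$ in $\{1,\dots,n+1\}$ $(d,n\ge1)$, a map $\mathbf i\colon X_n\to X_d$, such that $\mathbf j\circ\mathbf i=\mathbf i|\mathbf j:=(i_{j_1},\dots,i_{j_{f+1}})$ and $(1,2,\dots,n+1)$ acts on $X_n$ as the identity. Its free contraction algebra $\mathbb H(X)$ is the commutative $\mathbb Q$-algebra generated by symbols $[\alpha]_{n_1,\dots,n_d}$ ($\alpha\in X_d$, $d\ge1$, $n_s\ge1$), of weight $n_1+\dots+n_d$, and $[\alpha]_0$ ($\alpha\in X_1$), of weight $1$, modulo the relations $[(i_1,i_2)\alpha]_0+[(i_2,i_3)\alpha]_0=[(i_1,i_3)\alpha]_0$. For $\alpha\in X_n$ let $\mathrm{ev}_\alpha$ be the algebra homomorphism to $\mathbb H(X)$ from the subalgebra of $\mathbb H^{\mathrm{symb}}$ generated by the symbols in $x_1,\dots,x_n$ with $\mathrm{ev}_\alpha[x_{i_1\to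 i_2},\dots,x_{i_d\to i_{d+1}}]_{\mathbf n}=[\mathbf i(\alpha)]_{\mathbf n}$ and $\mathrm{ev}_\alpha[x_r]_0=[(r,r+1)\alpha]_0$. **Theorem.** For every contraction system $X$ the algebra $\mathbb H(X)$, graded by the weight, is a graded Hopf algebra over $\mathbb Q$, whose counit kills all symbols and whose coproduct is the algebra homomorphism given by $$\Delta_X([\alpha]_0)=1\otimes[\alpha]_0+[\alpha]_0\otimes1,\qquad \Delta_X([\alpha]_{n_1,\dots,n_d})=(\mathrm{ev}_\alpha\otimes\mathrm{ev}_\alpha)\big(\Delta[x_1,\dots,x_d]_{n_1,\dots,n_d}\big);$$ here $\Delta[x_1,\dots,x_d]_{n_1,\dots,n_d}$ only involves symbols in $x_1,\dots,x_d$. The coproduct and counit are natural in $X$. In particular, the following contraction systems have graded Hopf algebras $\mathbb H(X)$. 1. For a field $F$: $X_k=\{x\in F^k: x_i\ne0,\ \prod_{r=i}^jx_r\neq1\ (1\le i\le j\le k)\}$ with $\mathbf i(x)=(x_{i_1\to i_2},\dots,x_{i_d\to i_{d+1}})$. This gives $\mathbb H^{\mathrm{symb}}(F)$. 2. For a field $F$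 and a surjective homomorphism $\pi\colon E\to F^*$ from a torsion free abelian group with kernel isomorphic to $\mathbb Z$: $X_k=\{(u_i,v_{i,j})_{1\le i\le j\le k}\in E^{k+\binom{k+1}2}:\pi(\sum_{r=i}^ju_r)+\pi(v_{i,j})=1\}$, where $\mathbf i$ sends $(u,v)$ to the point with coordinates $u'_s=\sum_{r=i_s}^{i_{s+1}-1}u_r$, $v'_{r,s}=v_{i_r,i_{s+1}-1}$. This gives $\widehat{\mathbb H}^{\mathrm{symb}}_E(F)$. 3. For an open subset $U$ of a complex manifold $M$: $X_k$ is the set of holomorphic maps from $U$ to $\widehat S_k(\mathbb C)=\{(u_i,v_{i,j})_{1\le i\le j\le k}:e^{\sum_{r=i}^ju_r}+e^{v_{i,j}}=1\}$, with the contractions of item 2 applied pointwise. As $U$ varies, these algebras form a presheaf of Hopf algebras, and the associated sheaf $\widehat{\mathbb H}^{\mathrm{symb}}_M$, with the structure maps induced from those of the presheaf, is a sheaf of Hopf algebras on $M$ (a Hopf monoid in the tensor category of sheaves of $\mathbb Q$-vector spaces). 4. For a semisimplicial (in particular, a simplicial) set $S_\bullet$: $X_k=S_k$ for $k\ge1$,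 where $\mathbf i\colon S_n\to S_d$ is induced by the morphism $[d]\to[n]$, $k\mapsto i_{k+1}-1$. This gives $\mathbb H^{\mathrm{symb}}_{S_\bullet}$. -/

import Mathlib

open scoped TensorProduct Manifold ContDiff

universe u v

noncomputable section

namespace SymbPolylog

/-! ### The algebra of symbolic polylogarithms

The variables are `x 0, x 1, x 2, ...` and `x_{a → b} = ∏_{a ≤ r < b} x r`. A strictly increasing
sequence `i : Fin (d + 2) ↪o ℕ` records the `d + 1` arguments `x_{i 0 → i 1}, …, x_{i d → i (d+1)}`
of a symbol of depth `d + 1`. -/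

/-- The generators of the algebra of symbolic polylogarithms: `log r` is `[x r]_0`, and `poly d i n`
is `[x_{i 0 → i 1}, …, x_{i d → i (d+1)}]_{n 0, …, n d}`. -/
inductive Gen : Type
  | log (r : ℕ) : Gen
  | poly (d : ℕ) (i : Fin (d + 2) ↪o ℕ) (n : Fin (d + 1) → ℕ+) : Gen

/-- The algebra `H^symb`: the free commutative `ℚ`-algebra on the symbols. -/
abbrev Hsymb : Type := MvPolynomial Gen ℚ

/-- The generators of the auxiliary algebra, which has additional inverted symbols: `inv d i n` is
`[x_{i d → i (d+1)}⁻¹, …, x_{i 0 → i 1}⁻¹]_{n d, …, n 0}` (both lists reversed). -/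
inductive BarGen : Type
  | log (r : ℕ) : BarGen
  | reg (d : ℕ) (i : Fin (d + 2) ↪o ℕ) (n : Fin (d + 1) → ℕ+) : BarGen
  | inv (d : ℕ) (i : Fin (d + 2) ↪o ℕ) (n : Fin (d + 1) → ℕ+) : BarGen

/-- The auxiliary algebra `\bar H^symb`. -/
abbrev Hbar : Type := MvPolynomial BarGen ℚ

/-- The inclusion of `H^symb` in `\bar H^symb`, as the subalgebra of regular symbols. -/
def toBar : Hsymb →ₐ[ℚ] Hbar :=
  MvPolynomial.rename fun g => match g with
    | .log r => .log r
    | .poly d i n => .reg d i n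

/-- `[x_{a → b}]_0 = ∑_{a ≤ r < b} [x r]_0` in `H^symb`, and `[x_{a → b}]_0 = -[x_{b → a}]_0` when
`b < a`, in which case `x_{a → b}` is read as `x_{b → a}⁻¹`. -/
def logSym (a b : ℕ) : Hsymb :=
  ∑ r ∈ Finset.Ico a b, MvPolynomial.X (.log r) - ∑ r ∈ Finset.Ico b a, MvPolynomial.X (.log r)

/-- The exponent vector of the monomial `t_0^(n_0 - 1) ⋯ t_{d-1}^(n_{d-1} - 1)` that marks the
symbols with indices `n` in a generating series. -/
def shift {d : ℕ} (n : Fin d → ℕ+) : Fin d →₀ ℕ :=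
  Finsupp.equivFunOnFinite.symm fun r => (n r : ℕ) - 1

open Classical in
/-- The symbol of `\bar H^symb` with arguments `x_{a 0 → a 1}, …, x_{a d → a (d+1)}`: a regular symbol
if `a` is strictly increasing, an inverted symbol if `a` is strictly decreasing (no other sequences
occur below). -/
def barSym {d : ℕ} (a : Fin (d + 2) → ℕ) (n : Fin (d + 1) → ℕ+) : Hbar :=
  if h : StrictMono a then
    MvPolynomial.X (.reg d (OrderEmbedding.ofStrictMono a h) n)
  else if h : StrictAnti a then
    MvPolynomial.X (.inv d
      (OrderEmbedding.ofStrictMono (a ∘ Fin.rev) (h.comp Fin.rev_strictAnti)) (n ∘ Fin.rev))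
  else 0

/-- The generating series `[y | t] = ∑ [y_0, …, y_{d-1}]_n t_0^(n_0 - 1) ⋯ t_{d-1}^(n_{d-1} - 1)`
with `y_r = x_{a r → a (r+1)}`, in `\bar H^symb`; it is `1` in depth `0`. -/
def barSeries : {d : ℕ} → (Fin (d + 1) → ℕ) → MvPowerSeries (Fin d) Hbar
  | 0, _ => 1
  | _ + 1, a => fun m => barSym a fun r => (m r).succPNat

open Classical in
/-- The generating series `[y | t]` of the symbols with arguments `y_r = x_{a r → a (r+1)}`, in
`H^symb`, for a strictly increasing sequence `a`; it is `1` in depth `0`. -/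
def symSeries : {d : ℕ} → (Fin (d + 1) → ℕ) → MvPowerSeries (Fin d) Hsymb
  | 0, _ => 1
  | d + 1, a => fun m =>
      if h : StrictMono a then
        MvPolynomial.X (.poly d (OrderEmbedding.ofStrictMono a h) fun r => (m r).succPNat)
      else 0

/-- The series `exp (c t_j) = ∑ c^n t_j^n / n!`. -/
def expSeries {A : Type} [CommRing A] [Algebra ℚ A] {d : ℕ} (c : A) (j : Fin d) :
    MvPowerSeries (Fin d) A :=
  PowerSeries.subst (MvPowerSeries.C c * MvPowerSeries.X j) (PowerSeries.exp A)

/-! ### Goncharov's coproduct -/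

/-- The instances `i_1 ≤ j_1 < i_2 ≤ j_2 < … < i_k ≤ j_k < i_{k+1} = d + 1` of indices (with
`i_0 = j_0 = 0 < i_1`) that index Goncharov's coproduct. Indices start at `0` here: the number `i q`
is `i_{q+1} - 1`, and `j q` is `j_{q+1} - 1`. -/
@[ext]
structure CoproductIndex (d k : ℕ) where
  i : Fin (k + 1) → Fin (d + 1)
  j : Fin k → Fin d
  i_le_j : ∀ q : Fin k, (i q.castSucc : ℕ) ≤ j q
  j_lt_i : ∀ q : Fin k, (j q : ℕ) < i q.succ
  i_last : (i (Fin.last k) : ℕ) = d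

instance (d k : ℕ) : Fintype (CoproductIndex d k) :=
  Fintype.ofInjective (fun p => (p.i, p.j)) fun _ _ h =>
    CoproductIndex.ext (congrArg Prod.fst h) (congrArg Prod.snd h)

namespace CoproductIndex

variable {d k : ℕ} (p : CoproductIndex d k) (a : Fin (d + 1) → ℕ)

/-- The left-hand factor `[y_{i_1 → i_2}, …, y_{i_k → i_{k+1}} | t_{j_1}, …, t_{j_k}]`. -/
def left : MvPowerSeries (Fin d) Hbar :=
  MvPowerSeries.subst (fun q => (MvPowerSeries.X (p.j q) : MvPowerSeries (Fin d) Hbar))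
    (barSeries (a ∘ p.i))

/-- The factor `[y_1, …, y_{i_1 - 1} | t_1, …, t_{i_1 - 1}]` of the right-hand side. -/
def rightZero : MvPowerSeries (Fin d) Hbar :=
  MvPowerSeries.subst
    (fun r : Fin (p.i 0) =>
      (MvPowerSeries.X ⟨r, by omega⟩ : MvPowerSeries (Fin d) Hbar))
    (barSeries fun r : Fin (p.i 0 + 1) => a ⟨r, by omega⟩)

/-- The series
`[y_{j-1}⁻¹, y_{j-2}⁻¹, …, y_i⁻¹ | t_j - t_{j-1}, …, t_j - t_i]` for `i = i_q`, `j = j_q`. -/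
def rightInv (q : Fin k) : MvPowerSeries (Fin d) Hbar :=
  MvPowerSeries.subst
    (fun r : Fin (p.j q - p.i q.castSucc) =>
      (MvPowerSeries.X (p.j q) - MvPowerSeries.X ⟨p.j q - 1 - r, by omega⟩ :
        MvPowerSeries (Fin d) Hbar))
    (barSeries fun r : Fin (p.j q - p.i q.castSucc + 1) => a ⟨p.j q - r, by omega⟩)

/-- The series
`[y_{j+1}, y_{j+2}, …, y_{i'-1} | t_{j+1} - t_j, …, t_{i'-1} - t_j]` for `j = j_q`,
`i' = i_{q+1}`. -/
def rightReg (q : Fin k) : MvPowerSeries (Fin d) Hbar :=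
  MvPowerSeries.subst
    (fun r : Fin (p.i q.succ - p.j q - 1) =>
      (MvPowerSeries.X ⟨p.j q + 1 + r, by omega⟩ - MvPowerSeries.X (p.j q) :
        MvPowerSeries (Fin d) Hbar))
    (barSeries fun r : Fin (p.i q.succ - p.j q - 1 + 1) =>
      a ⟨p.j q + 1 + r, by have := p.j_lt_i q; omega⟩)

/-- The right-hand factor. -/
def right : MvPowerSeries (Fin d) Hbar :=
  p.rightZero a * ∏ q : Fin k, (-1) ^ ((p.j q : ℕ) - p.i q.castSucc) *
    expSeries (toBar (logSym (a (p.i q.castSucc)) (a (p.i q.succ)))) (p.j q) *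
      p.rightInv a q * p.rightReg a q

end CoproductIndex

/-- The generating series `Δ([y | t])` of coproducts, where `y_r = x_{a r → a (r+1)}`. -/
def comulSeries {d : ℕ} (a : Fin (d + 1) → ℕ) : MvPowerSeries (Fin d) (Hbar ⊗[ℚ] Hbar) :=
  ∑ k ∈ Finset.range (d + 1), ∑ p : CoproductIndex d k,
    MvPowerSeries.map (Algebra.TensorProduct.includeLeft : Hbar →ₐ[ℚ] Hbar ⊗[ℚ] Hbar).toRingHom
        (p.left a) *
      MvPowerSeries.map (Algebra.TensorProduct.includeRight : Hbar →ₐ[ℚ] Hbar ⊗[ℚ] Hbar).toRingHom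
        (p.right a)

/-- Goncharov's coproduct on `\bar H^symb`. -/
def comulBar : Hbar →ₐ[ℚ] Hbar ⊗[ℚ] Hbar :=
  MvPolynomial.aeval fun g => match g with
    | .log r => MvPolynomial.X (.log r) ⊗ₜ 1 + 1 ⊗ₜ MvPolynomial.X (.log r)
    | .reg _ i n => MvPowerSeries.coeff (shift n) (comulSeries i)
    | .inv _ i n => MvPowerSeries.coeff (shift (n ∘ Fin.rev)) (comulSeries (i ∘ Fin.rev))

/-! ### Inversion and the coproduct on `H^symb` -/

/-- The quotient `f / t_j` of a power series by a variable, for `f` divisible by `t_j`. -/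
def divX {A : Type} [CommRing A] {d : ℕ} (j : Fin d) (f : MvPowerSeries (Fin d) A) :
    MvPowerSeries (Fin d) A :=
  fun m => MvPowerSeries.coeff (m + Finsupp.single j 1) f

/-- The series `INV([y_{d-1}⁻¹, …, y_0⁻¹ | -t_{d-1}, …, -t_0])` in `H^symb`, where
`y_r = x_{a r → a (r+1)}` for a strictly increasing sequence `a`, by recursion on the depth. Both
sums run over a variable `t_j`, `0 ≤ j < d`; the first one splits the sequence `y` before `y_j` and
the second one omits `y_j`. -/
def invSeries : (d : ℕ) → (Fin (d + 1) → ℕ) → MvPowerSeries (Fin d) Hsymb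
  | 0, _ => 1
  | d + 1, a =>
    let t : Fin (d + 1) → MvPowerSeries (Fin (d + 1)) Hsymb := MvPowerSeries.X
    (∑ j : Fin (d + 1), (-1) ^ (d + j) *
        (invSeries j fun r : Fin (j + 1) => a ⟨r, by omega⟩).subst
          (fun r : Fin j => t ⟨r, by omega⟩) *
        (symSeries fun r : Fin (d + 1 - j + 1) => a ⟨j + r, by omega⟩).subst
          (fun r : Fin (d + 1 - j) => t ⟨j + r, by omega⟩)) +
    ∑ j : Fin (d + 1), (-1) ^ (d + 1 + j) * divX j
      ((invSeries j fun r : Fin (j + 1) => a ⟨r, by omega⟩).subst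
          (fun r : Fin j => t ⟨r, by omega⟩) *
          (symSeries fun r : Fin (d - j + 1) => a ⟨j + 1 + r, by omega⟩).subst
            (fun r : Fin (d - j) => t ⟨j + 1 + r, by omega⟩) -
        (invSeries j fun r : Fin (j + 1) => a ⟨r, by omega⟩).subst
          (fun r : Fin j => t ⟨r, by omega⟩ - t j) *
          expSeries (logSym (a 0) (a (Fin.last (d + 1)))) j *
          (symSeries fun r : Fin (d - j + 1) => a ⟨j + 1 + r, by omega⟩).subst
            (fun r : Fin (d - j) => t ⟨j + 1 + r, by omega⟩ - t j))
termination_by d => d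

/-- The map `INV`, which fixes the regular symbols. The sign comes from the signs of the variables in
`INV([y_{d-1}⁻¹, …, y_0⁻¹ | -t_{d-1}, …, -t_0])`. -/
def INV : Hbar →ₐ[ℚ] Hsymb :=
  MvPolynomial.aeval fun g => match g with
    | .log r => MvPolynomial.X (.log r)
    | .reg d i n => MvPolynomial.X (.poly d i n)
    | .inv d i n =>
      (-1) ^ (∑ r, ((n r : ℕ) - 1)) * MvPowerSeries.coeff (shift n) (invSeries (d + 1) i)

/-- The coproduct of `H^symb`: the restriction of `INV ∘ Δ` to `H^symb`. -/
def comulH : Hsymb →ₐ[ℚ] Hsymb ⊗[ℚ] Hsymb :=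
  ((Algebra.TensorProduct.map INV INV).comp comulBar).comp toBar

/-- The generators that involve only the first `N` variables `x 0, …, x (N - 1)`. -/
def Gen.InFirst (N : ℕ) : Gen → Prop
  | .log r => r < N
  | .poly _ i _ => ∀ r, i r < N + 1

/-- The subalgebra of `H^symb` generated by the symbols in the first `N` variables. -/
def Hsymb.first (N : ℕ) : Subalgebra ℚ Hsymb :=
  Algebra.adjoin ℚ (MvPolynomial.X '' {g | g.InFirst N})

/-- The symbol `[x 0, …, x d]_n`. -/
def stdSym {d : ℕ} (n : Fin (d + 1) → ℕ+) : Hsymb :=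
  MvPolynomial.X (.poly d (Fin.valOrderEmb (d + 2)) n)

/-! ### Contraction systems -/

/-- A contraction system: sets `X_1, X_2, …`, where `X_{n+1}` is `obj n`, with contraction maps.
A contraction from depth `n + 1` to depth `d + 1` is a strictly increasing sequence of `d + 2` numbers
among `n + 2` ones, and `j.trans i` is the composite sequence `i | j`. -/
structure ContractionSystem where
  obj : ℕ → Type u
  contract : ∀ {n d : ℕ}, (Fin (d + 2) ↪o Fin (n + 2)) → obj n → obj d
  contract_refl : ∀ {n : ℕ} (α : obj n), contract (RelEmbedding.refl _) α = α
  contract_contract : ∀ {n d f : ℕ} (i : Fin (d + 2) ↪o Fin (n + 2)) (j : Fin (f + 2) ↪o Fin (d + 2))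
    (α : obj n), contract j (contract i α) = contract (j.trans i) α

namespace ContractionSystem

/-- A morphism of contraction systems. -/
structure Hom (X : ContractionSystem.{u}) (Y : ContractionSystem.{v}) where
  app : ∀ n, X.obj n → Y.obj n
  app_contract : ∀ {n d : ℕ} (i : Fin (d + 2) ↪o Fin (n + 2)) (α : X.obj n),
    app d (X.contract i α) = Y.contract i (app n α)

/-- The contraction `(a, b)` to depth `1`. -/
def pair {n : ℕ} {a b : Fin (n + 2)} (h : a < b) : Fin 2 ↪o Fin (n + 2) :=
  OrderEmbedding.ofStrictMono ![a, b] (by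
    rw [Fin.strictMono_iff_lt_succ]
    intro i
    fin_cases i
    exact h)

variable (X : ContractionSystem.{u})

/-- The symbols `[α]_0`, `α ∈ X_1`, and `[α]_n`, `α ∈ X_{d+1}`. -/
inductive Gen : Type u
  | log (α : X.obj 0) : Gen
  | poly (d : ℕ) (α : X.obj d) (n : Fin (d + 1) → ℕ+) : Gen

variable {X} in
/-- The weight of a symbol; `[α]_0` has weight `1`. -/
def Gen.weight : X.Gen → ℕ
  | .log _ => 1
  | .poly _ _ n => ∑ r, (n r : ℕ)

/-- The relations `[(i₁,i₂)α]_0 + [(i₂,i₃)α]_0 = [(i₁,i₃)α]_0`. -/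
inductive Rel : MvPolynomial X.Gen ℚ → Prop
  | mk {n : ℕ} (α : X.obj n) {i₁ i₂ i₃ : Fin (n + 2)} (h₁₂ : i₁ < i₂) (h₂₃ : i₂ < i₃) :
    Rel (MvPolynomial.X (.log (X.contract (pair h₁₂) α)) +
      MvPolynomial.X (.log (X.contract (pair h₂₃) α)) -
        MvPolynomial.X (.log (X.contract (pair (h₁₂.trans h₂₃)) α)))

/-- The free contraction algebra `H(X)`. -/
abbrev Alg : Type u := MvPolynomial X.Gen ℚ ⧸ Ideal.span {p | X.Rel p}

variable {X} in
/-- `[α]_0` in `H(X)`. -/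
def logSym (α : X.obj 0) : X.Alg := Ideal.Quotient.mk _ (MvPolynomial.X (.log α))

variable {X} in
/-- `[α]_n` in `H(X)`. -/
def sym {d : ℕ} (α : X.obj d) (n : Fin (d + 1) → ℕ+) : X.Alg :=
  Ideal.Quotient.mk _ (MvPolynomial.X (.poly d α n))

/-- The part of weight `n` of `H(X)`: the classes of the polynomials homogeneous of weight `n`. -/
def weightPart (n : ℕ) : Submodule ℚ X.Alg :=
  (MvPolynomial.weightedHomogeneousSubmodule ℚ (Gen.weight (X := X)) n).map
    (Ideal.Quotient.mkₐ ℚ (Ideal.span {p | X.Rel p})).toLinearMap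

variable {X}

theorem logSym_rel {n : ℕ} (α : X.obj n) {i₁ i₂ i₃ : Fin (n + 2)} (h₁₂ : i₁ < i₂) (h₂₃ : i₂ < i₃) :
    logSym (X.contract (pair h₁₂) α) + logSym (X.contract (pair h₂₃) α) =
      logSym (X.contract (pair (h₁₂.trans h₂₃)) α) := by
  have h := Ideal.Quotient.eq_zero_iff_mem.2
    (Ideal.subset_span (s := {p | X.Rel p}) (Rel.mk α h₁₂ h₂₃))
  rw [map_sub, map_add, sub_eq_zero] at h
  exact h

/-- The algebra homomorphism out of `H(X)` with given values on the symbols. -/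
def lift {A : Type v} [CommRing A] [Algebra ℚ A] (L : X.obj 0 → A)
    (P : ∀ d, X.obj d → (Fin (d + 1) → ℕ+) → A)
    (hL : ∀ {n : ℕ} (α : X.obj n) {i₁ i₂ i₃ : Fin (n + 2)} (h₁₂ : i₁ < i₂) (h₂₃ : i₂ < i₃),
      L (X.contract (pair h₁₂) α) + L (X.contract (pair h₂₃) α) =
        L (X.contract (pair (h₁₂.trans h₂₃)) α)) : X.Alg →ₐ[ℚ] A :=
  Ideal.Quotient.liftₐ _
    (MvPolynomial.aeval fun g => match g with
      | .log α => L α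
      | .poly d α n => P d α n)
    (fun p hp => by
      rw [← RingHom.mem_ker]
      refine (Ideal.span_le.2 ?_ : Ideal.span {p | X.Rel p} ≤ _) hp
      rintro _ ⟨α, h₁₂, h₂₃⟩
      simp [RingHom.mem_ker, hL α h₁₂ h₂₃])

open Classical in
/-- The evaluation `ev_α` at `α ∈ X_{N+1}`, with
`ev_α [i(x 0, …, x N)]_n = [i(α)]_n`. It matters only on the symbols in `x 0, …, x N`, and is set to
`0` on the other ones. -/
def ev {N : ℕ} (α : X.obj N) : Hsymb →ₐ[ℚ] X.Alg :=
  MvPolynomial.aeval fun g => match g with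
    | .log r =>
      if h : r < N + 1 then
        logSym (X.contract (pair (a := ⟨r, by omega⟩) (b := ⟨r + 1, by omega⟩)
          (by simp)) α)
      else 0
    | .poly _ i n =>
      if h : ∀ r, i r < N + 2 then
        sym (X.contract (OrderEmbedding.ofStrictMono (fun r => (⟨i r, h r⟩ : Fin (N + 2)))
          fun _ _ hrs => i.strictMono hrs) α) n
      else 0

variable (X)

/-- The coproduct `Δ_X` of `H(X)`: `[α]_0` is primitive, and
`Δ_X [α]_n = ev_α (Δ [x 0, …, x d]_n)`. -/
def comul : X.Alg →ₐ[ℚ] X.Alg ⊗[ℚ] X.Alg :=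
  lift (fun α => logSym α ⊗ₜ 1 + 1 ⊗ₜ logSym α)
    (fun _ α n => Algebra.TensorProduct.map (ev α) (ev α) (comulH (stdSym n)))
    (fun α _ _ _ h₁₂ h₂₃ => by
      rw [← logSym_rel α h₁₂ h₂₃, TensorProduct.add_tmul, TensorProduct.tmul_add]
      abel)

/-- The counit of `H(X)`, which kills all symbols. -/
def counit : X.Alg →ₐ[ℚ] ℚ :=
  lift (fun _ => 0) (fun _ _ _ => 0) (fun _ _ _ _ _ _ => add_zero 0)

/-- The algebra homomorphism induced by a morphism of contraction systems. -/
def Hom.map {X : ContractionSystem.{u}} {Y : ContractionSystem.{v}} (f : X.Hom Y) :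
    X.Alg →ₐ[ℚ] Y.Alg :=
  lift (fun α => logSym (f.app 0 α)) (fun d α n => sym (f.app d α) n)
    (fun α _ _ _ h₁₂ h₂₃ => by
      rw [f.app_contract, f.app_contract, f.app_contract, logSym_rel])

theorem algHom_ext {A : Type v} [CommRing A] [Algebra ℚ A] {f g : X.Alg →ₐ[ℚ] A}
    (hL : ∀ α, f (logSym α) = g (logSym α))
    (hP : ∀ (d : ℕ) (α : X.obj d) (n : Fin (d + 1) → ℕ+), f (sym α n) = g (sym α n)) : f = g := by
  apply Ideal.Quotient.algHom_ext
  apply MvPolynomial.algHom_ext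
  rintro (α | ⟨d, α, n⟩)
  · exact hL α
  · exact hP d α n

@[simp]
theorem Hom.map_logSym {X : ContractionSystem.{u}} {Y : ContractionSystem.{v}} (f : X.Hom Y)
    (α : X.obj 0) : f.map (logSym α) = logSym (f.app 0 α) := by
  change MvPolynomial.aeval _ (MvPolynomial.X _) = _
  simp

@[simp]
theorem Hom.map_sym {X : ContractionSystem.{u}} {Y : ContractionSystem.{v}} (f : X.Hom Y)
    {d : ℕ} (α : X.obj d) (n : Fin (d + 1) → ℕ+) : f.map (sym α n) = sym (f.app d α) n := by
  change MvPolynomial.aeval _ (MvPolynomial.X _) = _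
  simp

/-- The identity morphism. -/
def Hom.refl (X : ContractionSystem.{u}) : X.Hom X := ⟨fun _ α => α, fun _ _ => rfl⟩

/-- The composition of morphisms, first `f`, then `g`. -/
def Hom.comp {X Y Z : ContractionSystem.{u}} (f : X.Hom Y) (g : Y.Hom Z) : X.Hom Z :=
  ⟨fun n α => g.app n (f.app n α), fun i α => by rw [f.app_contract, g.app_contract]⟩

theorem Hom.map_refl (X : ContractionSystem.{u}) : (Hom.refl X).map = AlgHom.id ℚ X.Alg :=
  algHom_ext _ (fun _ => Hom.map_logSym _ _) (fun _ _ _ => Hom.map_sym _ _ _)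

theorem Hom.map_comp {X Y Z : ContractionSystem.{u}} (f : X.Hom Y) (g : Y.Hom Z) :
    (f.comp g).map = g.map.comp f.map :=
  algHom_ext _ (fun _ => by simp [Hom.comp]) (fun _ _ _ => by simp [Hom.comp])

end ContractionSystem

/-- The commutative algebra `A` with the grading `𝒜`, the coproduct `Δ` and the counit `ε` is a graded
Hopf algebra: the grading is an algebra grading that `Δ`, `ε` and the antipode respect, and `Δ`
(coassociative) and `ε` (a counit) are the coproduct and the counit of a Hopf algebra structure on the
`ℚ`-algebra `A`. -/
structure IsGradedHopfAlgebra {A : Type u} [CommRing A] [Algebra ℚ A] (𝒜 : ℕ → Submodule ℚ A)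
    (Δ : A →ₐ[ℚ] A ⊗[ℚ] A) (ε : A →ₐ[ℚ] ℚ) : Prop where
  graded : Nonempty (GradedAlgebra 𝒜)
  comul_mem : ∀ n, ∀ a ∈ 𝒜 n, Δ a ∈ ⨆ p ∈ Finset.HasAntidiagonal.antidiagonal n,
    LinearMap.range (TensorProduct.map (𝒜 p.1).subtype (𝒜 p.2).subtype)
  counit_eq_zero : ∀ n, n ≠ 0 → ∀ a ∈ 𝒜 n, ε a = 0
  hopf : ∃ h₁ h₂ h₃, ∃ H : HopfAlgebra ℚ A, H.toBialgebra = Bialgebra.ofAlgHom Δ ε h₁ h₂ h₃ ∧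
    ∀ n, ∀ a ∈ 𝒜 n, H.antipode a ∈ 𝒜 n

/-- The free contraction algebra `H(X)`, graded by the weight, is a graded Hopf algebra with the
coproduct `Δ_X`. -/
def ContractionSystem.IsHopf (X : ContractionSystem.{u}) : Prop :=
  IsGradedHopfAlgebra X.weightPart X.comul X.counit

/-! ### Examples of contraction systems -/

section Block

/-- `x_{a → b} = ∏_{a ≤ r < b} x r`, for a family `x 0, …, x n` and `0 ≤ a, b ≤ n + 1`. The additive
version `blockSum` is `u_{a → b} = ∑_{a ≤ r < b} u r`. -/
@[to_additive]
def blockProd {G : Type u} [CommMonoid G] {n : ℕ} (x : Fin (n + 1) → G) (a b : Fin (n + 2)) : G :=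
  ∏ r with a ≤ Fin.castSucc r ∧ Fin.castSucc r < b, x r

variable {G : Type u} [CommMonoid G]

@[to_additive]
theorem blockProd_mul {n : ℕ} (x : Fin (n + 1) → G) {a b c : Fin (n + 2)} (hab : a ≤ b)
    (hbc : b ≤ c) : blockProd x a b * blockProd x b c = blockProd x a c := by
  unfold blockProd
  rw [← Finset.prod_union]
  · congr 1
    ext r
    simp only [Finset.mem_union, Finset.mem_filter, Finset.mem_univ, true_and]
    grind
  · rw [Finset.disjoint_left]
    intro r
    simp only [Finset.mem_filter, Finset.mem_univ, true_and]
    grind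

@[to_additive]
theorem blockProd_self {n : ℕ} (x : Fin (n + 1) → G) (a : Fin (n + 2)) : blockProd x a a = 1 := by
  unfold blockProd
  rw [Finset.filter_eq_empty_iff.2, Finset.prod_empty]
  grind

@[to_additive]
theorem blockProd_succ {n : ℕ} (x : Fin (n + 1) → G) (s : Fin (n + 1)) :
    blockProd x s.castSucc s.succ = x s := by
  unfold blockProd
  rw [Finset.prod_eq_single_of_mem s (by simp)]
  simp
  grind

@[to_additive]
theorem blockProd_blockProd {n d : ℕ} (x : Fin (n + 1) → G) (i : Fin (d + 2) ↪o Fin (n + 2))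
    {a b : Fin (d + 2)} (hab : a ≤ b) :
    blockProd (fun s : Fin (d + 1) => blockProd x (i s.castSucc) (i s.succ)) a b =
      blockProd x (i a) (i b) := by
  induction b using Fin.induction with
  | zero =>
    obtain rfl : a = 0 := le_antisymm hab (Fin.zero_le a)
    rw [blockProd_self, blockProd_self]
  | succ b ih =>
    rcases hab.eq_or_lt with rfl | h
    · rw [blockProd_self, blockProd_self]
    · have h' : a ≤ b.castSucc := Fin.le_castSucc_iff.2 h
      have hb : b.castSucc ≤ b.succ := b.castSucc_le_succ
      rw [← blockProd_mul _ h' hb, ih h', blockProd_succ, blockProd_mul _ (i.monotone h')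
        (i.monotone hb)]

end Block

namespace ContractionSystem

/-- The contraction system of a field `F`: tuples `x` of nonzero elements with `x_{a → b} ≠ 1` for
`a < b`, that is, `∏_{r = i}^j x r ≠ 1` for `i ≤ j = b - 1`. -/
def ofField (F : Type u) [Field F] : ContractionSystem.{u} where
  obj n := {x : Fin (n + 1) → F // (∀ s, x s ≠ 0) ∧ ∀ a b : Fin (n + 2), a < b → blockProd x a b ≠ 1}
  contract i x := ⟨fun s => blockProd x.1 (i s.castSucc) (i s.succ),
    fun _ => Finset.prod_ne_zero_iff.2 fun r _ => x.2.1 r,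
    fun a b hab => by
      rw [blockProd_blockProd x.1 i hab.le]
      exact x.2.2 _ _ (i.strictMono hab)⟩
  contract_refl x := Subtype.ext (funext fun s => blockProd_succ x.1 s)
  contract_contract i j x := Subtype.ext (funext fun s =>
    blockProd_blockProd x.1 i (j.monotone s.castSucc_le_succ))

/-- For a map `e : E → F`, the contraction system of the `(u_i, v_{i,j})` with
`e (∑_{r = i}^j u_r) + e v_{i,j} = 1` for all `i ≤ j`. The pair `i ≤ j` is recorded as `i < j + 1`, so
that `v (a, b)` is `v_{a, b - 1}`. -/
def hat {E : Type u} [AddCommMonoid E] {F : Type v} [Add F] [One F] (e : E → F) :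
    ContractionSystem.{u} where
  obj n := {p : (Fin (n + 1) → E) × ({q : Fin (n + 2) × Fin (n + 2) // q.1 < q.2} → E) //
    ∀ q, e (blockSum p.1 q.1.1 q.1.2) + e (p.2 q) = 1}
  contract i p := ⟨(fun s => blockSum p.1.1 (i s.castSucc) (i s.succ),
      fun q => p.1.2 ⟨(i q.1.1, i q.1.2), i.strictMono q.2⟩),
    fun q => by
      rw [blockSum_blockSum p.1.1 i q.2.le]
      exact p.2 ⟨(i q.1.1, i q.1.2), i.strictMono q.2⟩⟩
  contract_refl p := Subtype.ext (Prod.ext (funext fun s => blockSum_succ p.1.1 s) rfl)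
  contract_contract i j p := Subtype.ext (Prod.ext (funext fun s =>
    blockSum_blockSum p.1.1 i (j.monotone s.castSucc_le_succ)) rfl)

end ContractionSystem

/-- A torsion free extension `π : E → F^*` of the multiplicative group of a field by `ℤ`. -/
structure IsTorsionFreeExtension {E F : Type*} [AddCommGroup E] [Field F] (π : E →+ Additive Fˣ) :
    Prop where
  torsionFree : IsAddTorsionFree E
  surjective : Function.Surjective π
  ker : Nonempty (π.ker ≃+ ℤ)

namespace ContractionSystem

/-- The contraction system of an extension `π : E → F^*`. -/
def ofExtension {E : Type u} {F : Type v} [AddCommGroup E] [Field F] (π : E →+ Additive Fˣ) :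
    ContractionSystem.{u} :=
  hat fun x => ((π x).toMul : F)

open CategoryTheory in
/-- The contraction system of a semisimplicial set `S`, with `X_k = S_k` for `k ≥ 1`. -/
def ofSemisimplicial (S : SemiSimplexCategoryᵒᵖ ⥤ Type u) : ContractionSystem.{u} where
  obj n := S.obj (.op ⟨n + 1⟩)
  contract {n d} i := S.map (Quiver.Hom.op
    ((SemiSimplexCategory.homEquiv (n := ⟨d + 1⟩) (m := ⟨n + 1⟩)).symm i))
  contract_refl α := by
    refine Eq.trans ?_ (S.map_id_apply _ α)
    rfl
  contract_contract i j α := by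
    refine (S.map_comp_apply _ _ α).symm.trans ?_
    have h : (SemiSimplexCategory.homEquiv (n := ⟨_ + 1⟩) (m := ⟨_ + 1⟩)).symm j ≫
        (SemiSimplexCategory.homEquiv (n := ⟨_ + 1⟩) (m := ⟨_ + 1⟩)).symm i =
        SemiSimplexCategory.homEquiv.symm (j.trans i) :=
      SemiSimplexCategory.hom_ext (by
        rw [SemiSimplexCategory.homEquiv_comp, Equiv.apply_symm_apply, Equiv.apply_symm_apply,
          Equiv.apply_symm_apply])
    rw [← op_comp, h]

open CategoryTheory in
/-- The contraction system of a simplicial set. -/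
def ofSimplicial (S : SSet.{u}) : ContractionSystem.{u} :=
  ofSemisimplicial (SemiSimplexCategory.toSimplexCategory.op ⋙ S)

end ContractionSystem

/-! ### The sheaf on a complex manifold -/

section Sheaf

open CategoryTheory TopologicalSpace Opposite MonoidalCategory

variable {E : Type} [NormedAddCommGroup E] [NormedSpace ℂ E]
  {M : Type} [TopologicalSpace M] [ChartedSpace E M]

/-- The space `\hat S_{n+1}(ℂ)` of the `(u_i, v_{i,j})` in `ℂ^N` with
`exp (∑_{r = i}^j u_r) + exp v_{i,j} = 1` for all `i ≤ j`. -/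
abbrev HatS (n : ℕ) : Type := (ContractionSystem.hat Complex.exp).obj n

/-- A map to `\hat S_{n+1}(ℂ)` is holomorphic if all of its coordinates are. -/
def IsHolomorphic (E : Type) [NormedAddCommGroup E] [NormedSpace ℂ E] {M : Type}
    [TopologicalSpace M] [ChartedSpace E M] {U : Opens M} {n : ℕ} (f : U → HatS n) : Prop :=
  (∀ s, MDifferentiable 𝓘(ℂ, E) 𝓘(ℂ, ℂ) fun z => (f z).1.1 s) ∧
    ∀ q, MDifferentiable 𝓘(ℂ, E) 𝓘(ℂ, ℂ) fun z => (f z).1.2 q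

/-- The contraction system of the holomorphic maps `U → \hat S_k(ℂ)`, with pointwise contractions. -/
def ContractionSystem.ofOpen (E : Type) [NormedAddCommGroup E] [NormedSpace ℂ E] {M : Type}
    [TopologicalSpace M] [ChartedSpace E M] (U : Opens M) : ContractionSystem.{0} where
  obj n := {f : U → HatS n // IsHolomorphic E f}
  contract i f := ⟨fun z => (ContractionSystem.hat Complex.exp).contract i (f.1 z), by
    refine ⟨fun s => ?_, fun q => f.2.2 _⟩
    have h := MDifferentiable.sum
      (t := Finset.univ.filter fun r => i s.castSucc ≤ Fin.castSucc r ∧ Fin.castSucc r < i s.succ)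
      (f := fun r (z : U) => (f.1 z).1.1 r) fun r _ => f.2.1 r
    convert h using 1
    ext z
    rw [Finset.sum_apply]
    rfl⟩
  contract_refl f := Subtype.ext (funext fun z => ContractionSystem.contract_refl _ (f.1 z))
  contract_contract i j f :=
    Subtype.ext (funext fun z => ContractionSystem.contract_contract _ i j (f.1 z))

/-- Restriction of holomorphic maps to a smaller open set. -/
def restrict {U V : Opens M} (h : V ≤ U) :
    (ContractionSystem.ofOpen E U).Hom (ContractionSystem.ofOpen E V) where
  app _ f := ⟨fun z => f.1 (Set.inclusion h z),
    fun s => (f.2.1 s).comp ((contMDiff_inclusion (n := 1) h).mdifferentiable one_ne_zero),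
    fun q => (f.2.2 q).comp ((contMDiff_inclusion (n := 1) h).mdifferentiable one_ne_zero)⟩
  app_contract _ _ := rfl

theorem restrict_refl (U : Opens M) :
    restrict (E := E) (le_refl U) = ContractionSystem.Hom.refl _ := rfl

theorem restrict_trans {U V W : Opens M} (h : V ≤ U) (h' : W ≤ V) :
    restrict (E := E) (h'.trans h) = (restrict h).comp (restrict h') := rfl

/-- The presheaf `U ↦ H(X(U))` of `ℚ`-vector spaces, with `X(U)_k` the set of holomorphic maps from
`U` to `\hat S_k(ℂ)`. -/
def presheaf (E M : Type) [NormedAddCommGroup E] [NormedSpace ℂ E] [TopologicalSpace M]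
    [ChartedSpace E M] : (Opens (TopCat.of M))ᵒᵖ ⥤ ModuleCat.{0} ℚ where
  obj U := ModuleCat.of ℚ (ContractionSystem.ofOpen E (M := M) U.unop).Alg
  map f := ModuleCat.ofHom (restrict (E := E) (M := M) (leOfHom f.unop)).map.toLinearMap
  map_id U := by
    refine ModuleCat.hom_ext (LinearMap.ext fun x => ?_)
    change (restrict (E := E) (M := M) (le_refl U.unop)).map x = x
    rw [restrict_refl, ContractionSystem.Hom.map_refl]
    rfl
  map_comp f g := by
    refine ModuleCat.hom_ext (LinearMap.ext fun x => ?_)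
    change (restrict (E := E) (M := M) ((leOfHom g.unop).trans (leOfHom f.unop))).map x =
      (restrict (E := E) (M := M) (leOfHom g.unop)).map
        ((restrict (E := E) (M := M) (leOfHom f.unop)).map x)
    rw [restrict_trans, ContractionSystem.Hom.map_comp]
    rfl

attribute [local instance] CategoryTheory.Sheaf.monoidalCategory
  CategoryTheory.Sheaf.braidedCategory

/-- The sheaf associated with the presheaf `U ↦ H(X(U))`. -/
def sheaf (E M : Type) [NormedAddCommGroup E] [NormedSpace ℂ E] [TopologicalSpace M]
    [ChartedSpace E M] : Sheaf (Opens.grothendieckTopology (TopCat.of M)) (ModuleCat.{0} ℚ) :=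
  (presheafToSheaf _ _).obj (presheaf E M)

/-- The presheaf `U ↦ H(X(U))` is a presheaf of Hopf algebras with the multiplication, unit,
coproduct and counit of the algebras `H(X(U))`, and the associated sheaf is a sheaf of Hopf algebras
(a Hopf monoid in the tensor category of sheaves of `ℚ`-vector spaces) with the structure maps that
these induce on associated sheaves. -/
def IsSheafOfHopfAlgebras (E M : Type) [NormedAddCommGroup E] [NormedSpace ℂ E]
    [TopologicalSpace M] [ChartedSpace E M] : Prop :=
  ∃ (P : HopfObj (presheaf E M)) (S : HopfObj (sheaf E M)),
    (∀ U : (Opens (TopCat.of M))ᵒᵖ,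
      let X := ContractionSystem.ofOpen E (M := M) U.unop
      P.mul.app U = ModuleCat.ofHom (LinearMap.mul' ℚ X.Alg) ∧
      P.one.app U = ModuleCat.ofHom (Algebra.linearMap ℚ X.Alg) ∧
      P.comul.app U = ModuleCat.ofHom X.comul.toLinearMap ∧
      P.counit.app U = ModuleCat.ofHom X.counit.toLinearMap) ∧
    let F := presheafToSheaf (Opens.grothendieckTopology (TopCat.of M)) (ModuleCat.{0} ℚ)
    S.mul = Functor.LaxMonoidal.μ F _ _ ≫ F.map P.mul ∧
    S.one = Functor.LaxMonoidal.ε F ≫ F.map P.one ∧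
    S.comul = F.map P.comul ≫ Functor.OplaxMonoidal.δ F _ _ ∧
    S.counit = F.map P.counit ≫ Functor.OplaxMonoidal.η F

end Sheaf

end SymbPolylog

end

noncomputable section

namespace SymbPolylog

/-! ### Series of paths

A path from a name `n` is a list of letters, each of which carries a label in `Λ` and the name at
which it ends. A series assigns a coefficient to every start and path. -/

/-- Series of paths on the vertex set `N` with edges labelled by `Λ`. -/
def PathSeries (N Λ K : Type) : Type := N → List (Λ × N) → K

namespace PathSeries

variable {N Λ K : Type}

@[ext]
theorem ext {f g : PathSeries N Λ K} (h : ∀ n w, f n w = g n w) : f = g :=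
  funext fun n => funext fun w => h n w

/-- The last name of a path. -/
def last (n : N) : List (Λ × N) → N
  | [] => n
  | (_, m) :: w => last m w

@[simp] theorem last_nil (n : N) : last n ([] : List (Λ × N)) = n := rfl

@[simp] theorem last_cons (n : N) (x : Λ × N) (w : List (Λ × N)) : last n (x :: w) = last x.2 w := rfl

@[simp] theorem last_append (n : N) (w w' : List (Λ × N)) :
    last n (w ++ w') = last (last n w) w' := by
  induction w generalizing n with
  | nil => rfl
  | cons x w ih => simp [ih]

theorem last_mem (n : N) (w : List (Λ × N)) : last n w = n ∨ ∃ x ∈ w, x.2 = last n w := by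
  induction w generalizing n with
  | nil => simp
  | cons x w ih =>
    rcases ih x.2 with h | ⟨y, hy, h⟩
    · exact .inr ⟨x, by simp, by simp [h]⟩
    · exact .inr ⟨y, by simp [hy], by simp [h]⟩

/-- The coefficients of the paths that start with a letter `a` from `n`. -/
def der (n : N) (a : Λ) (f : PathSeries N Λ K) : PathSeries N Λ K := fun m w => f n ((a, m) :: w)

section Ring

variable [CommRing K]

instance : AddCommGroup (PathSeries N Λ K) := inferInstanceAs (AddCommGroup (N → List (Λ × N) → K))

instance : Module K (PathSeries N Λ K) := inferInstanceAs (Module K (N → List (Λ × N) → K))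

@[simp] theorem zero_apply (n : N) (w : List (Λ × N)) : (0 : PathSeries N Λ K) n w = 0 := rfl
@[simp] theorem add_apply (f g : PathSeries N Λ K) (n : N) (w : List (Λ × N)) :
    (f + g) n w = f n w + g n w := rfl
@[simp] theorem neg_apply (f : PathSeries N Λ K) (n : N) (w : List (Λ × N)) :
    (-f) n w = -f n w := rfl
@[simp] theorem sub_apply (f g : PathSeries N Λ K) (n : N) (w : List (Λ × N)) :
    (f - g) n w = f n w - g n w := rfl
@[simp] theorem smul_apply (c : K) (f : PathSeries N Λ K) (n : N) (w : List (Λ × N)) :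
    (c • f) n w = c * f n w := rfl
@[simp] theorem sum_apply {ι : Type*} (s : Finset ι) (f : ι → PathSeries N Λ K) (n : N)
    (w : List (Λ × N)) : (∑ i ∈ s, f i) n w = ∑ i ∈ s, f i n w := by
  classical
  induction s using Finset.induction_on with
  | empty => rfl
  | insert a s ha ih => rw [Finset.sum_insert ha, Finset.sum_insert ha, add_apply, ih]

@[simp] theorem der_add (n : N) (a : Λ) (f g : PathSeries N Λ K) :
    der n a (f + g) = der n a f + der n a g := rfl
@[simp] theorem der_smul (n : N) (a : Λ) (c : K) (f : PathSeries N Λ K) :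
    der n a (c • f) = c • der n a f := rfl

/-- The product of series, by concatenation of paths. -/
def mul : PathSeries N Λ K → PathSeries N Λ K → N → List (Λ × N) → K
  | f, g, n, [] => f n [] * g n []
  | f, g, n, (a, m) :: w => f n [] * g n ((a, m) :: w) + mul (der n a f) g m w

instance : Mul (PathSeries N Λ K) := ⟨mul⟩

@[simp] theorem mul_nil (f g : PathSeries N Λ K) (n : N) : (f * g) n [] = f n [] * g n [] := rfl

theorem mul_cons (f g : PathSeries N Λ K) (n : N) (a : Λ) (m : N) (w : List (Λ × N)) :
    (f * g) n ((a, m) :: w) = f n [] * g n ((a, m) :: w) + (der n a f * g) m w := rfl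

theorem der_mul (n : N) (a : Λ) (f g : PathSeries N Λ K) :
    der n a (f * g) = f n [] • der n a g + der n a f * g := rfl

theorem mul_apply (f g : PathSeries N Λ K) (n : N) (w : List (Λ × N)) :
    (f * g) n w = ∑ k ∈ Finset.range (w.length + 1),
      f n (w.take k) * g (last n (w.take k)) (w.drop k) := by
  induction w generalizing f n with
  | nil => simp
  | cons x w ih =>
    rw [mul_cons, ih, List.length_cons, Finset.sum_range_succ' _ (w.length + 1), add_comm]
    simp [der]

/-- A diagonal series, supported on the empty paths. -/
def diag (c : N → K) : PathSeries N Λ K := fun n w => match w with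
  | [] => c n
  | _ :: _ => 0

@[simp] theorem diag_nil (c : N → K) (n : N) : (diag c : PathSeries N Λ K) n [] = c n := rfl
@[simp] theorem diag_cons (c : N → K) (n : N) (x : Λ × N) (w : List (Λ × N)) :
    (diag c : PathSeries N Λ K) n (x :: w) = 0 := rfl
@[simp] theorem der_diag (c : N → K) (n : N) (a : Λ) :
    der n a (diag c : PathSeries N Λ K) = 0 := rfl

instance : One (PathSeries N Λ K) := ⟨diag 1⟩

theorem one_def : (1 : PathSeries N Λ K) = diag 1 := rfl
@[simp] theorem one_nil (n : N) : (1 : PathSeries N Λ K) n [] = 1 := rfl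
@[simp] theorem one_cons (n : N) (x : Λ × N) (w : List (Λ × N)) :
    (1 : PathSeries N Λ K) n (x :: w) = 0 := rfl

theorem zero_mul' (f : PathSeries N Λ K) : 0 * f = 0 := by
  ext n w; rw [mul_apply]; simp

theorem add_mul' (f g h : PathSeries N Λ K) : (f + g) * h = f * h + g * h := by
  ext n w; simp [mul_apply, add_mul, Finset.sum_add_distrib]

theorem mul_add' (f g h : PathSeries N Λ K) : f * (g + h) = f * g + f * h := by
  ext n w; simp [mul_apply, mul_add, Finset.sum_add_distrib]

theorem smul_mul' (c : K) (f g : PathSeries N Λ K) : (c • f) * g = c • (f * g) := by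
  ext n w; simp [mul_apply, Finset.mul_sum, mul_assoc]

theorem mul_smul' (c : K) (f g : PathSeries N Λ K) : f * (c • g) = c • (f * g) := by
  ext n w; simp [mul_apply, Finset.mul_sum, mul_left_comm]

theorem mul_assoc' (f g h : PathSeries N Λ K) : f * g * h = f * (g * h) := by
  ext n w
  induction w generalizing f n with
  | nil => simp [mul_assoc]
  | cons x w ih =>
    obtain ⟨a, m⟩ := x
    rw [mul_cons, der_mul, add_mul', smul_mul', mul_cons, mul_cons, add_apply, ih]
    simp
    ring

theorem diag_mul_apply (c : N → K) (f : PathSeries N Λ K) (n : N) (w : List (Λ × N)) :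
    (diag c * f : PathSeries N Λ K) n w = c n * f n w := by
  cases w with
  | nil => simp
  | cons x w => obtain ⟨a, m⟩ := x; rw [mul_cons, der_diag, zero_mul']; simp

theorem mul_diag_apply (c : N → K) (f : PathSeries N Λ K) (n : N) (w : List (Λ × N)) :
    (f * diag c : PathSeries N Λ K) n w = f n w * c (last n w) := by
  induction w generalizing f n with
  | nil => simp
  | cons x w ih => obtain ⟨a, m⟩ := x; rw [mul_cons, ih]; simp [der]

instance : Ring (PathSeries N Λ K) where
  __ := (inferInstance : AddCommGroup (PathSeries N Λ K))
  mul_assoc := mul_assoc'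
  left_distrib := mul_add'
  right_distrib := add_mul'
  zero_mul := zero_mul'
  mul_zero f := by ext n w; rw [mul_apply]; simp
  one_mul f := by ext n w; rw [one_def, diag_mul_apply]; simp
  mul_one f := by ext n w; rw [one_def, mul_diag_apply]; simp

instance : Algebra K (PathSeries N Λ K) :=
  Algebra.ofModule smul_mul' fun c f g => mul_smul' c f g

theorem diag_mul_diag (c c' : N → K) : (diag c * diag c' : PathSeries N Λ K) = diag (c * c') := by
  ext n w
  rw [diag_mul_apply]
  cases w <;> simp

open Classical in
/-- The letter `a`: the sum of all paths of length `1` with label `a`. -/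
def letter (a : Λ) : PathSeries N Λ K := fun _ w => match w with
  | [x] => if x.1 = a then 1 else 0
  | _ => 0

@[simp] theorem letter_nil (a : Λ) (n : N) : (letter a : PathSeries N Λ K) n [] = 0 := rfl

open Classical in
theorem der_letter (n : N) (a b : Λ) :
    der n b (letter a : PathSeries N Λ K) = if b = a then 1 else 0 := by
  ext m w
  cases w with
  | nil => simp [der, letter]; split_ifs <;> rfl
  | cons x w => simp [der, letter]; split_ifs <;> rfl

open Classical in
theorem letter_mul_cons (a : Λ) (f : PathSeries N Λ K) (n : N) (b : Λ) (m : N) (w : List (Λ × N)) :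
    (letter a * f : PathSeries N Λ K) n ((b, m) :: w) = if b = a then f m w else 0 := by
  rw [mul_cons, der_letter]
  split_ifs <;> simp

open Classical in
theorem mul_letter_append (a : Λ) (f : PathSeries N Λ K) (n : N) (b : Λ) (m : N)
    (w : List (Λ × N)) : (f * letter a : PathSeries N Λ K) n (w ++ [(b, m)]) = if b = a then f n w else 0 := by
  induction w generalizing f n with
  | nil => rw [List.nil_append, mul_cons]; simp [letter, mul_ite]
  | cons x w ih =>
    obtain ⟨c, l⟩ := x
    rw [List.cons_append, mul_cons, ih]
    have : (letter a : PathSeries N Λ K) n ((c, l) :: (w ++ [(b, m)])) = 0 := by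
      cases w <;> rfl
    simp [this, der]

/-- A series is the sum of its constant part and the parts that start with given letters. -/
theorem eq_sum_letter [Fintype Λ] (f : PathSeries N Λ K) (n : N) :
    f n = (diag (fun n => f n []) + ∑ a, letter a * der n a f : PathSeries N Λ K) n := by
  classical
  funext w
  cases w with
  | nil => simp
  | cons x w => obtain ⟨b, m⟩ := x; simp [letter_mul_cons, der]

end Ring

section Agree

/-- Agreement of series on the paths whose label sequence satisfies `L` and whose names satisfy
`P`. -/
def Agree (L : List Λ → Prop) (P : N → Prop) (f g : PathSeries N Λ K) : Prop :=
  ∀ n w, P n → (∀ x ∈ w, P x.2) → L (w.map Prod.fst) → f n w = g n w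

/-- A property of lists that passes to sublists. -/
def Hereditary (L : List Λ → Prop) : Prop := ∀ l l', l.Sublist l' → L l' → L l

variable {L : List Λ → Prop} {P : N → Prop} {f f' g g' : PathSeries N Λ K}

theorem Agree.refl (f : PathSeries N Λ K) : Agree L P f f := fun _ _ _ _ _ => rfl

theorem Agree.symm (h : Agree L P f g) : Agree L P g f := fun n w hn hw hl => (h n w hn hw hl).symm

theorem Agree.trans {h : PathSeries N Λ K} (h₁ : Agree L P f g) (h₂ : Agree L P g h) :
    Agree L P f h := fun n w hn hw hl => (h₁ n w hn hw hl).trans (h₂ n w hn hw hl)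

theorem Agree.mono {L' : List Λ → Prop} {P' : N → Prop} (h : Agree L P f g) (hL : ∀ l, L' l → L l)
    (hP : ∀ n, P' n → P n) : Agree L' P' f g :=
  fun n w hn hw hl => h n w (hP _ hn) (fun x hx => hP _ (hw x hx)) (hL _ hl)

theorem last_prop {n : N} {w : List (Λ × N)} (hn : P n) (hw : ∀ x ∈ w, P x.2) : P (last n w) := by
  rcases last_mem n w with h | ⟨x, hx, h⟩
  · rwa [h]
  · rw [← h]; exact hw x hx

variable [CommRing K]

theorem Agree.add (hf : Agree L P f f') (hg : Agree L P g g') : Agree L P (f + g) (f' + g') :=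
  fun n w hn hw hl => by rw [add_apply, add_apply, hf n w hn hw hl, hg n w hn hw hl]

theorem Agree.sub (hf : Agree L P f f') (hg : Agree L P g g') : Agree L P (f - g) (f' - g') :=
  fun n w hn hw hl => by rw [sub_apply, sub_apply, hf n w hn hw hl, hg n w hn hw hl]

theorem Agree.sum {ι : Type*} {s : Finset ι} {f f' : ι → PathSeries N Λ K}
    (h : ∀ i ∈ s, Agree L P (f i) (f' i)) : Agree L P (∑ i ∈ s, f i) (∑ i ∈ s, f' i) :=
  fun n w hn hw hl => by
    rw [sum_apply, sum_apply]
    exact Finset.sum_congr rfl fun i hi => h i hi n w hn hw hl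

theorem Agree.mul (hL : Hereditary L) (hf : Agree L P f f') (hg : Agree L P g g') :
    Agree L P (f * g) (f' * g') := fun n w hn hw hl => by
  rw [mul_apply, mul_apply]
  refine Finset.sum_congr rfl fun k _ => ?_
  have h₁ : ∀ x ∈ w.take k, P x.2 := fun x hx => hw x (List.mem_of_mem_take hx)
  rw [hf n _ hn h₁ (hL _ _ ((List.take_sublist k w).map _) hl),
    hg _ _ (last_prop hn h₁) (fun x hx => hw x (List.mem_of_mem_drop hx))
      (hL _ _ ((List.drop_sublist k w).map _) hl)]

end Agree

/-! ### Substitution of series for letters -/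

section Subst

variable [CommRing K] [Fintype Λ]

/-- The part of `substSeries T f` that comes from the paths of length `k`. -/
def substPart (T : Λ → PathSeries N Λ K) : ℕ → PathSeries N Λ K → PathSeries N Λ K
  | 0, f => diag fun n => f n []
  | k + 1, f => fun n => (∑ a, T a * substPart T k (der n a f) : PathSeries N Λ K) n

/-- The substitution of the series `T a` without constant terms for the letters `a`. -/
def substSeries (T : Λ → PathSeries N Λ K) (f : PathSeries N Λ K) : PathSeries N Λ K :=
  fun n w => ∑ k ∈ Finset.range (w.length + 1), substPart T k f n w

variable {T : Λ → PathSeries N Λ K}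

omit [Fintype Λ] in
theorem mul_congr_of_length {t x y : PathSeries N Λ K} (ht : ∀ n, t n [] = 0) {n : N}
    {w : List (Λ × N)} (h : ∀ m w', w'.length < w.length → x m w' = y m w') :
    (t * x) n w = (t * y) n w := by
  rw [mul_apply, mul_apply]
  refine Finset.sum_congr rfl fun k hk => ?_
  rcases k.eq_zero_or_pos with rfl | hk'
  · simp [ht]
  · by_cases hw : w = []
    · subst hw; simp [ht]
    · rw [h]
      have := List.length_pos_iff.2 hw
      rw [List.length_drop]
      omega

variable (hT : ∀ a n, T a n [] = 0)
include hT

theorem substPart_eq_zero (k : ℕ) (f : PathSeries N Λ K) (n : N) (w : List (Λ × N))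
    (hw : w.length < k) : substPart T k f n w = 0 := by
  induction k generalizing f n w with
  | zero => simp at hw
  | succ k ih =>
    change (∑ a, T a * substPart T k (der n a f) : PathSeries N Λ K) n w = 0
    rw [sum_apply]
    refine Finset.sum_eq_zero fun a _ => ?_
    rw [mul_congr_of_length (y := 0) (hT a), mul_zero, zero_apply]
    intro m w' hw'
    rw [ih _ _ _ (by omega), zero_apply]

theorem substSeries_eq_sum (f : PathSeries N Λ K) (n : N) (w : List (Λ × N)) {M : ℕ}
    (hM : w.length < M) : substSeries T f n w = ∑ k ∈ Finset.range M, substPart T k f n w := by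
  rw [substSeries]
  refine Finset.sum_subset (Finset.range_mono hM) fun k _ hk => ?_
  exact substPart_eq_zero hT _ _ _ _ (by simpa using hk)

/-- The recursion formula that characterizes `substSeries`. -/
theorem substSeries_apply (f : PathSeries N Λ K) (n : N) (w : List (Λ × N)) :
    substSeries T f n w =
      (diag (fun n => f n []) + ∑ a, T a * substSeries T (der n a f) : PathSeries N Λ K) n w := by
  rw [substSeries_eq_sum hT f n w (M := w.length + 1) (by omega), Finset.sum_range_succ', add_comm,
    add_apply, sum_apply]
  congr 1
  rw [← Finset.sum_congr rfl fun a _ => mul_congr_of_length (hT a)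
    (x := ∑ k ∈ Finset.range w.length, substPart T k (der n a f))
    fun m w' hw' => by rw [substSeries_eq_sum hT _ _ _ hw', sum_apply]]
  simp only [Finset.mul_sum, sum_apply, substPart]
  rw [Finset.sum_comm]

theorem eq_of_recursion {τ τ' : PathSeries N Λ K → PathSeries N Λ K}
    (c : PathSeries N Λ K → N → List (Λ × N) → K)
    (h : ∀ f n w, τ f n w = c f n w + (∑ a, T a * τ (der n a f) : PathSeries N Λ K) n w)
    (h' : ∀ f n w, τ' f n w = c f n w + (∑ a, T a * τ' (der n a f) : PathSeries N Λ K) n w) :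
    τ = τ' := by
  funext f
  ext n w
  induction hl : w.length using Nat.strong_induction_on generalizing f n w with
  | _ l ih =>
    subst hl
    rw [h, h', sum_apply, sum_apply]
    congr 1
    exact Finset.sum_congr rfl fun a _ => mul_congr_of_length (hT a)
      fun m w' hw' => ih _ hw' _ _ _ rfl

omit hT in
theorem substPart_add (k : ℕ) (f g : PathSeries N Λ K) :
    substPart T k (f + g) = substPart T k f + substPart T k g := by
  induction k generalizing f g with
  | zero => ext n w; cases w <;> simp [substPart]
  | succ k ih =>
    ext n w
    rw [add_apply, substPart, substPart, substPart, ← add_apply, ← Finset.sum_add_distrib]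
    simp only [der_add, ih, mul_add]

omit hT in
theorem substPart_smul (k : ℕ) (c : K) (f : PathSeries N Λ K) :
    substPart T k (c • f) = c • substPart T k f := by
  induction k generalizing f with
  | zero => ext n w; cases w <;> simp [substPart]
  | succ k ih =>
    ext n w
    rw [smul_apply, substPart, substPart, ← smul_apply, Finset.smul_sum]
    simp only [der_smul, ih, mul_smul_comm]

omit hT in
theorem substSeries_add (f g : PathSeries N Λ K) :
    substSeries T (f + g) = substSeries T f + substSeries T g := by
  ext n w
  simp only [substSeries, substPart_add, add_apply, Finset.sum_add_distrib]

omit hT in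
theorem substSeries_smul (c : K) (f : PathSeries N Λ K) :
    substSeries T (c • f) = c • substSeries T f := by
  ext n w
  simp only [substSeries, substPart_smul, smul_apply, Finset.mul_sum]

omit hT in
theorem substSeries_zero : substSeries T 0 = 0 := by
  have := substSeries_smul (T := T) 0 0
  simpa using this

omit hT in
theorem substSeries_neg (f : PathSeries N Λ K) : substSeries T (-f) = -substSeries T f := by
  have := substSeries_smul (T := T) (-1) f
  simpa using this

omit hT in
theorem substSeries_sum {ι : Type*} (s : Finset ι) (f : ι → PathSeries N Λ K) :
    substSeries T (∑ i ∈ s, f i) = ∑ i ∈ s, substSeries T (f i) :=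
  map_sum (AddMonoidHom.mk' (substSeries T) substSeries_add) f s

theorem substSeries_nil (f : PathSeries N Λ K) (n : N) : substSeries T f n [] = f n [] := by
  rw [substSeries_apply hT]; simp [hT]

theorem substSeries_diag (c : N → K) : substSeries T (diag c) = diag c := by
  ext n w
  rw [substSeries_apply hT]
  simp [substSeries_zero]

theorem substSeries_one : substSeries T 1 = 1 := substSeries_diag hT _

theorem substSeries_letter (a : Λ) : substSeries T (letter a) = T a := by
  classical
  ext n w
  rw [substSeries_apply hT]
  simp only [der_letter, letter_nil]
  rw [Finset.sum_eq_single a (by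
    intro b _ h; rw [if_neg h, substSeries_zero, mul_zero]) (by simp), if_pos rfl,
    substSeries_one hT, mul_one]
  cases w <;> simp

theorem substSeries_mul (f g : PathSeries N Λ K) :
    substSeries T (f * g) = substSeries T f * substSeries T g := by
  refine congrFun (eq_of_recursion hT (τ := fun f => substSeries T (f * g))
    (τ' := fun f => substSeries T f * substSeries T g)
    (fun f n w => f n [] * substSeries T g n w) (fun f n w => ?_) fun f n w => ?_) f
  · rw [substSeries_apply hT, substSeries_apply hT g]
    simp only [der_mul, substSeries_add, substSeries_smul, mul_add, Finset.sum_add_distrib,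
      mul_smul_comm, ← Finset.smul_sum, add_apply, smul_apply, mul_nil, ← add_assoc]
    cases w <;> simp
  · have : (substSeries T f * substSeries T g) n w =
      ((diag (fun n => f n []) + ∑ a, T a * substSeries T (der n a f)) * substSeries T g :
        PathSeries N Λ K) n w := by
      simp only [mul_apply]
      refine Finset.sum_congr rfl fun k _ => ?_
      rw [substSeries_apply hT]
    rw [this, add_mul, add_apply, diag_mul_apply, Finset.sum_mul]
    simp only [mul_assoc]

/-- An additive and multiplicative map that is the identity on diagonal series and maps the letters
to the series `T a` is `substSeries T`. -/
theorem eq_substSeries {τ : PathSeries N Λ K → PathSeries N Λ K}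
    (hadd : ∀ f g, τ (f + g) = τ f + τ g) (hmul : ∀ f g, τ (f * g) = τ f * τ g)
    (hdiag : ∀ c, τ (diag c) = diag c) (hletter : ∀ a, τ (letter a) = T a) :
    τ = substSeries T := by
  classical
  refine eq_of_recursion hT (fun f n w => diag (fun n => f n []) n w) (fun f n w => ?_)
    fun f n w => by rw [substSeries_apply hT, add_apply]
  have key : ∀ f g : PathSeries N Λ K, f n = g n → τ f n w = τ g n w := fun f g h => by
    have h' : diag (Pi.single n (1 : K)) * f = diag (Pi.single n (1 : K)) * g := by
      ext m w
      rw [diag_mul_apply, diag_mul_apply]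
      by_cases hm : m = n
      · subst hm; rw [h]
      · simp [hm]
    have h'' := congrArg (fun x => τ x n w) h'
    simpa [hmul, hdiag, diag_mul_apply] using h''
  have hsum : ∀ s : Finset Λ, ∀ g : Λ → PathSeries N Λ K, τ (∑ a ∈ s, g a) = ∑ a ∈ s, τ (g a) :=
    fun s g => map_sum (AddMonoidHom.mk' τ hadd) g s
  rw [key f _ (eq_sum_letter f n), hadd, hdiag, hsum, add_apply]
  simp only [hmul, hletter]

theorem substSeries_comp {U : Λ → PathSeries N Λ K} (hU : ∀ a n, U a n [] = 0)
    (f : PathSeries N Λ K) :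
    substSeries T (substSeries U f) = substSeries (fun a => substSeries T (U a)) f := by
  refine congrFun (eq_substSeries (τ := fun f => substSeries T (substSeries U f)) ?_ ?_ ?_ ?_ ?_) f
  · intro a n; rw [substSeries_nil hT, hU]
  · intro f g; simp only [substSeries_add]
  · intro f g; simp only [substSeries_mul hU, substSeries_mul hT]
  · intro c; simp only [substSeries_diag hU, substSeries_diag hT]
  · intro a; simp only [substSeries_letter hU]

omit hT in
theorem substSeries_letter_self (f : PathSeries N Λ K) : substSeries (letter : Λ → PathSeries N Λ K) f = f :=
  (congrFun (eq_substSeries (T := (letter : Λ → PathSeries N Λ K)) (τ := id) (by simp) (by simp) (by simp) (by simp)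
    (by simp)) f).symm

/-- Series that agree on a class of paths give substitutions that agree there, if `T a` is supported
on paths in which the label `a` occurs. -/
theorem Agree.substSeries (hT' : ∀ a n w, T a n w ≠ 0 → a ∈ w.map Prod.fst)
    {L : List Λ → Prop} (hL : Hereditary L) {P : N → Prop} {T' : Λ → PathSeries N Λ K}
    (hT'' : ∀ a n, T' a n [] = 0) (hTT : ∀ a, Agree L P (T a) (T' a))
    {f f' : PathSeries N Λ K} (hf : Agree L P f f') :
    Agree L P (substSeries T f) (PathSeries.substSeries T' f') := by
  intro n w hn hw hl
  induction h : w.length using Nat.strong_induction_on generalizing f f' L n w with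
  | _ l ih =>
    subst h
    rw [substSeries_apply hT, substSeries_apply hT'', add_apply, add_apply, sum_apply, sum_apply]
    congr 1
    · cases w with
      | nil => exact hf n [] hn (by simp) hl
      | cons x w => rfl
    refine Finset.sum_congr rfl fun a _ => ?_
    rw [mul_apply, mul_apply]
    refine Finset.sum_congr rfl fun k _ => ?_
    have h₁ : ∀ x ∈ w.take k, P x.2 := fun x hx => hw x (List.mem_of_mem_take hx)
    have h₂ := hTT a n _ hn h₁ (hL _ _ ((List.take_sublist k w).map _) hl)
    rw [← h₂]
    by_cases h₀ : T a n (w.take k) = 0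
    · simp [h₀]
    have hmem := hT' a n _ h₀
    have hpos : (w.drop k).length < w.length := by
      have : w.take k ≠ [] := by rintro h; rw [h] at hmem; simp at hmem
      have := List.length_pos_iff.2 this
      rw [List.length_take] at this
      rw [List.length_drop]
      omega
    congr 1
    refine ih _ hpos (L := fun l => L (a :: l)) (fun l l' hl' => hL _ _ (hl'.cons_cons a))
      (fun b => (hTT b).mono (fun l => hL _ _ (List.sublist_cons_self a l)) fun _ h => h)
      (f := der n a f) (f' := der n a f')
      (fun m w' hm hw' hl' => hf n ((a, m) :: w') hn (by simpa [hm] using hw') (by simpa using hl'))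
      _ _ (last_prop hn h₁) (fun x hx => hw x (List.mem_of_mem_drop hx)) (hL _ _ ?_ hl) rfl
    conv_rhs => rw [← List.take_append_drop k w, List.map_append]
    rw [← List.singleton_append]
    exact (List.singleton_sublist.2 hmem).append (List.Sublist.refl _)

end Subst

end PathSeries

end SymbPolylog

end

noncomputable section

namespace SymbPolylog

namespace PathSeries

variable {N Λ K : Type}

/-! ### Subpaths of a path -/

/-- The path with the letters `(a r, n (r + 1))`, `p ≤ r < q`. It goes from `n p` to `n q`. -/
def seg (a : ℕ → Λ) (n : ℕ → N) (p q : ℕ) : List (Λ × N) :=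
  (List.range' p (q - p)).map fun r => (a r, n (r + 1))

variable (a : ℕ → Λ) (n : ℕ → N)

theorem seg_of_le {p q : ℕ} (h : q ≤ p) : seg a n p q = [] := by
  simp [seg, Nat.sub_eq_zero_of_le h]

@[simp] theorem length_seg (p q : ℕ) : (seg a n p q).length = q - p := by simp [seg]

theorem seg_cons {p q : ℕ} (h : p < q) : seg a n p q = (a p, n (p + 1)) :: seg a n (p + 1) q := by
  obtain ⟨k, rfl⟩ : ∃ k, q = p + 1 + k := ⟨q - p - 1, by omega⟩
  rw [seg, seg, show p + 1 + k - p = k + 1 by omega, show p + 1 + k - (p + 1) = k by omega,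
    List.range'_succ, List.map_cons]

theorem seg_append {p q r : ℕ} (h : p ≤ q) (h' : q ≤ r) :
    seg a n p q ++ seg a n q r = seg a n p r := by
  rw [seg, seg, seg, ← List.map_append]
  obtain ⟨k, rfl⟩ := Nat.exists_eq_add_of_le h
  obtain ⟨l, rfl⟩ := Nat.exists_eq_add_of_le h'
  rw [show p + k - p = k by omega, show p + k + l - (p + k) = l by omega,
    show p + k + l - p = k + l by omega]
  congr 1
  simp

theorem take_seg {p q k : ℕ} (h : p + k ≤ q) : (seg a n p q).take k = seg a n p (p + k) := by
  rw [← seg_append a n (Nat.le_add_right p k) h, List.take_left' (by simp)]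

theorem drop_seg {p q k : ℕ} (h : p + k ≤ q) : (seg a n p q).drop k = seg a n (p + k) q := by
  rw [← seg_append a n (Nat.le_add_right p k) h, List.drop_left' (by simp)]

theorem last_seg {p q : ℕ} (h : p ≤ q) : last (n p) (seg a n p q) = n q := by
  obtain ⟨k, rfl⟩ := Nat.exists_eq_add_of_le h
  induction k generalizing p with
  | zero => rw [seg_of_le _ _ (by omega)]; rfl
  | succ k ih =>
    rw [seg_cons _ _ (by omega), last_cons, show p + (k + 1) = p + 1 + k by omega]
    exact ih (by omega)

theorem getD_seg_fst {p q r : ℕ} (h : r < q - p) (x : Λ) :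
    ((seg a n p q).map Prod.fst).getD r x = a (p + r) := by
  rw [List.getD_eq_getElem _ _ (by simpa using h)]
  simp [seg]

theorem getD_seg_snd {p q r : ℕ} (h : r < q - p) (x : N) :
    ((seg a n p q).map Prod.snd).getD r x = n (p + r + 1) := by
  rw [List.getD_eq_getElem _ _ (by simpa using h)]
  simp [seg]

/-- Every path is of the form `seg`. -/
theorem exists_seg (m : N) (w : List (Λ × N)) (b : Λ) : ∃ (a : ℕ → Λ) (n : ℕ → N),
    n 0 = m ∧ w = seg a n 0 w.length ∧ a w.length = b ∧
      ∀ r, a r = (w.map Prod.fst).getD r b := by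
  refine ⟨fun r => (w.map Prod.fst).getD r b, fun r => match r with
    | 0 => m
    | r + 1 => (w.map Prod.snd).getD r m, rfl, ?_, by simp, fun _ => rfl⟩
  refine List.ext_getElem (by simp) fun r h h' => ?_
  simp [seg, h]

section Expand

variable [CommRing K] {a n}

theorem mul_seg (f g : PathSeries N Λ K) {p q : ℕ} (h : p ≤ q) :
    (f * g) (n p) (seg a n p q) =
      ∑ r ∈ Finset.Icc p q, f (n p) (seg a n p r) * g (n r) (seg a n r q) := by
  rw [mul_apply, length_seg]
  refine Finset.sum_bij (fun k _ => p + k) (fun k hk => ?_) (fun k _ l _ h => by omega)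
    (fun r hr => ?_) fun k hk => ?_
  · rw [Finset.mem_range] at hk; rw [Finset.mem_Icc]; omega
  · rw [Finset.mem_Icc] at hr; exact ⟨r - p, by rw [Finset.mem_range]; omega, by omega⟩
  · rw [Finset.mem_range] at hk
    rw [take_seg _ _ (by omega), drop_seg _ _ (by omega), last_seg _ _ (by omega)]

theorem mul_congr_start {f f' g : PathSeries N Λ K} {m : N} (h : f m = f' m) :
    (f * g) m = (f' * g) m := by
  funext w
  rw [mul_apply, mul_apply, h]

variable [Fintype Λ]

/-- The term of the expansion of `substSeries` that belongs to sequences of indices `i` and `j`. -/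
def expandTerm (Φ Ψ : Λ → PathSeries N Λ K) (a : ℕ → Λ) (n : ℕ → N) (p : ℕ) {d k : ℕ}
    (f : PathSeries N Λ K) (i : Fin (k + 1) → Fin (d + 1)) (j : Fin k → Fin d) : K :=
  f (n p) (List.ofFn fun q => (a (i q.castSucc), n (j q + 1))) *
    (Φ (a (i 0)) (n p) (seg a n p (i 0)) *
      ∏ q, (Ψ (a (i q.castSucc)) (n (i q.castSucc + 1)) (seg a n (i q.castSucc + 1) (j q + 1)) *
        Φ (a (i q.succ)) (n (j q + 1)) (seg a n (j q + 1) (i q.succ))))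

/-- The condition that `i` and `j` index a term of the expansion of `substSeries`. -/
def ExpandIndex (p : ℕ) {d k : ℕ} (i : Fin (k + 1) → Fin (d + 1)) (j : Fin k → Fin d) : Prop :=
  p ≤ i 0 ∧ (∀ q, (i q.castSucc : ℕ) ≤ j q) ∧ (∀ q, (j q : ℕ) < i q.succ) ∧
    (i (Fin.last k) : ℕ) = d

theorem expandIndex_cons {p d k : ℕ} (i₀ : Fin (d + 1)) (i : Fin (k + 1) → Fin (d + 1)) (j₀ : Fin d)
    (j : Fin k → Fin d) :
    ExpandIndex p (Fin.cons i₀ i : Fin (k + 2) → Fin (d + 1)) (Fin.cons j₀ j : Fin (k + 1) → Fin d) ↔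
      (p ≤ i₀ ∧ (i₀ : ℕ) ≤ j₀) ∧ ExpandIndex (j₀ + 1) i j := by
  simp only [ExpandIndex, Fin.forall_fin_succ (n := k), ← Fin.succ_last, Fin.cons_succ,
    Fin.cons_zero, Fin.castSucc_zero, ← Fin.succ_castSucc, Nat.succ_le_iff]
  tauto

omit [Fintype Λ] in
theorem expandTerm_cons (Φ Ψ : Λ → PathSeries N Λ K) {p d k : ℕ} (f : PathSeries N Λ K)
    (i₀ : Fin (d + 1)) (i : Fin (k + 1) → Fin (d + 1)) (j₀ : Fin d) (j : Fin k → Fin d) :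
    expandTerm Φ Ψ a n p f (Fin.cons i₀ i : Fin (k + 2) → Fin (d + 1))
      (Fin.cons j₀ j : Fin (k + 1) → Fin d) =
      Φ (a i₀) (n p) (seg a n p i₀) * (Ψ (a i₀) (n (i₀ + 1)) (seg a n (i₀ + 1) (j₀ + 1)) *
        expandTerm Φ Ψ a n (j₀ + 1) (der (n p) (a i₀) f) i j) := by
  simp only [expandTerm, Fin.prod_univ_succ (n := k), List.ofFn_succ, Fin.cons_succ,
    Fin.cons_zero, Fin.castSucc_zero, ← Fin.succ_castSucc, der]
  ring

open Classical in
theorem substPart_mul_seg (Φ Ψ : Λ → PathSeries N Λ K) (k : ℕ) (f : PathSeries N Λ K) {p d : ℕ}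
    (hp : p ≤ d) :
    (substPart (fun x => Φ x * letter x * Ψ x) k f * Φ (a d)) (n p) (seg a n p d) =
      ∑ i : Fin (k + 1) → Fin (d + 1), ∑ j : Fin k → Fin d,
        if ExpandIndex p i j then expandTerm Φ Ψ a n p f i j else 0 := by
  induction k generalizing f p with
  | zero =>
    rw [substPart, diag_mul_apply, Fintype.sum_eq_single (fun _ => Fin.last d)]
    · simp [ExpandIndex, expandTerm, hp]
    · intro i hi
      refine Finset.sum_eq_zero fun j _ => if_neg fun h => hi ?_
      funext x
      obtain rfl : x = Fin.last 0 := Fin.ext (by simp)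
      exact Fin.ext h.2.2.2
  | succ k ih =>
    have h₁ : (substPart (fun x => Φ x * letter x * Ψ x) (k + 1) f * Φ (a d)) (n p) =
        (∑ x, Φ x * (letter x * (Ψ x * (substPart (fun x => Φ x * letter x * Ψ x) k
          (der (n p) x f) * Φ (a d)))) : PathSeries N Λ K) (n p) := by
      refine (mul_congr_start (f := substPart (fun x => Φ x * letter x * Ψ x) (k + 1) f) (f' := ∑ x, Φ x * letter x * Ψ x *
        substPart (fun x => Φ x * letter x * Ψ x) k (der (n p) x f)) rfl).trans ?_
      rw [Finset.sum_mul]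
      simp only [mul_assoc]
    have h₂ : ∀ y : Λ → PathSeries N Λ K,
        (∑ x, Φ x * (letter x * y x) : PathSeries N Λ K) (n p) (seg a n p d) =
          ∑ i : Fin (d + 1), if p ≤ i then Φ (a i) (n p) (seg a n p i) *
            if (i : ℕ) < d then y (a i) (n (i + 1)) (seg a n (i + 1) d) else 0 else 0 := by
      intro y
      rw [sum_apply]
      simp only [mul_seg _ _ hp]
      rw [Finset.sum_comm, Fin.sum_univ_eq_sum_range (fun i : ℕ => if p ≤ i then
        Φ (a i) (n p) (seg a n p i) * if (i : ℕ) < d then y (a i) (n (i + 1)) (seg a n (i + 1) d)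
          else 0 else 0) (d + 1), ← Finset.sum_filter]
      refine Finset.sum_congr (by ext; simp; omega) fun i hi => ?_
      split_ifs with h
      · simp only [seg_cons a n h, letter_mul_cons]
        simp
      · simp [seg_of_le a n (not_lt.1 h)]
    rw [h₁, h₂, ← (Fin.consEquiv fun _ : Fin (k + 2) => Fin (d + 1)).sum_comp,
      Fintype.sum_prod_type]
    refine Finset.sum_congr rfl fun i₀ _ => ?_
    simp only [← (Fin.consEquiv fun _ : Fin (k + 1) => Fin d).sum_comp, Fintype.sum_prod_type]
    simp only [Fin.consEquiv, Equiv.coe_fn_mk, expandIndex_cons, expandTerm_cons, ite_and]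
    split_ifs with h h'
    · rw [mul_seg _ _ (by omega)]
      simp only [Finset.mul_sum]
      rw [Finset.sum_comm]
      have : ∀ j₀ : Fin d, ∑ i : Fin (k + 1) → Fin (d + 1), ∑ j : Fin k → Fin d,
          (if (i₀ : ℕ) ≤ j₀ then if ExpandIndex (j₀ + 1) i j then
            Φ (a i₀) (n p) (seg a n p i₀) * (Ψ (a i₀) (n (i₀ + 1)) (seg a n (i₀ + 1) (j₀ + 1)) *
              expandTerm Φ Ψ a n (j₀ + 1) (der (n p) (a i₀) f) i j) else 0 else 0) =
          if (i₀ : ℕ) ≤ j₀ then Φ (a i₀) (n p) (seg a n p i₀) *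
            (Ψ (a i₀) (n (i₀ + 1)) (seg a n (i₀ + 1) (j₀ + 1)) *
              (substPart (fun x => Φ x * letter x * Ψ x) k (der (n p) (a i₀) f) * Φ (a d) :
                PathSeries N Λ K) (n (j₀ + 1)) (seg a n (j₀ + 1) d)) else 0 := by
        intro j₀
        split_ifs
        · rw [ih _ (by omega)]
          simp only [Finset.mul_sum, mul_ite, mul_zero]
        · simp
      rw [Finset.sum_congr rfl fun j₀ _ => this j₀]
      rw [Fin.sum_univ_eq_sum_range (fun j₀ : ℕ => if (i₀ : ℕ) ≤ j₀ then
        Φ (a i₀) (n p) (seg a n p i₀) * (Ψ (a i₀) (n (i₀ + 1)) (seg a n (i₀ + 1) (j₀ + 1)) *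
          (substPart (fun x => Φ x * letter x * Ψ x) k (der (n p) (a i₀) f) * Φ (a d) :
            PathSeries N Λ K) (n (j₀ + 1)) (seg a n (j₀ + 1) d)) else 0) d, ← Finset.sum_filter]
      refine Finset.sum_bij (fun m _ => m - 1) ?_ ?_ ?_ ?_
      · intro m hm; simp at hm ⊢; omega
      · intro m hm m' hm'; simp at hm hm'; omega
      · intro j hj; simp at hj; exact ⟨j + 1, by simp; omega, by simp⟩
      · intro m hm
        rw [Finset.mem_Icc] at hm
        rw [Nat.sub_add_cancel (by omega)]
    · rw [mul_zero]
      refine (Finset.sum_eq_zero fun i _ => Finset.sum_eq_zero fun j₀ _ => ?_).symm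
      refine Finset.sum_eq_zero fun j _ => if_neg ?_
      omega
    · simp

open Classical in
theorem substSeries_mul_seg (Φ Ψ : Λ → PathSeries N Λ K) (f : PathSeries N Λ K) (d : ℕ) :
    (substSeries (fun x => Φ x * letter x * Ψ x) f * Φ (a d)) (n 0) (seg a n 0 d) =
      ∑ k ∈ Finset.range (d + 1), ∑ i : Fin (k + 1) → Fin (d + 1), ∑ j : Fin k → Fin d,
        if ExpandIndex 0 i j then expandTerm Φ Ψ a n 0 f i j else 0 := by
  rw [← Finset.sum_congr rfl fun k _ => substPart_mul_seg Φ Ψ k f (Nat.zero_le d), ← sum_apply,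
    ← Finset.sum_mul, mul_seg _ _ (Nat.zero_le d), mul_seg _ _ (Nat.zero_le d)]
  refine Finset.sum_congr rfl fun r hr => ?_
  rw [Finset.mem_Icc] at hr
  rw [substSeries_eq_sum (fun x m => by simp) f _ _ (M := d + 1) (by rw [length_seg]; omega),
    sum_apply]

end Expand

end PathSeries

end SymbPolylog

end

noncomputable section

namespace SymbPolylog

section Exp

variable {τ R : Type} [CommRing R] [Algebra ℚ R]

/-- The exponential `exp x` of a power series `x` without constant term. -/
def expOf (x : MvPowerSeries τ R) : MvPowerSeries τ R := PowerSeries.subst x (PowerSeries.exp R)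

theorem expOf_add {x y : MvPowerSeries τ R} (hx : x.constantCoeff = 0) (hy : y.constantCoeff = 0) :
    expOf (x + y) = expOf x * expOf y := by
  have key : PowerSeries.subst (MvPowerSeries.X 0 + MvPowerSeries.X 1 : MvPowerSeries (Fin 2) R)
      (PowerSeries.exp R) =
      PowerSeries.subst (MvPowerSeries.X 0 : MvPowerSeries (Fin 2) R) (PowerSeries.exp R) *
        PowerSeries.subst (MvPowerSeries.X 1 : MvPowerSeries (Fin 2) R) (PowerSeries.exp R) := by
    ext e
    rw [PowerSeries.coeff_subst_X_zero_add_X_one, PowerSeries.coeff_subst_X_zero_subst_mul_X_one,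
      PowerSeries.coeff_exp, PowerSeries.coeff_exp, PowerSeries.coeff_exp, ← map_mul,
      ← map_natCast (algebraMap ℚ R), ← map_mul]
    congr 1
    have h := Nat.choose_mul_factorial_mul_factorial (Nat.le_add_right (e 0) (e 1))
    rw [Nat.add_sub_cancel_left] at h
    have h₀ := Nat.factorial_ne_zero (e 0)
    have h₁ := Nat.factorial_ne_zero (e 1)
    have h₂ := Nat.factorial_ne_zero (e 0 + e 1)
    field_simp
    exact_mod_cast by linarith
  have hxy : MvPowerSeries.HasSubst ![x, y] :=
    MvPowerSeries.hasSubst_of_constantCoeff_zero fun i => by fin_cases i <;> simpa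
  have h := congrArg (MvPowerSeries.subst ![x, y]) key
  have hX : ∀ i : Fin 2, PowerSeries.HasSubst (MvPowerSeries.X i : MvPowerSeries (Fin 2) R) :=
    fun i => PowerSeries.HasSubst.X i
  rw [MvPowerSeries.subst_mul hxy] at h
  simp only [PowerSeries.subst] at h
  rw [MvPowerSeries.subst_comp_subst_apply ((hX 0).add (hX 1)).const hxy,
    MvPowerSeries.subst_comp_subst_apply (hX 0).const hxy,
    MvPowerSeries.subst_comp_subst_apply (hX 1).const hxy, MvPowerSeries.subst_add hxy,
    MvPowerSeries.subst_X hxy, MvPowerSeries.subst_X hxy] at h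
  exact h

@[simp] theorem expOf_zero : expOf (0 : MvPowerSeries τ R) = 1 := by
  rw [expOf, PowerSeries.subst_zero_eq_C_constantCoeff]
  simp

theorem map_expOf {R' : Type} [CommRing R'] [Algebra ℚ R'] (g : R →ₐ[ℚ] R') {x : MvPowerSeries τ R}
    (hx : x.constantCoeff = 0) :
    MvPowerSeries.map (g : R →+* R') (expOf x) = expOf (MvPowerSeries.map (g : R →+* R') x) := by
  rw [expOf, PowerSeries.map_subst (PowerSeries.HasSubst.of_constantCoeff_zero hx),
    PowerSeries.map_exp]
  rfl

theorem subst_expOf {υ : Type} {s : τ → MvPowerSeries υ R} (hs : MvPowerSeries.HasSubst s)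
    {x : MvPowerSeries τ R} (hx : x.constantCoeff = 0) :
    MvPowerSeries.subst s (expOf x) = expOf (MvPowerSeries.subst s x) := by
  rw [expOf, PowerSeries.subst, MvPowerSeries.subst_comp_subst_apply
    (PowerSeries.HasSubst.of_constantCoeff_zero hx).const hs]
  rfl

theorem expSeries_eq {d : ℕ} (c : R) (j : Fin d) :
    expSeries c j = expOf (MvPowerSeries.C c * MvPowerSeries.X j) := rfl

end Exp

/-! ### Values of generating series at points -/

section Points

variable {τ R : Type} [CommRing R] [Algebra ℚ R] {d : ℕ} {s : Fin d → MvPowerSeries τ R}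

omit [Algebra ℚ R] in
theorem hasSubst_of_zero (hs : ∀ r, (s r).constantCoeff = 0) : MvPowerSeries.HasSubst s :=
  MvPowerSeries.hasSubst_of_constantCoeff_zero hs

/-- The value of a power series with coefficients in an algebra `A` at an `R`-valued point of `A` and
at power series `s` without constant terms. -/
def evalHom {A : Type} [CommRing A] [Algebra ℚ A] (g : A →ₐ[ℚ] R)
    (hs : ∀ r, (s r).constantCoeff = 0) :
    MvPowerSeries (Fin d) A →+* MvPowerSeries τ R :=
  (MvPowerSeries.substAlgHom (R := R) (hasSubst_of_zero hs)).toRingHom.comp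
    (MvPowerSeries.map (g : A →+* R))

section

variable {A : Type} [CommRing A] [Algebra ℚ A] (g : A →ₐ[ℚ] R) (hs : ∀ r, (s r).constantCoeff = 0)

theorem evalHom_apply (f : MvPowerSeries (Fin d) A) :
    evalHom g hs f = MvPowerSeries.subst s (MvPowerSeries.map (g : A →+* R) f) := by
  exact MvPowerSeries.substAlgHom_apply (hasSubst_of_zero hs) _

@[simp] theorem evalHom_X (j : Fin d) : evalHom g hs (MvPowerSeries.X j) = s j := by
  rw [evalHom_apply, MvPowerSeries.map_X, MvPowerSeries.subst_X (hasSubst_of_zero hs)]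

@[simp] theorem evalHom_C (c : A) : evalHom g hs (MvPowerSeries.C c) = MvPowerSeries.C (g c) := by
  rw [evalHom_apply, MvPowerSeries.map_C, MvPowerSeries.subst_C]
  rfl

theorem evalHom_subst {k : ℕ} {x : Fin k → MvPowerSeries (Fin d) A}
    (hx : ∀ r, (x r).constantCoeff = 0) (f : MvPowerSeries (Fin k) A) :
    evalHom g hs (MvPowerSeries.subst x f) =
      MvPowerSeries.subst (fun r => evalHom g hs (x r)) (MvPowerSeries.map (g : A →+* R) f) := by
  rw [evalHom_apply, MvPowerSeries.map_subst (hasSubst_of_zero hx),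
    MvPowerSeries.subst_comp_subst_apply ((hasSubst_of_zero hx).map _) (hasSubst_of_zero hs)]
  simp only [evalHom_apply]

theorem evalHom_expSeries (c : A) (j : Fin d) :
    evalHom g hs (expSeries c j) = expOf (MvPowerSeries.C (g c) * s j) := by
  rw [expSeries_eq, evalHom_apply, map_expOf g (by simp), subst_expOf (hasSubst_of_zero hs) (by simp),
    ← evalHom_apply g hs, map_mul, evalHom_C, evalHom_X]

end

/-- The value `[y | s]` of the generating series with `y_r = x_{a r → a (r+1)}` at a point `g`. -/
def evalSeries (g : Hbar →ₐ[ℚ] R) (a : Fin (d + 1) → ℕ) (s : Fin d → MvPowerSeries τ R) :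
    MvPowerSeries τ R :=
  MvPowerSeries.subst s (MvPowerSeries.map (g : Hbar →+* R) (barSeries a))

theorem evalSeries_congr (g : Hbar →ₐ[ℚ] R) {d' : ℕ} {s' : Fin d' → MvPowerSeries τ R}
    {a : Fin (d + 1) → ℕ} {a' : Fin (d' + 1) → ℕ} (h : d = d')
    (ha : ∀ r (h : r < d + 1) (h' : r < d' + 1), a ⟨r, h⟩ = a' ⟨r, h'⟩)
    (hs : ∀ r (h : r < d) (h' : r < d'), s ⟨r, h⟩ = s' ⟨r, h'⟩) :
    evalSeries g a s = evalSeries g a' s' := by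
  subst h
  rw [show a = a' from funext fun r => ha r r.2 r.2, show s = s' from funext fun r => hs r r.2 r.2]

theorem evalSeries_zero (g : Hbar →ₐ[ℚ] R) (a : Fin 1 → ℕ) (s : Fin 0 → MvPowerSeries τ R) :
    evalSeries g a s = 1 := by
  have hs : ∀ r, (s r).constantCoeff = 0 := fun r => r.elim0
  rw [evalSeries, ← evalHom_apply g hs]
  exact map_one _

/-- The product of two points. -/
def prodPoint (h g : Hbar →ₐ[ℚ] R) : Hbar →ₐ[ℚ] R :=
  (Algebra.TensorProduct.productMap h g).comp comulBar

theorem shift_succPNat {d : ℕ} (m : Fin d →₀ ℕ) : shift (fun r => (m r).succPNat) = m := by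
  ext r
  simp [shift]

theorem comulSeries_zero (a : Fin 1 → ℕ) : comulSeries a = 1 := by
  have hi : ∀ p : CoproductIndex 0 0, (p.i 0 : ℕ) = 0 := fun p => by omega
  have : ∀ p : CoproductIndex 0 0, p.left a = 1 ∧ p.right a = 1 := by
    intro p
    have hs : ∀ (k : ℕ) (x : Fin k → MvPowerSeries (Fin 0) Hbar), k = 0 →
        ∀ a, MvPowerSeries.subst x (barSeries (d := k) a) = 1 := by
      rintro _ x rfl a
      have hx : MvPowerSeries.HasSubst x := hasSubst_of_zero fun r => r.elim0
      rw [← MvPowerSeries.coe_substAlgHom hx]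
      exact map_one _
    refine ⟨hs _ _ rfl _, ?_⟩
    rw [CoproductIndex.right, CoproductIndex.rightZero, hs _ _ (hi p)]
    simp
  have huniq : ∃ p : CoproductIndex 0 0, ∀ q, q = p :=
    ⟨⟨fun _ => 0, Fin.elim0, fun q => q.elim0, fun q => q.elim0, rfl⟩, fun q =>
      CoproductIndex.ext (funext fun _ => Fin.ext (by omega)) (funext fun x => x.elim0)⟩
  obtain ⟨p, hp⟩ := huniq
  rw [comulSeries, Finset.sum_range_one, Fintype.sum_eq_single p fun q hq => absurd (hp q) hq,
    (this p).1, (this p).2, map_one, map_one, mul_one]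

theorem map_prodPoint_barSeries (h g : Hbar →ₐ[ℚ] R) (a : Fin (d + 1) → ℕ)
    (ha : StrictMono a ∨ StrictAnti a) :
    MvPowerSeries.map (prodPoint h g : Hbar →+* R) (barSeries a) =
      MvPowerSeries.map (Algebra.TensorProduct.productMap h g : Hbar ⊗[ℚ] Hbar →+* R)
        (comulSeries a) := by
  cases d with
  | zero => rw [comulSeries_zero, barSeries, map_one, map_one]
  | succ d =>
    ext m
    rw [MvPowerSeries.coeff_map, MvPowerSeries.coeff_map]
    change Algebra.TensorProduct.productMap h g (comulBar (barSym a _)) = _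
    refine congrArg (Algebra.TensorProduct.productMap h g) ?_
    rw [barSym]
    split_ifs with h₁ h₂
    · rw [comulBar, MvPolynomial.aeval_X]
      simp only [shift_succPNat]
      rfl
    · rw [comulBar, MvPolynomial.aeval_X]
      simp only [Function.comp_assoc, Fin.rev_involutive.comp_self, Function.comp_id,
        shift_succPNat, OrderEmbedding.coe_ofStrictMono]
    · exact absurd ha (by tauto)

theorem map_map_includeLeft (h g : Hbar →ₐ[ℚ] R) (f : MvPowerSeries (Fin d) Hbar) :
    MvPowerSeries.map (Algebra.TensorProduct.productMap h g : Hbar ⊗[ℚ] Hbar →+* R)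
      (MvPowerSeries.map
        (Algebra.TensorProduct.includeLeft : Hbar →ₐ[ℚ] Hbar ⊗[ℚ] Hbar).toRingHom f) =
      MvPowerSeries.map (h : Hbar →+* R) f := by
  ext m
  simp [MvPowerSeries.coeff_map]

theorem map_map_includeRight (h g : Hbar →ₐ[ℚ] R) (f : MvPowerSeries (Fin d) Hbar) :
    MvPowerSeries.map (Algebra.TensorProduct.productMap h g : Hbar ⊗[ℚ] Hbar →+* R)
      (MvPowerSeries.map
        (Algebra.TensorProduct.includeRight : Hbar →ₐ[ℚ] Hbar ⊗[ℚ] Hbar).toRingHom f) =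
      MvPowerSeries.map (g : Hbar →+* R) f := by
  ext m
  simp [MvPowerSeries.coeff_map]

/-- Goncharov's formula for the product of two points. -/
theorem evalSeries_prodPoint (h g : Hbar →ₐ[ℚ] R) (a : Fin (d + 1) → ℕ)
    (ha : StrictMono a ∨ StrictAnti a) (hs : ∀ r, (s r).constantCoeff = 0) :
    evalSeries (prodPoint h g) a s = ∑ k ∈ Finset.range (d + 1), ∑ p : CoproductIndex d k,
      evalSeries h (a ∘ p.i) (s ∘ p.j) *
        (evalSeries g (fun r : Fin (p.i 0 + 1) => a ⟨r, by omega⟩)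
          (fun r : Fin (p.i 0) => s ⟨r, by omega⟩) *
        ∏ q, (-1) ^ ((p.j q : ℕ) - p.i q.castSucc) *
          expOf (MvPowerSeries.C (g (toBar (logSym (a (p.i q.castSucc)) (a (p.i q.succ))))) *
            s (p.j q)) *
          evalSeries g (fun r : Fin (p.j q - p.i q.castSucc + 1) => a ⟨p.j q - r, by omega⟩)
            (fun r : Fin (p.j q - p.i q.castSucc) =>
              s (p.j q) - s ⟨p.j q - 1 - r, by omega⟩) *
          evalSeries g (fun r : Fin (p.i q.succ - p.j q - 1 + 1) =>
              a ⟨p.j q + 1 + r, by have := p.j_lt_i q; omega⟩)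
            (fun r : Fin (p.i q.succ - p.j q - 1) =>
              s ⟨p.j q + 1 + r, by omega⟩ - s (p.j q))) := by
  rw [evalSeries, map_prodPoint_barSeries h g a ha, comulSeries]
  simp only [map_sum, map_mul, map_map_includeLeft, map_map_includeRight]
  rw [← MvPowerSeries.coe_substAlgHom (hasSubst_of_zero hs)]
  simp only [map_sum, map_mul]
  rw [MvPowerSeries.coe_substAlgHom (hasSubst_of_zero hs)]
  simp only [← evalHom_apply _ hs]
  simp only [CoproductIndex.left, CoproductIndex.right, map_mul, map_prod,
    CoproductIndex.rightZero, CoproductIndex.rightInv, CoproductIndex.rightReg, map_pow, map_neg,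
    map_one, evalHom_expSeries]
  simp [evalHom_subst, evalHom_X, evalSeries, Function.comp_def]

end Points

end SymbPolylog

end

noncomputable section

namespace SymbPolylog

namespace PathSeries

/-! ### Reversal of paths -/

section Reverse

variable {N Λ K : Type}

/-- The reversed path, from the last name of a path to its start. -/
def revPath (n : N) : List (Λ × N) → List (Λ × N)
  | [] => []
  | (a, m) :: w => revPath m w ++ [(a, n)]

@[simp] theorem revPath_nil (n : N) : revPath n ([] : List (Λ × N)) = [] := rfl

@[simp] theorem length_revPath (n : N) (w : List (Λ × N)) : (revPath n w).length = w.length := by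
  induction w generalizing n with
  | nil => rfl
  | cons x w ih => simp [revPath, ih]

theorem revPath_append (n : N) (w w' : List (Λ × N)) :
    revPath n (w ++ w') = revPath (last n w) w' ++ revPath n w := by
  induction w generalizing n with
  | nil => simp
  | cons x w ih => simp [revPath, ih]

@[simp] theorem last_revPath (n : N) (w : List (Λ × N)) : last (last n w) (revPath n w) = n := by
  induction w generalizing n with
  | nil => rfl
  | cons x w ih => simp [revPath, ih]

@[simp] theorem revPath_revPath (n : N) (w : List (Λ × N)) :
    revPath (last n w) (revPath n w) = w := by
  induction w generalizing n with
  | nil => rfl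
  | cons x w ih => simp [revPath, revPath_append, ih]

theorem map_fst_revPath (n : N) (w : List (Λ × N)) :
    (revPath n w).map Prod.fst = (w.map Prod.fst).reverse := by
  induction w generalizing n with
  | nil => rfl
  | cons x w ih => simp [revPath, ih]

theorem revPath_seg (a : ℕ → Λ) (n : ℕ → N) {p q : ℕ} (h : p ≤ q) :
    revPath (n p) (seg a n p q) = seg (fun r => a (q - 1 - r)) (fun r => n (q - r)) 0 (q - p) := by
  obtain ⟨k, rfl⟩ := Nat.exists_eq_add_of_le h
  induction k generalizing p with
  | zero => simp [seg_of_le]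
  | succ k ih =>
    have h₁ := ih (p := p + 1) (by omega)
    rw [show p + 1 + k = p + (k + 1) by omega] at h₁
    rw [show p + (k + 1) - (p + 1) = k by omega] at h₁
    rw [seg_cons _ _ (by omega), revPath, h₁, show p + (k + 1) - p = k + 1 by omega,
      ← seg_append _ _ (Nat.zero_le k) (Nat.le_succ k), seg_cons _ _ (Nat.lt_succ_self k),
      seg_of_le _ _ le_rfl, show p + (k + 1) - 1 - k = p by omega,
      show p + (k + 1) - (k + 1) = p by omega]

variable [CommRing K]

/-- The anti-automorphism of the ring of series that reverses the paths and negates the letters. -/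
def reverse (f : PathSeries N Λ K) : PathSeries N Λ K :=
  fun n w => (-1) ^ w.length * f (last n w) (revPath n w)

theorem reverse_apply (f : PathSeries N Λ K) (n : N) (w : List (Λ × N)) :
    reverse f n w = (-1) ^ w.length * f (last n w) (revPath n w) := rfl

@[simp] theorem reverse_reverse (f : PathSeries N Λ K) : reverse (reverse f) = f := by
  ext n w
  simp [reverse_apply, ← mul_assoc, ← mul_pow]

theorem reverse_add (f g : PathSeries N Λ K) : reverse (f + g) = reverse f + reverse g := by
  ext n w
  simp [reverse_apply, mul_add]

theorem reverse_neg (f : PathSeries N Λ K) : reverse (-f) = -reverse f := by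
  ext n w
  simp [reverse_apply]

theorem reverse_diag (c : N → K) : reverse (diag c : PathSeries N Λ K) = diag c := by
  ext n w
  cases w with
  | nil => simp [reverse_apply]
  | cons x w =>
    obtain ⟨y, w', h⟩ : ∃ y w', revPath n (x :: w) = y :: w' :=
      List.exists_cons_of_length_pos (by simp)
    rw [reverse_apply, h]
    simp

theorem reverse_mul (f g : PathSeries N Λ K) : reverse (f * g) = reverse g * reverse f := by
  ext n w
  rw [reverse_apply, mul_apply, mul_apply, length_revPath, Finset.mul_sum,
    ← Finset.sum_range_reflect]
  refine Finset.sum_congr rfl fun k hk => ?_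
  have hk : k ≤ w.length := by simpa [Nat.lt_succ_iff] using hk
  rw [show w.length + 1 - 1 - k = w.length - k by omega, reverse_apply, reverse_apply]
  have hl : (w.drop k).length = w.length - k := List.length_drop
  have h := revPath_append n (w.take k) (w.drop k)
  rw [List.take_append_drop] at h
  have h₁ : (revPath n w).take (w.length - k) = revPath (last n (w.take k)) (w.drop k) := by
    rw [h, List.take_left' (by simp)]
  have h₂ : (revPath n w).drop (w.length - k) = revPath n (w.take k) := by
    rw [h, List.drop_left' (by simp)]
  have h₃ : last n w = last (last n (w.take k)) (w.drop k) := by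
    rw [← last_append, List.take_append_drop]
  rw [h₁, h₂, h₃, last_revPath, List.length_take, hl, min_eq_left hk,
    show (-1 : K) ^ w.length = (-1) ^ k * (-1) ^ (w.length - k) by
      rw [← pow_add, Nat.add_sub_cancel' hk]]
  ring

theorem reverse_letter (a : Λ) : reverse (letter a : PathSeries N Λ K) = -letter a := by
  classical
  ext n w
  rcases w with _ | ⟨x, _ | ⟨y, w⟩⟩
  · simp [reverse_apply]
  · simp [reverse_apply, revPath, letter]
    split_ifs <;> simp
  · obtain ⟨x', y', w', h⟩ : ∃ x' y' w', revPath n (x :: y :: w) = x' :: y' :: w' := by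
      obtain ⟨x', w', h⟩ : ∃ x' w', revPath n (x :: y :: w) = x' :: w' :=
        List.exists_cons_of_length_pos (by simp)
      obtain ⟨y', w'', h'⟩ : ∃ y' w'', w' = y' :: w'' := by
        have := length_revPath n (x :: y :: w)
        rw [h] at this
        exact List.exists_cons_of_length_pos (by simp at this; omega)
      exact ⟨x', y', w'', by rw [h, h']⟩
    rw [reverse_apply, h]
    simp [letter]

theorem reverse_substSeries [Fintype Λ] {T : Λ → PathSeries N Λ K} (hT : ∀ a n, T a n [] = 0)
    (f : PathSeries N Λ K) :
    reverse (substSeries T f) = substSeries (fun a => -reverse (T a)) (reverse f) := by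
  have := congrFun (eq_substSeries (T := fun a => -reverse (T a))
    (τ := fun f => reverse (substSeries T (reverse f)))
    (fun a n => by simp [reverse_apply, hT]) (fun f g => by
      simp only [reverse_add, substSeries_add]) (fun f g => by
      simp only [reverse_mul, substSeries_mul hT]) (fun c => by
      simp only [reverse_diag, substSeries_diag hT]) fun a => by
      simp only [reverse_letter, substSeries_neg, substSeries_letter hT, reverse_neg]) (reverse f)
  simpa using this

theorem Agree.reverse {L : List Λ → Prop} {P : N → Prop} {f g : PathSeries N Λ K}
    (h : Agree L P f g) : Agree (fun l => L l.reverse) P (reverse f) (PathSeries.reverse g) := by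
  intro n w hn hw hl
  have hP : ∀ (n : N) (w : List (Λ × N)), P n → (∀ x ∈ w, P x.2) → ∀ x ∈ revPath n w, P x.2 := by
    intro n w
    induction w generalizing n with
    | nil => simp
    | cons y w ih =>
      intro hn hw x hx
      rw [revPath, List.mem_append] at hx
      rcases hx with hx | hx
      · exact ih y.2 (hw y (by simp)) (fun z hz => hw z (by simp [hz])) x hx
      · rw [List.mem_singleton] at hx; subst hx; exact hn
  rw [reverse_apply, reverse_apply, h _ _ (last_prop hn hw) (hP n w hn hw)
    (by rwa [map_fst_revPath])]

end Reverse

/-! ### The series of a point -/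

section Points

variable {τ R : Type} [CommRing R] [Algebra ℚ R] {N K : Type} [CommRing K] {M : ℕ}

/-- The value of `[x_{0 → b}]_0` at a point. -/
def logAt (g : Hbar →ₐ[ℚ] R) (b : ℕ) : R := g (toBar (logSym 0 b))

theorem apply_logSym (g : Hbar →ₐ[ℚ] R) (a b : ℕ) :
    g (toBar (logSym a b)) = logAt g b - logAt g a := by
  rw [logAt, logAt, ← map_sub, ← map_sub]
  congr 2
  simp only [logSym, Finset.Ico_eq_empty_of_le (Nat.zero_le _), Finset.sum_empty, sub_zero]
  rcases le_total a b with h | h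
  · rw [Finset.Ico_eq_empty_of_le h, Finset.sum_empty, sub_zero, eq_sub_iff_add_eq, add_comm,
      Finset.sum_Ico_consecutive _ (Nat.zero_le a) h]
  · rw [Finset.Ico_eq_empty_of_le h, Finset.sum_empty, zero_sub, eq_sub_iff_add_eq, neg_add_eq_iff_eq_add,
      add_comm, Finset.sum_Ico_consecutive _ (Nat.zero_le b) h]

theorem logAt_prodPoint (h g : Hbar →ₐ[ℚ] R) (b : ℕ) :
    logAt (prodPoint h g) b = logAt h b + logAt g b := by
  simp [logAt, logSym, prodPoint, toBar, comulBar, Finset.sum_add_distrib]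

/-- The exponential `exp (c x)`, for a power series `x` without constant term. -/
abbrev expMul (c : R) (x : MvPowerSeries τ R) : MvPowerSeries τ R := expOf (MvPowerSeries.C c * x)

theorem expMul_add {c c' : R} {x : MvPowerSeries τ R} (hx : x.constantCoeff = 0) :
    expMul (c + c') x = expMul c x * expMul c' x := by
  rw [expMul, map_add, add_mul, expOf_add (by simp [hx]) (by simp [hx])]

theorem expMul_telescope {k : ℕ} (l : Fin (k + 1) → R) (x : Fin k → MvPowerSeries τ R)
    (y : MvPowerSeries τ R) (hx : ∀ q, (x q).constantCoeff = 0) (hy : y.constantCoeff = 0) :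
    expMul (l (Fin.last k)) y * ∏ q, expMul (l q.succ - l q.castSucc) (x q - y) =
      expMul (l 0) y * ∏ q, expMul (l q.castSucc) (-x q) * expMul (l q.succ) (x q) := by
  induction k with
  | zero => simp
  | succ k ih =>
    have h : expMul (l (Fin.last k).castSucc) y *
        ∏ q : Fin k, expMul (l q.castSucc.succ - l q.castSucc.castSucc) (x q.castSucc - y) =
        expMul (l 0) y * ∏ q : Fin k, expMul (l q.castSucc.castSucc) (-x q.castSucc) *
          expMul (l q.castSucc.succ) (x q.castSucc) :=
      ih (fun q => l q.castSucc) (fun q => x q.castSucc) fun q => hx _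
    rw [Fin.prod_univ_castSucc, Fin.prod_univ_castSucc, ← mul_assoc (expMul (l 0) y), ← h]
    have key : expMul (l (Fin.last (k + 1))) y *
        expMul (l (Fin.last k).succ - l (Fin.last k).castSucc) (x (Fin.last k) - y) =
        expMul (l (Fin.last k).castSucc) y * (expMul (l (Fin.last k).castSucc) (-x (Fin.last k)) *
          expMul (l (Fin.last k).succ) (x (Fin.last k))) := by
      have := hx (Fin.last k)
      rw [expMul, expMul, expMul, expMul, expMul, ← expOf_add (by simp [hy]) (by simp [hy, this]),
        ← expOf_add (by simp [this]) (by simp [this]),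
        ← expOf_add (by simp [hy]) (by simp [this]), Fin.succ_last, map_sub]
      congr 1
      ring
    linear_combination (∏ q : Fin k,
      expMul (l q.castSucc.succ - l q.castSucc.castSucc) (x q.castSucc - y)) * key

variable (g h : Hbar →ₐ[ℚ] R) (u : N → MvPowerSeries τ R) (ψ : MvPowerSeries τ R →+* K)

/-- The series that corresponds to a path from `0` to the point with label `b`: the coefficient of
`w` is given by the symbol with arguments `x_{a₁ → a₂}, …, x_{a_d → b}`, if `a₁, …, a_d` are the labels
of `w`. -/
def phi (b : Fin M) : PathSeries N (Fin M) K := fun n w =>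
  ψ (expMul (logAt g b) (u n) * evalSeries g (d := w.length)
    (fun r => ((w.map Prod.fst).getD r b : Fin M)) fun r => u ((w.map Prod.snd).getD r n) - u n)

/-- The series that corresponds to a path from the point with label `b` to `0`. -/
def psi (b : Fin M) : PathSeries N (Fin M) K := reverse (phi g (-u) ψ b)

/-- The image of the letter `b` under the substitution that corresponds to a point. -/
def image (b : Fin M) : PathSeries N (Fin M) K := phi g u ψ b * letter b * psi g u ψ b

variable {g h u ψ}

theorem phi_seg (a : ℕ → Fin M) (n : ℕ → N) {p q : ℕ} (hpq : p ≤ q) :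
    phi g u ψ (a q) (n p) (seg a n p q) = ψ (expMul (logAt g (a q)) (u (n p)) *
      evalSeries g (d := q - p) (fun r => a (p + r)) fun r => u (n (p + r + 1)) - u (n p)) := by
  rw [phi]
  congr 2
  refine evalSeries_congr _ (by simp) (fun r hr hr' => ?_) fun r hr hr' => ?_
  · rcases (Nat.lt_succ_iff.1 hr').lt_or_eq with h | rfl
    · simp only [getD_seg_fst a n h]
    · dsimp only
      rw [List.getD_eq_default _ _ (by simp), Nat.add_sub_cancel' hpq]
  · simp only [getD_seg_snd a n hr']

theorem psi_seg (a : ℕ → Fin M) (n : ℕ → N) {i j : ℕ} (hij : i ≤ j) :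
    psi g u ψ (a i) (n (i + 1)) (seg a n (i + 1) (j + 1)) =
      ψ ((-1) ^ (j - i) * (expMul (logAt g (a i)) (-u (n (j + 1))) *
        evalSeries g (d := j - i) (fun r => a (j - r)) fun r => u (n (j + 1)) - u (n (j - r)))) := by
  rw [psi, reverse_apply, last_seg _ _ (by omega), revPath_seg _ _ (by omega)]
  have h := phi_seg (g := g) (u := -u) (ψ := ψ) (fun r => a (j + 1 - 1 - r))
    (fun r => n (j + 1 - r)) (Nat.zero_le (j - i))
  rw [show j + 1 - 1 - (j - i) = i by omega] at h
  rw [show j + 1 - (i + 1) = j - i by omega, length_seg, show j + 1 - (i + 1) = j - i by omega,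
    map_mul ψ (_ ^ _), map_pow, map_neg, map_one]
  refine congrArg _ (h.trans (congrArg ψ ?_))
  rw [Pi.neg_apply]
  refine congrArg _ (evalSeries_congr _ (by omega) (fun r _ _ => by simp) fun r _ _ => ?_)
  simp only [Pi.neg_apply, sub_neg_eq_add, zero_add, Nat.sub_zero]
  rw [show j + 1 - (r + 1) = j - r by omega]
  ring

theorem phi_ofFn {k : ℕ} (a : Fin (k + 1) → Fin M) (m : N) (n : Fin k → N) :
    phi g u ψ (a (Fin.last k)) m (List.ofFn fun q => (a q.castSucc, n q)) =
      ψ (expMul (logAt g (a (Fin.last k))) (u m) *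
        evalSeries g (fun r => a r) fun r => u (n r) - u m) := by
  rw [phi]
  congr 2
  refine evalSeries_congr _ (by simp) (fun r hr hr' => ?_) fun r hr hr' => ?_
  · rcases (Nat.lt_succ_iff.1 hr').lt_or_eq with h | rfl
    · dsimp only
      rw [List.getD_eq_getElem _ _ (by simpa using h)]
      simp
    · dsimp only
      rw [List.getD_eq_default _ _ (by simp)]
      rfl
  · dsimp only
    rw [List.getD_eq_getElem _ _ (by simpa using hr')]
    simp

open Classical in
theorem sum_coproductIndex {d k : ℕ} (F : (Fin (k + 1) → Fin (d + 1)) → (Fin k → Fin d) → K) :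
    (∑ i : Fin (k + 1) → Fin (d + 1), ∑ j : Fin k → Fin d,
      if ExpandIndex 0 i j then F i j else 0) = ∑ p : CoproductIndex d k, F p.i p.j := by
  rw [← Fintype.sum_prod_type' (f := fun i j => if ExpandIndex 0 i j then F i j else 0),
    ← Finset.sum_filter]
  refine Finset.sum_bij' (fun x hx => ⟨x.1, x.2, ?_, ?_, ?_⟩) (fun p _ => (p.i, p.j)) ?_ ?_ ?_ ?_ ?_
  · simp only [Finset.mem_filter] at hx; exact hx.2.2.1
  · simp only [Finset.mem_filter] at hx; exact hx.2.2.2.1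
  · simp only [Finset.mem_filter] at hx; exact hx.2.2.2.2
  · simp
  · intro p _; simp [ExpandIndex, p.i_le_j, p.j_lt_i, p.i_last]
  · simp
  · simp
  · simp

theorem phi_prodPoint_seg (hu : ∀ n, (u n).constantCoeff = 0) {d : ℕ} (a : ℕ → Fin M) (n : ℕ → N)
    (ha : StrictMono (fun r : Fin (d + 1) => (a r : ℕ)) ∨
      StrictAnti fun r : Fin (d + 1) => (a r : ℕ)) :
    phi (prodPoint h g) u ψ (a d) (n 0) (seg a n 0 d) =
      (substSeries (image g u ψ) (phi h u ψ (a d)) * phi g u ψ (a d)) (n 0) (seg a n 0 d) := by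
  classical
  have hs : ∀ r : Fin d, (u (n (r + 1)) - u (n 0)).constantCoeff = 0 := fun r => by simp [hu]
  unfold image
  rw [substSeries_mul_seg, phi_seg _ _ (Nat.zero_le d), Nat.sub_zero]
  simp only [Nat.zero_add]
  rw [evalSeries_prodPoint h g _ ha hs, Finset.mul_sum, map_sum]
  refine Finset.sum_congr rfl fun k _ => ?_
  rw [sum_coproductIndex, Finset.mul_sum, map_sum]
  refine Finset.sum_congr rfl fun p _ => ?_
  have h₁ : phi h u ψ (a d) (n 0) (List.ofFn fun q : Fin k => (a (p.i q.castSucc), n (p.j q + 1))) =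
      ψ (expMul (logAt h (a d)) (u (n 0)) * evalSeries h (fun r => a (p.i r))
        fun r => u (n (p.j r + 1)) - u (n 0)) := by
    have := phi_ofFn (g := h) (u := u) (ψ := ψ) (fun r => a (p.i r)) (n 0) fun q => n (p.j q + 1)
    simp only [p.i_last] at this
    exact this
  have h₂ : ∀ q : Fin k, psi g u ψ (a (p.i q.castSucc)) (n (p.i q.castSucc + 1))
      (seg a n (p.i q.castSucc + 1) (p.j q + 1)) = _ := fun q => psi_seg _ _ (p.i_le_j q)
  have h₃ : ∀ q : Fin k, phi g u ψ (a (p.i q.succ)) (n (p.j q + 1))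
      (seg a n (p.j q + 1) (p.i q.succ)) = _ := fun q => phi_seg _ _ (p.j_lt_i q)
  rw [expandTerm, h₁, phi_seg _ _ (Nat.zero_le _)]
  simp only [h₂, h₃, ← map_mul, ← map_prod]
  congr 1
  have h₄ := expMul_telescope (fun r => logAt g (a (p.i r))) (fun q => u (n (p.j q + 1))) (u (n 0))
    (fun q => hu _) (hu _)
  simp only [p.i_last] at h₄
  have h₅ : evalSeries g (fun r : Fin (p.i 0 + 1) => (a r : ℕ))
      (fun r : Fin (p.i 0) => u (n (r + 1)) - u (n 0)) =
      evalSeries g (d := (p.i 0 : ℕ) - 0) (fun r => (a (0 + r) : ℕ))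
        fun r => u (n (0 + r + 1)) - u (n 0) :=
    evalSeries_congr _ (by omega) (fun r _ _ => by simp) fun r _ _ => by simp
  have h₆ : ∀ q : Fin k, evalSeries g (fun r : Fin (p.j q - p.i q.castSucc + 1) =>
        (a (p.j q - r) : ℕ)) (fun r : Fin (p.j q - p.i q.castSucc) =>
        u (n (p.j q + 1)) - u (n 0) - (u (n (p.j q - 1 - r + 1)) - u (n 0))) =
      evalSeries g (d := (p.j q : ℕ) - p.i q.castSucc) (fun r => (a (p.j q - r) : ℕ))
        fun r => u (n (p.j q + 1)) - u (n (p.j q - r)) := fun q =>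
    evalSeries_congr _ rfl (fun r _ _ => rfl) fun r _ _ => by
      dsimp only
      rw [show (p.j q : ℕ) - 1 - r + 1 = p.j q - r by omega]
      ring
  have h₇ : ∀ q : Fin k, evalSeries g (fun r : Fin (p.i q.succ - p.j q - 1 + 1) =>
        (a (p.j q + 1 + r) : ℕ)) (fun r : Fin (p.i q.succ - p.j q - 1) =>
        u (n (p.j q + 1 + r + 1)) - u (n 0) - (u (n (p.j q + 1)) - u (n 0))) =
      evalSeries g (d := (p.i q.succ : ℕ) - (p.j q + 1)) (fun r => (a (p.j q + 1 + r) : ℕ))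
        fun r => u (n (p.j q + 1 + r + 1)) - u (n (p.j q + 1)) := fun q =>
    evalSeries_congr _ (by omega) (fun r _ _ => rfl) fun r _ _ => by ring
  simp only [apply_logSym, Function.comp_def, logAt_prodPoint, expMul_add (hu _), h₅, h₆, h₇,
    Finset.prod_mul_distrib]
  rw [Finset.prod_mul_distrib] at h₄
  linear_combination (expMul (logAt h (a d)) (u (n 0)) * evalSeries h (fun r => (a (p.i r) : ℕ))
      (fun r => u (n (p.j r + 1)) - u (n 0)) * evalSeries g (d := (p.i 0 : ℕ) - 0)
      (fun r => (a (0 + r) : ℕ)) (fun r => u (n (0 + r + 1)) - u (n 0)) *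
    (∏ q : Fin k, (-1) ^ ((p.j q : ℕ) - p.i q.castSucc)) *
    (∏ q : Fin k, evalSeries g (d := (p.j q : ℕ) - p.i q.castSucc) (fun r => (a (p.j q - r) : ℕ))
        fun r => u (n (p.j q + 1)) - u (n (p.j q - r))) *
    ∏ q : Fin k, evalSeries g (d := (p.i q.succ : ℕ) - (p.j q + 1))
      (fun r => (a (p.j q + 1 + r) : ℕ))
        fun r => u (n (p.j q + 1 + r + 1)) - u (n (p.j q + 1))) * h₄

end Points

end PathSeries

end SymbPolylog

end

noncomputable section

namespace SymbPolylog

namespace PathSeries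

section Agree

variable {N Λ K : Type} [CommRing K] {L : List Λ → Prop} {P : N → Prop}

theorem hereditary_pairwise (r : Λ → Λ → Prop) : Hereditary (List.Pairwise r) :=
  fun _ _ h => List.Pairwise.sublist h

theorem Hereditary.append (hL : Hereditary L) (b : List Λ) : Hereditary fun l => L (l ++ b) :=
  fun _ _ h => hL _ _ (h.append (List.Sublist.refl b))

theorem Agree.mul_letter {b : Λ} {f g : PathSeries N Λ K} (h : Agree (fun l => L (l ++ [b])) P f g) :
    Agree L P (f * letter b) (g * letter b) := by
  classical
  intro n w hn hw hl
  rcases List.eq_nil_or_concat' w with rfl | ⟨w', ⟨c, m⟩, rfl⟩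
  · simp
  · rw [mul_letter_append, mul_letter_append]
    split_ifs with hc
    · subst hc
      exact h n w' hn (fun x hx => hw x (by simp [hx])) (by simpa using hl)
    · rfl

theorem Agree.letter_mul {b : Λ} {f g : PathSeries N Λ K} (h : Agree (fun l => L (b :: l)) P f g) :
    Agree L P (letter b * f) (letter b * g) := by
  classical
  intro n w hn hw hl
  rcases w with _ | ⟨⟨c, m⟩, w⟩
  · simp
  · rw [letter_mul_cons, letter_mul_cons]
    split_ifs with hc
    · subst hc
      exact h m w (hw (c, m) (by simp)) (fun x hx => hw x (by simp [hx])) (by simpa using hl)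
    · rfl

theorem Agree.mul_letter_mul (hL : Hereditary L) {b : Λ} {f f' g g' : PathSeries N Λ K}
    (hf : Agree (fun l => L (l ++ [b])) P f f') (hg : Agree (fun l => L (b :: l)) P g g') :
    Agree L P (f * letter b * g) (f' * letter b * g') := by
  refine (hf.mul_letter.mul hL (Agree.refl g)).trans ?_
  rw [mul_assoc, mul_assoc]
  exact (Agree.refl f').mul hL hg.letter_mul

theorem mem_of_mul_letter_mul_ne_zero {b : Λ} (f g : PathSeries N Λ K) (n : N) (w : List (Λ × N))
    (h : (f * letter b * g : PathSeries N Λ K) n w ≠ 0) : b ∈ w.map Prod.fst := by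
  classical
  by_contra hb
  refine h ?_
  rw [mul_assoc, mul_apply]
  refine Finset.sum_eq_zero fun k _ => ?_
  have hb' : b ∉ (w.drop k).map Prod.fst := fun h' =>
    hb (((List.drop_sublist k w).map Prod.fst).subset h')
  rcases hd : w.drop k with _ | ⟨⟨c, m⟩, w'⟩
  · simp
  · rw [letter_mul_cons, if_neg, mul_zero]
    rintro rfl
    rw [hd] at hb'
    simp at hb'

end Agree

section Points

variable {τ R : Type} [CommRing R] [Algebra ℚ R] {N K : Type} [CommRing K] {M : ℕ}
variable {g h : Hbar →ₐ[ℚ] R} {u : N → MvPowerSeries τ R} {ψ : MvPowerSeries τ R →+* K}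

theorem image_nil (b : Fin M) (n : N) : image g u ψ b n [] = 0 := by simp [image]

theorem mem_of_image_ne_zero (b : Fin M) (n : N) (w : List (Fin M × N))
    (h : image g u ψ b n w ≠ 0) : b ∈ w.map Prod.fst := mem_of_mul_letter_mul_ne_zero _ _ _ _ h

theorem reverse_image (b : Fin M) : -reverse (image g (-u) ψ b) = image g u ψ b := by
  rw [image, image, reverse_mul (K := K), reverse_mul (K := K), reverse_letter, psi, psi,
    reverse_reverse, neg_neg]
  simp [mul_assoc]

theorem phi_prodPoint (hu : ∀ n, (u n).constantCoeff = 0) (b : Fin M) :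
    Agree (fun l => (l ++ [b]).Pairwise (· < ·) ∨ (l ++ [b]).Pairwise (· > ·)) (fun _ => True)
      (phi (prodPoint h g) u ψ b) (substSeries (image g u ψ) (phi h u ψ b) * phi g u ψ b) := by
  intro m w _ _ hl
  obtain ⟨a, n, rfl, hw, rfl, ha⟩ := exists_seg m w b
  have hget : ∀ r (hr : r < (w.map Prod.fst ++ [a w.length]).length),
      (w.map Prod.fst ++ [a w.length])[r] = a r := by
    intro r hr
    rw [ha r, List.getElem_append]
    split_ifs with h'
    · rw [List.getD_eq_getElem _ _ h']
    · rw [List.getD_eq_default _ _ (not_lt.1 h')]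
      simp
  have := phi_prodPoint_seg (g := g) (h := h) (ψ := ψ) hu (d := w.length) a n ?_
  · rwa [← hw] at this
  · refine hl.imp (fun hl r s hrs => ?_) fun hl r s hrs => ?_
    · rw [List.pairwise_iff_getElem] at hl
      have := hl r s (by simp; omega) (by simp; omega) hrs
      rwa [hget, hget] at this
    · rw [List.pairwise_iff_getElem] at hl
      have := hl r s (by simp; omega) (by simp; omega) hrs
      rwa [hget, hget] at this

theorem psi_prodPoint (hu : ∀ n, (u n).constantCoeff = 0) (b : Fin M) :
    Agree (fun l => (b :: l).Pairwise (· < ·)) (fun _ => True)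
      (psi (prodPoint h g) u ψ b) (psi g u ψ b * substSeries (image g u ψ) (psi h u ψ b)) := by
  have key := (phi_prodPoint (g := g) (h := h) (u := -u) (ψ := ψ) (by simp [hu]) b).reverse
  rw [reverse_mul, reverse_substSeries image_nil] at key
  simp only [reverse_image] at key
  refine key.mono (fun l hl => .inr ?_) fun _ h => h
  rw [← List.pairwise_reverse]
  simpa using hl

theorem image_prodPoint (hu : ∀ n, (u n).constantCoeff = 0) (b : Fin M) :
    Agree (List.Pairwise (· < ·)) (fun _ => True)
      (image (prodPoint h g) u ψ b) (substSeries (image g u ψ) (image h u ψ b)) := by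
  have : substSeries (image g u ψ) (image h u ψ b) =
      substSeries (image g u ψ) (phi h u ψ b) * phi g u ψ b * letter b *
        (psi g u ψ b * substSeries (image g u ψ) (psi h u ψ b)) := by
    rw [image, substSeries_mul image_nil, substSeries_mul image_nil, substSeries_letter image_nil]
    simp only [image, mul_assoc]
  rw [this]
  exact Agree.mul_letter_mul (hereditary_pairwise _)
    ((phi_prodPoint hu b).mono (fun _ => .inl) fun _ h => h) (psi_prodPoint hu b)

/-- The product of points is associative. -/
theorem phi_prodPoint_assoc (k : Hbar →ₐ[ℚ] R) (hu : ∀ n, (u n).constantCoeff = 0) (b : Fin M) :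
    Agree (fun l => (l ++ [b]).Pairwise (· < ·)) (fun _ => True)
      (phi (prodPoint k (prodPoint h g)) u ψ b) (phi (prodPoint (prodPoint k h) g) u ψ b) := by
  have hL : Hereditary fun l : List (Fin M) => (l ++ [b]).Pairwise (· < ·) :=
    (hereditary_pairwise _).append [b]
  have hphi : ∀ h g : Hbar →ₐ[ℚ] R, Agree (fun l => (l ++ [b]).Pairwise (· < ·)) (fun _ => True)
      (phi (prodPoint h g) u ψ b) (substSeries (image g u ψ) (phi h u ψ b) * phi g u ψ b) :=
    fun h g => (phi_prodPoint hu b).mono (fun _ => .inl) fun _ h => h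
  refine (hphi k _).trans (Agree.trans ?_ (hphi _ g).symm)
  refine Agree.trans ?_ (Agree.mul hL (Agree.substSeries image_nil mem_of_image_ne_zero hL image_nil
    (fun _ => Agree.refl _) (hphi k h).symm) (Agree.refl _))
  rw [substSeries_mul image_nil, substSeries_comp image_nil image_nil, mul_assoc]
  refine Agree.mul hL ?_ (hphi h g)
  refine Agree.substSeries image_nil mem_of_image_ne_zero hL
    (fun a n => by rw [substSeries_nil image_nil, image_nil]) (fun a => ?_) (Agree.refl _)
  exact (image_prodPoint hu a).mono (fun l hl => hl.sublist (List.sublist_append_left _ _))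
    fun _ h => h

end Points

/-! ### Recovering a point from its series -/

section Generic

variable {R : Type} [CommRing R] [Algebra ℚ R] {d : ℕ}

/-- The names of the variables of a generating series, with the name `none` of zero. -/
def genericValue : Option (Fin d) → MvPowerSeries (Fin d) R
  | none => 0
  | some j => MvPowerSeries.X j

omit [Algebra ℚ R] in
theorem constantCoeff_genericValue (n : Option (Fin d)) :
    (genericValue n : MvPowerSeries (Fin d) R).constantCoeff = 0 := by
  cases n <;> simp [genericValue]

theorem phi_genericValue {M : ℕ} (g : Hbar →ₐ[ℚ] R) (a : Fin (d + 1) → Fin M) :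
    phi g genericValue (RingHom.id _) (a (Fin.last d)) none
      (List.ofFn fun q => (a q.castSucc, some q)) =
      MvPowerSeries.map (g : Hbar →+* R) (barSeries fun r => a r) := by
  rw [phi_ofFn]
  simp [genericValue, expMul, evalSeries, MvPowerSeries.subst_self]

theorem pairwise_ofFn {M : ℕ} {a : Fin (d + 1) → Fin M} (ha : StrictMono a) :
    ((List.ofFn fun q : Fin d => (a q.castSucc, some q)).map Prod.fst ++
      [a (Fin.last d)]).Pairwise (· < ·) := by
  have : (List.ofFn fun q : Fin d => (a q.castSucc, some q)).map Prod.fst ++ [a (Fin.last d)] =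
      List.ofFn a := by
    rw [List.ofFn_succ', List.concat_eq_append, List.map_ofFn]
    rfl
  rw [this, List.pairwise_ofFn]
  exact fun i j h => ha h

theorem apply_reg_eq {g g' : Hbar →ₐ[ℚ] R} (i : Fin (d + 2) ↪o ℕ) (n : Fin (d + 1) → ℕ+)
    (h : ∀ (M : ℕ) (b : Fin M), Agree (fun l => (l ++ [b]).Pairwise (· < ·)) (fun _ => True)
      (phi g (genericValue (d := d + 1)) (RingHom.id _) b) (phi g' genericValue (RingHom.id _) b)) :
    g (MvPolynomial.X (.reg d i n)) = g' (MvPolynomial.X (.reg d i n)) := by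
  obtain ⟨M, a, ha, hai⟩ : ∃ (M : ℕ) (a : Fin (d + 2) → Fin M), StrictMono a ∧
      ∀ r, (a r : ℕ) = i r :=
    ⟨i (Fin.last (d + 1)) + 1,
      fun r => ⟨i r, (i.monotone (Fin.le_last r)).trans_lt (Nat.lt_succ_self _)⟩,
      fun r s hrs => i.strictMono hrs, fun _ => rfl⟩
  have key := h M (a (Fin.last _)) none _ trivial (fun _ _ => trivial) (pairwise_ofFn ha)
  rw [phi_genericValue, phi_genericValue] at key
  simp only [hai] at key
  have h' := congrArg (MvPowerSeries.coeff (shift n)) key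
  rw [MvPowerSeries.coeff_map, MvPowerSeries.coeff_map] at h'
  have hb : MvPowerSeries.coeff (shift n) (barSeries (d := d + 1) fun r => i r) =
      MvPolynomial.X (.reg d i n) := by
    change barSym _ _ = _
    rw [barSym, dif_pos i.strictMono]
    congr 2
    funext r
    refine PNat.eq ?_
    have := (n r).pos
    simp [shift]
    omega
  rw [hb] at h'
  exact h'

end Generic

end PathSeries

end SymbPolylog

end

noncomputable section

namespace SymbPolylog

namespace PathSeries

/-! ### Multiplication at the interface

The name `none` stands for the value zero. A series `f` with `f none [] = 0` is a combination
`f₀ * diag v + ∑ a, f_a * letter a`, and similarly from the left. The product of the interface is the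
bilinear map `B` with `B (x * f) (g * y) = x * B f g * y` that extends the multiplication of the
algebra with unit `diag v` and with the letters as orthogonal idempotents. -/

section Interface

variable {J Λ K : Type} [CommRing K] {v v' : Option J → K}

/-- The series `f` with the last name of each path replaced by `none`. -/
def zeroEnd : PathSeries (Option J) Λ K → Option J → List (Λ × Option J) → K
  | f, _, [] => f none []
  | f, n, (a, m) :: w => zeroEnd (der n a f) m w

/-- The series `f` as an element of the ring of series, with last names replaced by `none`. -/
def zeroEndSeries (f : PathSeries (Option J) Λ K) : PathSeries (Option J) Λ K := zeroEnd f

omit [CommRing K] in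
theorem zeroEndSeries_apply (f : PathSeries (Option J) Λ K) (n : Option J)
    (w : List (Λ × Option J)) : zeroEndSeries f n w = zeroEnd f n w := rfl

omit [CommRing K] in
theorem zeroEnd_append (f : PathSeries (Option J) Λ K) (n : Option J) (w : List (Λ × Option J))
    (a : Λ) (m : Option J) : zeroEnd f n (w ++ [(a, m)]) = f n (w ++ [(a, none)]) := by
  induction w generalizing f n with
  | nil => rfl
  | cons x w ih => exact ih _ _

omit [CommRing K] in
theorem zeroEnd_of_last {f : PathSeries (Option J) Λ K} {n : Option J} {w : List (Λ × Option J)}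
    (h : last n w = none) : zeroEnd f n w = f n w := by
  induction w generalizing f n with
  | nil => rw [zeroEnd]; rw [last_nil] at h; rw [h]
  | cons x w ih => exact ih (f := der n x.1 f) h

theorem zeroEnd_add (f g : PathSeries (Option J) Λ K) (n : Option J) (w : List (Λ × Option J)) :
    zeroEnd (f + g) n w = zeroEnd f n w + zeroEnd g n w := by
  induction w generalizing f g n with
  | nil => rfl
  | cons x w ih => exact ih _ _ _

theorem zeroEnd_smul (c : K) (f : PathSeries (Option J) Λ K) (n : Option J)
    (w : List (Λ × Option J)) : zeroEnd (c • f) n w = c * zeroEnd f n w := by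
  induction w generalizing f n with
  | nil => rfl
  | cons x w ih => exact ih _ _

theorem zeroEndSeries_mul (x : PathSeries (Option J) Λ K) {f : PathSeries (Option J) Λ K}
    (hf : f none [] = 0) : zeroEndSeries (x * f) = x * zeroEndSeries f := by
  ext n w
  rw [zeroEndSeries_apply]
  induction w generalizing x n with
  | nil => simp [zeroEnd, zeroEndSeries_apply, hf]
  | cons y w ih =>
    obtain ⟨a, m⟩ := y
    rw [zeroEnd, der_mul, zeroEnd_add, zeroEnd_smul, ih, mul_cons]
    rfl

/-- The series `f` with the start of each path replaced by `none`. -/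
def zeroStart (f : PathSeries (Option J) Λ K) : PathSeries (Option J) Λ K := fun _ w => f none w

theorem zeroStart_mul {f : PathSeries (Option J) Λ K} (hf : f none [] = 0)
    (y : PathSeries (Option J) Λ K) : zeroStart (f * y) = zeroStart f * y := by
  ext n w
  cases w with
  | nil => simp [zeroStart, hf]
  | cons x w => obtain ⟨a, m⟩ := x; simp [zeroStart, mul_cons, hf]; rfl

/-- The coefficient `f₀` of `diag v` on the right. -/
def rightDiv (v' : Option J → K) (f : PathSeries (Option J) Λ K) : PathSeries (Option J) Λ K :=
  (f - zeroEndSeries f) * diag v'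

/-- The coefficient of `letter a` on the right. -/
def rightLetter (a : Λ) (f : PathSeries (Option J) Λ K) : PathSeries (Option J) Λ K :=
  fun n w => f n (w ++ [(a, none)])

/-- The coefficient of `diag v` on the left. -/
def leftDiv (v' : Option J → K) (f : PathSeries (Option J) Λ K) : PathSeries (Option J) Λ K :=
  diag v' * (f - zeroStart f)

theorem rightDiv_mul (x : PathSeries (Option J) Λ K) {f : PathSeries (Option J) Λ K}
    (hf : f none [] = 0) : rightDiv v' (x * f) = x * rightDiv v' f := by
  rw [rightDiv, rightDiv, zeroEndSeries_mul x hf, ← mul_sub, mul_assoc]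

theorem rightLetter_mul (a : Λ) (x : PathSeries (Option J) Λ K) {f : PathSeries (Option J) Λ K}
    (hf : f none [] = 0) : rightLetter a (x * f) = x * rightLetter a f := by
  ext n w
  rw [rightLetter, ← zeroEnd_append (x * f) n w a none, ← zeroEndSeries_apply, zeroEndSeries_mul x hf,
    mul_apply, mul_apply, List.length_append, List.length_singleton, Finset.sum_range_succ]
  have h : zeroEndSeries f (last n ((w ++ [(a, none)]).take (w.length + 1)))
      ((w ++ [(a, none)]).drop (w.length + 1)) = 0 := by
    rw [List.drop_of_length_le (by simp)]
    exact hf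
  rw [h, mul_zero, add_zero]
  refine Finset.sum_congr rfl fun k hk => ?_
  have hk : k ≤ w.length := by simpa [Nat.lt_succ_iff] using hk
  rw [List.take_append_of_le_length hk, List.drop_append_of_le_length hk, zeroEndSeries_apply,
    zeroEnd_append]
  rfl

theorem leftDiv_mul {f : PathSeries (Option J) Λ K} (hf : f none [] = 0)
    (y : PathSeries (Option J) Λ K) : leftDiv v' (f * y) = leftDiv v' f * y := by
  rw [leftDiv, leftDiv, zeroStart_mul hf, ← sub_mul, mul_assoc]

theorem leftLetter_mul (a : Λ) {f : PathSeries (Option J) Λ K} (hf : f none [] = 0)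
    (y : PathSeries (Option J) Λ K) : der none a (f * y) = der none a f * y := by
  rw [der_mul, hf, zero_smul, zero_add]

variable [Fintype Λ]

theorem sum_rightLetter_mul {f : PathSeries (Option J) Λ K} (hf : f none [] = 0) :
    ∑ a, rightLetter a f * letter a = zeroEndSeries f := by
  classical
  ext n w
  rw [sum_apply, zeroEndSeries_apply]
  rcases List.eq_nil_or_concat' w with rfl | ⟨w', ⟨c, m⟩, rfl⟩
  · simp [zeroEnd, hf]
  · simp only [mul_letter_append, zeroEnd_append]
    simp [rightLetter]

theorem sum_mul_leftLetter {f : PathSeries (Option J) Λ K} (hf : f none [] = 0) :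
    ∑ a, letter a * der none a f = zeroStart f := by
  classical
  ext n w
  rw [sum_apply]
  rcases w with _ | ⟨⟨c, m⟩, w⟩
  · simp [zeroStart, hf]
  · simp [letter_mul_cons, zeroStart, der]

variable (hv : v none = 0) (hv' : ∀ n, n ≠ none → v n * v' n = 1)
include hv hv'

omit hv [Fintype Λ] in
theorem rightDiv_mul_diag (f : PathSeries (Option J) Λ K) :
    rightDiv v' f * diag v = f - zeroEndSeries f := by
  ext n w
  rw [rightDiv, mul_diag_apply, mul_diag_apply, mul_assoc, mul_comm (v' _)]
  by_cases h : last n w = none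
  · rw [sub_apply, zeroEndSeries_apply, zeroEnd_of_last h, sub_self, zero_mul]
  · rw [hv' _ h, mul_one]

omit hv [Fintype Λ] in
theorem diag_mul_leftDiv (f : PathSeries (Option J) Λ K) :
    diag v * leftDiv v' f = f - zeroStart f := by
  ext n w
  rw [leftDiv, diag_mul_apply, diag_mul_apply, ← mul_assoc]
  by_cases h : n = none
  · subst h
    rw [sub_apply, zeroStart, sub_self, mul_zero]
  · rw [hv' _ h, one_mul]

omit hv in
theorem right_decomposition {f : PathSeries (Option J) Λ K} (hf : f none [] = 0) :
    f = rightDiv v' f * diag v + ∑ a, rightLetter a f * letter a := by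
  rw [rightDiv_mul_diag hv', sum_rightLetter_mul hf, sub_add_cancel]

omit hv in
theorem left_decomposition {f : PathSeries (Option J) Λ K} (hf : f none [] = 0) :
    f = diag v * leftDiv v' f + ∑ a, letter a * der none a f := by
  rw [diag_mul_leftDiv hv', sum_mul_leftLetter hf, sub_add_cancel]

omit hv hv' in
/-- The product at the interface. -/
def interface (v' : Option J → K) (f g : PathSeries (Option J) Λ K) : PathSeries (Option J) Λ K :=
  rightDiv v' f * g + zeroEndSeries f * leftDiv v' g + ∑ a, rightLetter a f * letter a * der none a g

omit hv hv' in
theorem interface_mul (x y : PathSeries (Option J) Λ K) {f g : PathSeries (Option J) Λ K}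
    (hf : f none [] = 0) (hg : g none [] = 0) :
    interface v' (x * f) (g * y) = x * interface v' f g * y := by
  simp only [interface, rightDiv_mul _ hf, leftDiv_mul hg, rightLetter_mul _ _ hf,
    zeroEndSeries_mul _ hf, leftLetter_mul _ hg, mul_add, add_mul, Finset.mul_sum, Finset.sum_mul,
    mul_assoc]

omit [Fintype Λ] in
omit hv hv' in
theorem zeroEndSeries_add (f g : PathSeries (Option J) Λ K) :
    zeroEndSeries (f + g) = zeroEndSeries f + zeroEndSeries g := by
  ext n w; exact zeroEnd_add _ _ _ _

omit hv hv' in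
theorem interface_add_left (f f' g : PathSeries (Option J) Λ K) :
    interface v' (f + f') g = interface v' f g + interface v' f' g := by
  have h : ∀ a : Λ, rightLetter a (f + f') = rightLetter a f + rightLetter a f' := fun a => rfl
  simp only [interface, rightDiv, zeroEndSeries_add, h, add_mul, Finset.sum_add_distrib]
  noncomm_ring

omit hv hv' in
theorem interface_add_right (f g g' : PathSeries (Option J) Λ K) :
    interface v' f (g + g') = interface v' f g + interface v' f g' := by
  have h : zeroStart (g + g') = zeroStart g + zeroStart g' := rfl
  simp only [interface, leftDiv, h, der_add, mul_add, Finset.sum_add_distrib]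
  noncomm_ring

omit hv hv' in
theorem interface_sum_left {ι : Type} (s : Finset ι) (f : ι → PathSeries (Option J) Λ K)
    (g : PathSeries (Option J) Λ K) :
    interface v' (∑ i ∈ s, f i) g = ∑ i ∈ s, interface v' (f i) g :=
  map_sum (AddMonoidHom.mk' (fun f => interface v' f g) fun f f' => interface_add_left f f' g) f s

omit hv hv' in
theorem interface_sum_right {ι : Type} (s : Finset ι) (f : PathSeries (Option J) Λ K)
    (g : ι → PathSeries (Option J) Λ K) :
    interface v' f (∑ i ∈ s, g i) = ∑ i ∈ s, interface v' f (g i) :=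
  map_sum (AddMonoidHom.mk' (fun g => interface v' f g) fun g g' => interface_add_right f g g') g s

omit [Fintype Λ] in
omit hv' in
theorem zeroEndSeries_diag : zeroEndSeries (diag v : PathSeries (Option J) Λ K) = 0 := by
  ext n w
  rw [zeroEndSeries_apply]
  rcases List.eq_nil_or_concat' w with rfl | ⟨w', ⟨c, m⟩, rfl⟩
  · exact hv
  · rw [zeroEnd_append]
    cases w' <;> rfl

theorem interface_diag_left (L : List Λ → Prop) {g : PathSeries (Option J) Λ K} :
    Agree L (· ≠ none) (interface v' (diag v) g) g := by
  intro n w hn _ _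
  have h : ∀ a : Λ, rightLetter a (diag v : PathSeries (Option J) Λ K) = 0 := fun a => by
    ext n w; cases w <;> rfl
  simp only [interface, rightDiv, zeroEndSeries_diag hv, h, zero_mul, Finset.sum_const_zero, add_zero,
    sub_zero]
  rw [diag_mul_diag, diag_mul_apply, Pi.mul_apply, hv' n hn, one_mul]

theorem interface_diag_right (L : List Λ → Prop) {f : PathSeries (Option J) Λ K} :
    Agree L (· ≠ none) (interface v' f (diag v)) f := by
  intro n w hn hw _
  have h : zeroStart (diag v : PathSeries (Option J) Λ K) = 0 := by
    ext n w; cases w <;> simp [zeroStart, hv]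
  simp only [interface, leftDiv, h, der_diag, mul_zero, Finset.sum_const_zero, add_zero,
    sub_zero]
  have hl : last n w ≠ none := last_prop (P := (· ≠ none)) hn hw
  rw [diag_mul_diag, rightDiv_mul_diag hv', add_apply, mul_diag_apply, Pi.mul_apply, mul_comm (v' _),
    hv' _ hl, mul_one, sub_apply, sub_add_cancel]

omit hv hv' in
theorem Agree.interface {L : List Λ → Prop} (hL : Hereditary L)
    {f f' g g' : PathSeries (Option J) Λ K} (hf : Agree L (fun _ => True) f f')
    (hg : Agree L (fun _ => True) g g') :
    Agree L (fun _ => True) (interface v' f g) (PathSeries.interface v' f' g') := by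
  have hz : Agree L (fun _ => True) (zeroEndSeries f) (zeroEndSeries f') := by
    intro n w _ _ hl
    rw [zeroEndSeries_apply, zeroEndSeries_apply]
    rcases List.eq_nil_or_concat' w with rfl | ⟨w', ⟨c, m⟩, rfl⟩
    · exact hf none [] trivial (by simp) hl
    · rw [zeroEnd_append, zeroEnd_append]
      exact hf n _ trivial (by simp) (by simpa using hl)
  refine ((((hf.sub hz).mul hL (Agree.refl _)).mul hL hg).add (hz.mul hL
    ((Agree.refl _).mul hL (hg.sub fun n w _ _ hl => hg none w trivial (by simp) hl)))).add
      (Agree.sum fun a _ => Agree.mul_letter_mul hL ?_ ?_)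
  · exact fun n w _ _ hl => hf n _ trivial (by simp) (by simpa using hl)
  · exact fun n w _ _ hl => hg none _ trivial (by simp) (by simpa using hl)

/-- A substitution that preserves the product at the interface of letters preserves it in general. -/
theorem interface_substSeries [DecidableEq Λ] {T : Λ → PathSeries (Option J) Λ K}
    (hT : ∀ a n, T a n [] = 0) {L : List Λ → Prop} (hL : Hereditary L)
    (h : ∀ a b, Agree L (· ≠ none) (interface v' (T a) (T b)) (if a = b then T a else 0))
    {f g : PathSeries (Option J) Λ K} (hf : f none [] = 0) (hg : g none [] = 0) :
    Agree L (· ≠ none) (interface v' (substSeries T f) (substSeries T g))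
      (substSeries T (interface v' f g)) := by
  have hd : (diag v : PathSeries (Option J) Λ K) none [] = 0 := hv
  set x₀ := substSeries T (rightDiv v' f) with hx₀
  set x := fun a => substSeries T (rightLetter a f) with hx
  set y₀ := substSeries T (leftDiv v' g) with hy₀
  set y := fun a => substSeries T (der none a g) with hy
  have hF : substSeries T f = x₀ * diag v + ∑ a, x a * T a := by
    conv_lhs => rw [right_decomposition hv' hf]
    simp only [substSeries_add, substSeries_mul hT, substSeries_sum, substSeries_diag hT,
      substSeries_letter hT, hx₀, hx]
  have hG : substSeries T g = diag v * y₀ + ∑ a, T a * y a := by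
    conv_lhs => rw [left_decomposition hv' hg]
    simp only [substSeries_add, substSeries_mul hT, substSeries_sum, substSeries_diag hT,
      substSeries_letter hT, hy₀, hy]
  have hz : substSeries T (zeroEndSeries f) = ∑ a, x a * T a := by
    rw [← sum_rightLetter_mul hf]
    simp only [substSeries_mul hT, substSeries_sum, substSeries_letter hT, hx]
  have hR : substSeries T (interface v' f g) = x₀ * (diag v * y₀) + ∑ a, x₀ * (T a * y a) +
      (∑ a, x a * T a) * y₀ + ∑ a, x a * T a * y a := by
    rw [interface, substSeries_add, substSeries_add, substSeries_mul hT, substSeries_mul hT, hz, hG,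
      substSeries_sum, mul_add, Finset.mul_sum]
    simp only [substSeries_mul hT, substSeries_letter hT, hx₀, hx, hy₀, hy]
  have hB : interface v' (substSeries T f) (substSeries T g) =
      x₀ * interface v' (diag v) (diag v) * y₀ + ∑ a, x₀ * interface v' (diag v) (T a) * y a +
      ∑ a, x a * interface v' (T a) (diag v) * y₀ +
      ∑ a, ∑ b, x a * interface v' (T a) (T b) * y b := by
    have h₁ : ∀ x y : PathSeries (Option J) Λ K, _ := fun x y => interface_mul (v' := v') x y hd hd
    have h₂ : ∀ b, ∀ x y : PathSeries (Option J) Λ K, _ :=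
      fun b x y => interface_mul (v' := v') x y hd (hT b none)
    have h₃ : ∀ b, ∀ x y : PathSeries (Option J) Λ K, _ :=
      fun b x y => interface_mul (v' := v') x y (hT b none) hd
    have h₄ : ∀ a b, ∀ x y : PathSeries (Option J) Λ K, _ :=
      fun a b x y => interface_mul (v' := v') x y (hT a none) (hT b none)
    rw [hF, hG]
    simp only [interface_add_left, interface_add_right, interface_sum_left, interface_sum_right,
      h₁, h₂, h₃, h₄, Finset.sum_add_distrib]
    rw [Finset.sum_comm (f := fun a b => x b * interface v' (T b) (T a) * y a)]
    abel
  rw [hB, hR, Finset.sum_mul]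
  have hc : ∀ {p p' : PathSeries (Option J) Λ K} (x y : PathSeries (Option J) Λ K),
      Agree L (· ≠ none) p p' → Agree L (· ≠ none) (x * p * y) (x * p' * y) :=
    fun x y h => ((Agree.refl x).mul hL h).mul hL (Agree.refl y)
  refine Agree.add (Agree.add (Agree.add ?_ ?_) ?_) ?_
  · rw [← mul_assoc]
    exact hc _ _ (interface_diag_left hv hv' L)
  · refine Agree.sum fun a _ => ?_
    rw [← mul_assoc]
    exact hc _ _ (interface_diag_left hv hv' L)
  · exact Agree.sum fun a _ => hc _ _ (interface_diag_right hv hv' L)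
  · refine Agree.sum fun a _ => ?_
    refine (Agree.sum fun b _ => hc _ _ (h a b)).trans ?_
    rw [Finset.sum_eq_single a (fun b _ hb => by rw [if_neg (Ne.symm hb)]; simp) (by simp),
      if_pos rfl]
    exact Agree.refl _

end Interface

/-! ### Cancellation -/

section Cancel

variable {N Λ K : Type} [CommRing K] {L : List Λ → Prop} {P : N → Prop}

theorem Agree.of_mul_left (hL : Hereditary L) {f x y : PathSeries N Λ K} (hf : ∀ n, IsUnit (f n []))
    (h : Agree L P (f * x) (f * y)) : Agree L P x y := by
  intro n w hn hw hl
  induction hk : w.length using Nat.strong_induction_on generalizing n w with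
  | _ l ih =>
    subst hk
    have key := h n w hn hw hl
    rw [mul_apply, mul_apply, Finset.sum_range_succ', Finset.sum_range_succ'] at key
    simp only [List.take_zero, List.drop_zero, last_nil] at key
    rw [Finset.sum_congr rfl fun k hk => ?_, add_right_inj] at key
    · exact (hf n).mul_left_cancel key
    · have h₁ : ∀ z ∈ w.take (k + 1), P z.2 := fun z hz => hw z (List.mem_of_mem_take hz)
      rw [Finset.mem_range] at hk
      rw [ih _ (by rw [List.length_drop]; omega) _ _ (last_prop hn h₁)
        (fun z hz => hw z (List.mem_of_mem_drop hz)) (hL _ _ ((List.drop_sublist _ w).map _) hl) rfl]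

theorem Agree.of_mul_right (hL : Hereditary L) {f x y : PathSeries N Λ K}
    (hf : ∀ n, IsUnit (f n [])) (h : Agree L P (x * f) (y * f)) : Agree L P x y := by
  have hL' : Hereditary fun l => L l.reverse := fun l l' hl => hL _ _ hl.reverse
  have h' := h.reverse
  rw [reverse_mul, reverse_mul] at h'
  have := (Agree.of_mul_left hL' (fun n => by simpa [reverse_apply] using hf n) h').reverse
  simpa using this

end Cancel

end PathSeries

end SymbPolylog

end

noncomputable section

namespace SymbPolylog

namespace PathSeries

/-! ### The relation between regular and inverted symbols -/

section Units

variable {τ R : Type} [CommRing R] [Algebra ℚ R] {N K : Type} [CommRing K] {M : ℕ}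
variable {g : Hbar →ₐ[ℚ] R} {u : N → MvPowerSeries τ R} {ψ : MvPowerSeries τ R →+* K}

theorem expMul_zero_left (x : MvPowerSeries τ R) : expMul (0 : R) x = 1 := by
  rw [expMul, map_zero, zero_mul, expOf_zero]

theorem expMul_zero_right (c : R) : expMul c (0 : MvPowerSeries τ R) = 1 := by
  rw [expMul, mul_zero, expOf_zero]

theorem isUnit_expMul (c : R) {x : MvPowerSeries τ R} (hx : x.constantCoeff = 0) :
    IsUnit (expMul c x) :=
  IsUnit.of_mul_eq_one (expMul (-c) x) (by rw [← expMul_add hx, add_neg_cancel, expMul_zero_left])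

theorem expMul_neg (c : R) (x : MvPowerSeries τ R) : expMul c (-x) = expMul (-c) x := by
  rw [expMul, expMul, map_neg, neg_mul, mul_neg]

theorem phi_nil (b : Fin M) (n : N) : phi g u ψ b n [] = ψ (expMul (logAt g b) (u n)) := by
  rw [phi]
  congr 1
  exact (congrArg _ (evalSeries_zero g _ _)).trans (mul_one _)

theorem isUnit_phi (hu : ∀ n, (u n).constantCoeff = 0) (b : Fin M) (n : N) :
    IsUnit (phi g u ψ b n []) := by
  rw [phi_nil]
  exact (isUnit_expMul _ (hu n)).map ψ

theorem isUnit_psi (hu : ∀ n, (u n).constantCoeff = 0) (b : Fin M) (n : N) :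
    IsUnit (psi g u ψ b n []) := by
  rw [psi, reverse_apply]
  simpa [revPath] using isUnit_phi (g := g) (u := -u) (ψ := ψ) (by simp [hu]) b n

end Units

section Rel

variable {τ R : Type} [CommRing R] [Algebra ℚ R] {J K : Type} [CommRing K]

/-- The relation between regular and inverted symbols, for the values `v'` that are inverse to `u`. -/
def InterfaceRel (M : ℕ) (g : Hbar →ₐ[ℚ] R) (u : Option J → MvPowerSeries τ R)
    (ψ : MvPowerSeries τ R →+* K) (v' : Option J → K) : Prop :=
  ∀ a b : Fin M, Agree (List.Pairwise (· < ·)) (· ≠ none)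
    (interface v' (letter a * psi g u ψ a) (phi g u ψ b * letter b)) (if a = b then letter a else 0)

variable {M : ℕ} {g h : Hbar →ₐ[ℚ] R} {u : Option J → MvPowerSeries τ R}
  {ψ : MvPowerSeries τ R →+* K} {v' : Option J → K}

theorem InterfaceRel.image (hg : InterfaceRel M g u ψ v') (a b : Fin M) :
    Agree (List.Pairwise (· < ·)) (· ≠ none)
      (interface v' (image g u ψ a) (image g u ψ b)) (if a = b then PathSeries.image g u ψ a else 0) := by
  have h₁ : PathSeries.image g u ψ a = phi g u ψ a * (letter a * psi g u ψ a) := mul_assoc _ _ _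
  have h₂ : PathSeries.image g u ψ b = phi g u ψ b * letter b * psi g u ψ b := rfl
  rw [h₁, h₂, interface_mul _ _ (by simp) (by simp)]
  refine ((((Agree.refl _).mul (hereditary_pairwise _) (hg a b)).mul (hereditary_pairwise _)
    (Agree.refl _))).trans ?_
  split_ifs with hab
  · subst hab
    rw [mul_assoc]
    exact Agree.refl _
  · rw [mul_zero, zero_mul]
    exact Agree.refl _

theorem InterfaceRel.prodPoint (hu : ∀ n, (u n).constantCoeff = 0) (hu0 : u none = 0)
    (hv' : ∀ n, n ≠ none → ψ (u n) * v' n = 1)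
    (hh : InterfaceRel M h u ψ v') (hg : InterfaceRel M g u ψ v') :
    InterfaceRel M (prodPoint h g) u ψ v' := by
  intro a b
  set L : List (Fin M) → Prop := List.Pairwise (· < ·)
  have hL : Hereditary L := hereditary_pairwise _
  set σ : PathSeries (Option J) (Fin M) K → PathSeries (Option J) (Fin M) K :=
    substSeries (PathSeries.image g u ψ) with hσ
  have h₁ : Agree L (fun _ => True) (letter a * psi (SymbPolylog.prodPoint h g) u ψ a)
      (letter a * psi g u ψ a * σ (psi h u ψ a)) := by
    rw [mul_assoc]
    exact (psi_prodPoint hu a).letter_mul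
  have h₂ : Agree L (fun _ => True) (phi (SymbPolylog.prodPoint h g) u ψ b * letter b)
      (σ (phi h u ψ b) * (phi g u ψ b * letter b)) := by
    rw [← mul_assoc]
    exact ((phi_prodPoint hu b).mono (fun _ => .inl) fun _ h => h).mul_letter
  refine ((Agree.interface hL h₁ h₂).mono (fun _ h => h) fun _ _ => trivial).trans ?_
  refine Agree.of_mul_left hL (isUnit_phi (g := g) (ψ := ψ) hu a) ?_
  refine Agree.of_mul_right hL (isUnit_psi (g := g) (ψ := ψ) hu b) ?_
  rw [← interface_mul _ _ (by simp) (by simp [hσ, substSeries_nil image_nil])]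
  have h₃ : phi g u ψ a * (letter a * psi g u ψ a * σ (psi h u ψ a)) =
      σ (letter a * psi h u ψ a) := by
    rw [hσ, substSeries_mul image_nil, substSeries_letter image_nil, PathSeries.image]
    simp only [mul_assoc]
  have h₄ : σ (phi h u ψ b) * (phi g u ψ b * letter b) * psi g u ψ b =
      σ (phi h u ψ b * letter b) := by
    rw [hσ, substSeries_mul image_nil, substSeries_letter image_nil, PathSeries.image]
    simp only [mul_assoc]
  rw [h₃, h₄]
  refine (interface_substSeries (v := fun n => ψ (u n)) (by simp [hu0]) hv' image_nil hL hg.image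
    (by simp) (by simp)).trans ?_
  refine (Agree.substSeries image_nil mem_of_image_ne_zero hL image_nil (fun _ => Agree.refl _)
    (hh a b)).trans ?_
  split_ifs with hab
  · subst hab
    rw [substSeries_letter image_nil, PathSeries.image]
    exact Agree.refl _
  · rw [substSeries_zero, mul_zero, zero_mul]
    exact Agree.refl _

/-! ### The relation in terms of generating series -/

omit [CommRing K] in
theorem seg_congr {N Λ : Type} (a : ℕ → Λ) {n n' : ℕ → N} {p q : ℕ}
    (h : ∀ r, p < r → r ≤ q → n r = n' r) : seg a n p q = seg a n' p q := by
  unfold seg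
  refine List.map_congr_left fun r hr => ?_
  rw [List.mem_range'_1] at hr
  rw [h _ (by omega) (by omega)]

theorem seg_succ {N Λ : Type} (a : ℕ → Λ) (n : ℕ → N) {p q : ℕ} (h : p ≤ q) :
    seg a n p (q + 1) = seg a n p q ++ [(a q, n (q + 1))] := by
  rw [← seg_append a n h (Nat.le_succ q), seg_cons a n (Nat.lt_succ_self q), seg_of_le _ _ le_rfl]

variable {Λ : Type}

omit [CommRing K] in
theorem zeroEnd_seg (F : PathSeries (Option J) Λ K) (a : ℕ → Λ) (n : ℕ → Option J) (r : ℕ) :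
    zeroEnd F (n 0) (seg a n 0 (r + 1)) =
      F (n 0) (seg a (Function.update n (r + 1) none) 0 (r + 1)) := by
  rw [seg_succ _ _ (Nat.zero_le r), zeroEnd_append, seg_succ _ _ (Nat.zero_le r),
    Function.update_self]
  congr 2
  refine seg_congr _ fun k _ hk => (Function.update_of_ne (by omega) _ _).symm

theorem interface_seg [Fintype Λ] {F G : PathSeries (Option J) Λ K} (hF : ∀ n, F n [] = 0)
    (hG : ∀ n, G n [] = 0) (a : ℕ → Λ) (n : ℕ → Option J) (d : ℕ) :
    interface v' F G (n 0) (seg a n 0 (d + 1)) =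
      ∑ r ∈ Finset.range d, v' (n (r + 1)) * (F (n 0) (seg a n 0 (r + 1)) *
        G (n (r + 1)) (seg a n (r + 1) (d + 1)) - zeroEnd F (n 0) (seg a n 0 (r + 1)) *
          G none (seg a n (r + 1) (d + 1))) +
      ∑ r ∈ Finset.range (d + 1), zeroEnd F (n 0) (seg a n 0 (r + 1)) *
        G none (seg a n r (d + 1)) := by
  classical
  have hsum : ∀ f : ℕ → K, f 0 = 0 → ∑ r ∈ Finset.Icc 0 (d + 1), f r =
      ∑ r ∈ Finset.range (d + 1), f (r + 1) := by
    intro f hf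
    rw [show Finset.Icc 0 (d + 1) = Finset.range (d + 2) by ext; simp; omega,
      Finset.sum_range_succ', hf, add_zero]
  have hs : ∀ p, seg a n p p = [] := fun p => seg_of_le _ _ le_rfl
  rw [interface, add_apply, add_apply, mul_seg _ _ (Nat.zero_le _), mul_seg _ _ (Nat.zero_le _),
    ← Finset.sum_add_distrib]
  congr 1
  · rw [hsum _ (by simp [hs, rightDiv, hF, zeroEndSeries_apply, zeroEnd]), Finset.sum_range_succ]
    rw [hs]
    simp only [hG, mul_zero, leftDiv, diag_mul_apply, sub_apply, zeroStart, sub_zero,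
      add_zero]
    refine Finset.sum_congr rfl fun r hr => ?_
    have hl : last (n 0) (seg a n 0 (r + 1)) = n (r + 1) := last_seg _ _ (Nat.zero_le _)
    rw [rightDiv, mul_diag_apply, hl, sub_apply, zeroEndSeries_apply]
    ring
  · have h : ∀ c r, (rightLetter c F * letter c : PathSeries (Option J) Λ K) (n 0)
        (seg a n 0 (r + 1)) = if a r = c then zeroEnd F (n 0) (seg a n 0 (r + 1)) else 0 := by
      intro c r
      rw [seg_succ a n (Nat.zero_le r), mul_letter_append, zeroEnd_append]
      split_ifs with hc
      · rw [hc]; rfl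
      · rfl
    rw [sum_apply, Finset.sum_congr rfl fun c _ =>
      mul_seg (rightLetter c F * letter c) (der none c G) (Nat.zero_le _), Finset.sum_comm,
      hsum _ (by simp [hs])]
    refine Finset.sum_congr rfl fun r hr => ?_
    rw [Finset.mem_range] at hr
    simp only [h]
    rw [Finset.sum_eq_single (a r) (fun c _ hc => by rw [if_neg (Ne.symm hc), zero_mul]) (by simp),
      if_pos rfl, seg_cons a n hr]
    rfl

/-- The left-hand side of the relation between regular and inverted symbols. -/
def relationSum (g : Hbar →ₐ[ℚ] R) (ψ : MvPowerSeries τ R →+* K) (d : ℕ) (a : ℕ → ℕ)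
    (s : ℕ → MvPowerSeries τ R) (c : ℕ → K) : K :=
  ∑ j ∈ Finset.range d, (-1) ^ j * c j * ψ (
      evalSeries g (d := j) (fun r => a (j - r)) (fun r => s j - s (j - 1 - r)) *
        expMul (logAt g (a d) - logAt g (a 0)) (s j) *
          evalSeries g (d := d - (j + 1)) (fun r => a (j + 1 + r)) (fun r => s (j + 1 + r) - s j) -
      evalSeries g (d := j) (fun r => a (j - r)) (fun r => -s (j - 1 - r)) *
        evalSeries g (d := d - (j + 1)) (fun r => a (j + 1 + r)) (fun r => s (j + 1 + r))) +
  ∑ j ∈ Finset.range (d + 1), (-1) ^ j * ψ (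
    evalSeries g (d := j) (fun r => a (j - r)) (fun r => -s (j - 1 - r)) *
      evalSeries g (d := d - j) (fun r => a (j + r)) (fun r => s (j + r)))

theorem interface_eq_relationSum (hu : ∀ n, (u n).constantCoeff = 0) (hu0 : u none = 0)
    (a : ℕ → Fin M) (n : ℕ → Option J) (d : ℕ) :
    interface v' (letter (a 0) * psi g u ψ (a 0)) (phi g u ψ (a d) * letter (a d)) (n 0)
      (seg a n 0 (d + 1)) = relationSum g ψ d (fun r => a r) (fun r => u (n (r + 1)))
        fun r => v' (n (r + 1)) := by
  rw [interface_seg (by simp) (by simp)]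
  have hF : ∀ n r, (letter (a 0) * psi g u ψ (a 0) : PathSeries (Option J) (Fin M) K) (n 0)
      (seg a n 0 (r + 1)) = psi g u ψ (a 0) (n 1) (seg a n (0 + 1) (r + 1)) := by
    intro n r
    rw [seg_cons _ _ (Nat.succ_pos r), letter_mul_cons, if_pos rfl]
  have hG : ∀ m r, r ≤ d → (phi g u ψ (a d) * letter (a d) : PathSeries (Option J) (Fin M) K) m
      (seg a n r (d + 1)) = phi g u ψ (a d) m (seg a n r d) := by
    intro m r hr
    rw [seg_succ _ _ hr, mul_letter_append, if_pos rfl]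
  have hP : ∀ r, r ≤ d → (phi g u ψ (a d) * letter (a d) : PathSeries (Option J) (Fin M) K) none
      (seg a n r (d + 1)) =
      ψ (evalSeries g (d := d - r) (fun q => a (r + q)) fun q => u (n (r + q + 1))) := by
    intro r hr
    have h₁ : seg a n r d = seg a (Function.update n r none) r d :=
      seg_congr _ fun k hk _ => (Function.update_of_ne (by omega) _ _).symm
    have h₂ := phi_seg (g := g) (u := u) (ψ := ψ) a (Function.update n r none) hr
    rw [Function.update_self, hu0, expMul_zero_right, one_mul] at h₂
    rw [hG _ _ hr, h₁, h₂]
    refine congrArg ψ (evalSeries_congr _ rfl (fun _ _ _ => rfl) fun k _ _ => ?_)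
    dsimp only
    rw [Function.update_of_ne (by omega), sub_zero]
  have hI : ∀ r, zeroEnd (letter (a 0) * psi g u ψ (a 0) : PathSeries (Option J) (Fin M) K) (n 0)
      (seg a n 0 (r + 1)) = (-1) ^ r *
        ψ (evalSeries g (d := r) (fun q => a (r - q)) fun q => -u (n (r - 1 - q + 1))) := by
    intro r
    have h₂ := psi_seg (g := g) (u := u) (ψ := ψ) a (Function.update n (r + 1) none) (Nat.zero_le r)
    rw [Function.update_self, hu0, neg_zero, expMul_zero_right, one_mul, map_mul, map_pow, map_neg,
      map_one, Nat.sub_zero] at h₂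
    have h₃ := hF (Function.update n (r + 1) none) r
    rw [Function.update_of_ne (by omega)] at h₃
    rw [zeroEnd_seg, h₃, h₂]
    congr 2
    refine evalSeries_congr _ rfl (fun _ _ _ => rfl) fun k hk _ => ?_
    dsimp only
    rw [Function.update_of_ne (by omega), zero_sub, show r - 1 - k + 1 = r - k by omega]
  rw [relationSum]
  congr 1
  · refine Finset.sum_congr rfl fun j hj => ?_
    rw [Finset.mem_range] at hj
    have h₁ := psi_seg (g := g) (u := u) (ψ := ψ) a n (Nat.zero_le j)
    have h₂ := phi_seg (g := g) (u := u) (ψ := ψ) a n (p := j + 1) (q := d) hj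
    have h₃ : evalSeries g (d := j - 0) (fun r => (a (j - r) : ℕ))
        (fun r => u (n (j + 1)) - u (n (j - r))) =
        evalSeries g (d := j) (fun r => (a (j - r) : ℕ))
        (fun r => u (n (j + 1)) - u (n (j - 1 - r + 1))) :=
      evalSeries_congr _ rfl (fun _ _ _ => rfl) fun k hk _ => by
        dsimp only
        rw [show j - 1 - k + 1 = j - k by omega]
    rw [hI, hP _ hj, hF, hG _ _ hj, h₁, h₂, h₃, sub_eq_add_neg (logAt g (a d)), expMul_add (hu _),
      expMul_neg]
    simp only [map_mul, map_sub, map_pow, map_neg, map_one, Nat.sub_zero]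
    ring
  · refine Finset.sum_congr rfl fun j hj => ?_
    rw [Finset.mem_range, Nat.lt_succ_iff] at hj
    rw [hI, hP _ hj, map_mul, mul_assoc]

theorem interfaceRel_iff (hu : ∀ n, (u n).constantCoeff = 0) (hu0 : u none = 0) :
    InterfaceRel M g u ψ v' ↔ ∀ (d : ℕ) (a : ℕ → Fin M) (n : ℕ → Option J), d ≠ 0 →
      (∀ r s, r < s → s ≤ d → a r < a s) → (∀ r ≤ d + 1, n r ≠ none) →
      relationSum g ψ d (fun r => a r) (fun r => u (n (r + 1))) (fun r => v' (n (r + 1))) = 0 := by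
  constructor
  · intro h d a n hd ha hn
    rw [← interface_eq_relationSum hu hu0, h (a 0) (a d), if_neg (ha 0 d (by omega) le_rfl).ne]
    · rfl
    · exact hn 0 (by omega)
    · intro x hx
      simp only [seg, List.mem_map, List.mem_range'_1] at hx
      obtain ⟨r, hr, rfl⟩ := hx
      exact hn _ (by omega)
    · rw [List.pairwise_iff_getElem]
      intro i j hi hj hij
      simp only [seg, List.map_map, List.length_map, List.length_range'] at hi hj
      simpa [seg] using ha i j hij (by omega)
  · intro h a b m w hm hw hl
    rcases w.eq_nil_or_concat' with rfl | ⟨w', x, rfl⟩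
    · split_ifs <;> simp [interface, rightDiv, zeroEndSeries_apply, zeroEnd]
    obtain ⟨a', n, rfl, hw', -, -⟩ := exists_seg m (w' ++ [x]) b
    rw [List.length_append, List.length_singleton] at hw'
    generalize w'.length = d at hw'
    have hw'' : ∀ r ≤ d + 1, n r ≠ none := by
      intro r hr
      rcases r with _ | r
      · exact hm
      · refine hw (a' r, n (r + 1)) ?_
        rw [hw']
        simp only [seg, List.mem_map, List.mem_range'_1]
        exact ⟨r, by omega, rfl⟩
    rw [hw', List.pairwise_iff_getElem] at hl
    have ha : ∀ r s, r < s → s ≤ d → a' r < a' s := by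
      intro r s hrs hs
      simpa [seg] using hl r s (by simp; omega) (by simp; omega) hrs
    rw [hw']
    by_cases ha0 : a' 0 = a
    swap
    · have hF : ∀ n r, (letter a * psi g u ψ a : PathSeries (Option J) (Fin M) K) (n 0)
          (seg a' n 0 (r + 1)) = 0 := by
        intro n r
        rw [seg_cons _ _ (Nat.succ_pos r), letter_mul_cons, if_neg ha0]
      have hF' : ∀ r, zeroEnd (letter a * psi g u ψ a : PathSeries (Option J) (Fin M) K) (n 0)
          (seg a' n 0 (r + 1)) = 0 := by
        intro r
        have := hF (Function.update n (r + 1) none) r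
        rw [Function.update_of_ne (by omega)] at this
        rw [zeroEnd_seg, this]
      rw [interface_seg (by simp) (by simp)]
      simp only [hF, hF', zero_mul, sub_zero, mul_zero, Finset.sum_const_zero, add_zero]
      split_ifs with hab
      · rw [← mul_one (letter a), seg_cons _ _ (Nat.succ_pos d), letter_mul_cons, if_neg ha0]
      · rfl
    subst ha0
    by_cases hb : a' d = b
    swap
    · have hG : ∀ m r, r ≤ d → (phi g u ψ b * letter b : PathSeries (Option J) (Fin M) K) m
          (seg a' n r (d + 1)) = 0 := by
        intro m r hr
        rw [seg_succ _ _ hr, mul_letter_append, if_neg hb]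
      rw [interface_seg (by simp) (by simp), Finset.sum_eq_zero fun r hr => ?_,
        Finset.sum_eq_zero fun r hr => ?_, add_zero]
      · split_ifs with hab
        · rw [← one_mul (letter _), seg_succ _ _ (Nat.zero_le d), mul_letter_append,
            if_neg (by rwa [hab])]
        · rfl
      · rw [Finset.mem_range] at hr
        rw [hG _ _ (by omega), mul_zero]
      · rw [Finset.mem_range] at hr
        rw [hG _ _ (by omega), hG _ _ (by omega), mul_zero, mul_zero, sub_zero, mul_zero]
    subst hb
    rw [interface_eq_relationSum hu hu0]
    rcases eq_or_ne d 0 with rfl | hd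
    · rw [if_pos rfl, seg_succ _ _ le_rfl, seg_of_le _ _ le_rfl, List.nil_append]
      simp [relationSum, letter]
      rw [evalSeries_zero, evalSeries_zero, map_one, mul_one]
    · rw [h d a' n hd ha hw'', if_neg (ha 0 d (by omega) le_rfl).ne]
      rfl

end Rel

end PathSeries

end SymbPolylog

end

noncomputable section

namespace SymbPolylog

/-! ### Substitutions that permute and rescale the variables -/

section Rescale

variable {R : Type} [CommRing R] {d : ℕ}

theorem coeff_subst_smul_X (e : Equiv.Perm (Fin d)) (c : Fin d → R) (f : MvPowerSeries (Fin d) R)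
    (m : Fin d →₀ ℕ) :
    MvPowerSeries.coeff m (MvPowerSeries.subst (fun i => MvPowerSeries.C (c i) * MvPowerSeries.X (e i))
      f) = (∏ i, c i ^ m (e i)) *
        MvPowerSeries.coeff (Finsupp.equivFunOnFinite.symm fun i => m (e i)) f := by
  classical
  rw [MvPowerSeries.coeff_subst (MvPowerSeries.hasSubst_of_constantCoeff_zero (by simp))]
  have h : ∀ k : Fin d →₀ ℕ, (k.prod fun i n => (MvPowerSeries.C (c i) * MvPowerSeries.X (e i) :
      MvPowerSeries (Fin d) R) ^ n) = MvPowerSeries.C (∏ i, c i ^ k i) *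
        MvPowerSeries.monomial (k.mapDomain e) 1 := by
    intro k
    rw [Finsupp.prod_fintype _ _ (by simp)]
    simp only [mul_pow, Finset.prod_mul_distrib, map_prod, map_pow, MvPowerSeries.X_pow_eq]
    rw [MvPowerSeries.prod_monomial, Finset.prod_const_one, Finsupp.mapDomain,
      Finsupp.sum_fintype _ _ (by simp)]
  simp only [h, MvPowerSeries.coeff_C_mul, MvPowerSeries.coeff_monomial]
  rw [finsum_eq_single _ (Finsupp.equivFunOnFinite.symm fun i => m (e i))]
  · rw [if_pos]
    · simp [mul_comm]
    · ext i
      rw [← e.apply_symm_apply i, Finsupp.mapDomain_apply e.injective]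
      simp
  · intro k hk
    rw [if_neg, mul_zero, smul_zero]
    rintro rfl
    refine hk ?_
    ext i
    simp [Finsupp.mapDomain_apply e.injective]

theorem divX_neg (j : Fin d) (f : MvPowerSeries (Fin d) R) : divX j (-f) = -divX j f := rfl

theorem X_mul_divX {j : Fin d} {f : MvPowerSeries (Fin d) R} (h : MvPowerSeries.X j ∣ f) :
    MvPowerSeries.X j * divX j f = f := by
  obtain ⟨f, rfl⟩ := h
  congr 1
  ext m
  change MvPowerSeries.coeff (m + Finsupp.single j 1) (MvPowerSeries.X j * f) = _
  rw [MvPowerSeries.X_def, add_comm, MvPowerSeries.coeff_add_monomial_mul, one_mul]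

theorem X_dvd_of_subst_eq_zero {j : Fin d} {f : MvPowerSeries (Fin d) R}
    (h : MvPowerSeries.subst (fun i => if i = j then 0 else (MvPowerSeries.X i : MvPowerSeries (Fin d) R))
      f = 0) : MvPowerSeries.X j ∣ f := by
  rw [MvPowerSeries.X_dvd_iff]
  intro m hm
  have key := coeff_subst_smul_X (Equiv.refl _) (fun i => if i = j then (0 : R) else 1) f m
  have h' : (fun i => MvPowerSeries.C (if i = j then (0 : R) else 1) *
      (MvPowerSeries.X (Equiv.refl (Fin d) i) : MvPowerSeries (Fin d) R)) =
      fun i => if i = j then 0 else MvPowerSeries.X i := by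
    funext i
    split_ifs <;> simp
  rw [h', h, map_zero, Finset.prod_eq_one, one_mul] at key
  · rw [key]
    congr 1
    ext i
    simp
  · intro i _
    split_ifs with hi
    · simp [hi, hm]
    · simp

end Rescale

/-! ### Inverted symbols -/

section Inversion

variable {R τ : Type} [CommRing R] [Algebra ℚ R]

theorem map_INV_inv {d : ℕ} {a : Fin (d + 1) → ℕ} (ha : StrictMono a) :
    MvPowerSeries.map (INV : Hbar →+* Hsymb) (barSeries (a ∘ Fin.rev)) =
      MvPowerSeries.subst (fun r => -MvPowerSeries.X r.rev : Fin d → MvPowerSeries (Fin d) Hsymb)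
        (invSeries d a) := by
  have h : (fun r => -MvPowerSeries.X r.rev : Fin d → MvPowerSeries (Fin d) Hsymb) =
      fun r => MvPowerSeries.C (-1) * MvPowerSeries.X (Fin.revPerm r) := by
    funext r
    simp
  rw [h]
  refine MvPowerSeries.ext fun m => ?_
  rw [coeff_subst_smul_X, MvPowerSeries.coeff_map]
  cases d with
  | zero =>
    rw [invSeries]
    change INV (MvPowerSeries.coeff m 1) = _
    rw [show m = 0 from Subsingleton.elim _ _,
      show (Finsupp.equivFunOnFinite.symm _ : Fin 0 →₀ ℕ) = 0 from Subsingleton.elim _ _]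
    simp
  | succ d =>
    have hn : ¬ StrictMono (a ∘ Fin.rev) := fun h' =>
      lt_asymm (h' (show (0 : Fin (d + 2)) < Fin.last _ from Fin.last_pos))
        (ha (show (Fin.last (d + 1)).rev < Fin.rev 0 by rw [Fin.rev_last, Fin.rev_zero]; exact Fin.last_pos))
    change INV (barSym _ _) = _
    rw [barSym, dif_neg hn, dif_pos (ha.comp_strictAnti Fin.rev_strictAnti), INV,
      MvPolynomial.aeval_X]
    have h₂ : (a ∘ Fin.rev) ∘ Fin.rev = a := by ext; simp
    dsimp only [OrderEmbedding.coe_ofStrictMono]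
    rw [h₂, Finset.prod_pow_eq_pow_sum]
    congr 2

theorem map_INV_reg {d : ℕ} {a : Fin (d + 1) → ℕ} (ha : StrictMono a) :
    MvPowerSeries.map (INV : Hbar →+* Hsymb) (barSeries a) = symSeries a := by
  cases d with
  | zero => exact map_one _
  | succ d =>
    refine MvPowerSeries.ext fun m => ?_
    have h : MvPowerSeries.coeff m (symSeries a) = MvPolynomial.X
        (.poly d (OrderEmbedding.ofStrictMono a ha) fun r => (m r).succPNat) := dif_pos ha
    rw [MvPowerSeries.coeff_map, h]
    change INV (barSym _ _) = _
    rw [barSym, dif_pos ha, INV, MvPolynomial.aeval_X]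

variable {d : ℕ} {s : Fin d → MvPowerSeries τ R} (q : Hsymb →ₐ[ℚ] R)

theorem map_comp_INV (f : MvPowerSeries (Fin d) Hbar) :
    MvPowerSeries.map (q.comp INV : Hbar →+* R) f =
      MvPowerSeries.map (q : Hsymb →+* R) (MvPowerSeries.map (INV : Hbar →+* Hsymb) f) := by
  ext m
  simp

theorem evalSeries_inv {a a' : Fin (d + 1) → ℕ} (ha : StrictMono a) (ha' : ∀ r, a' r = a r.rev)
    (hs : ∀ r, (s r).constantCoeff = 0) :
    evalSeries (q.comp INV) a' s =
      MvPowerSeries.subst (fun r => -s r.rev) (MvPowerSeries.map (q : Hsymb →+* R) (invSeries d a)) := by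
  obtain rfl : a' = a ∘ Fin.rev := funext ha'
  rw [evalSeries, map_comp_INV, map_INV_inv ha, ← evalHom_apply q hs, evalHom_subst q hs (by simp)]
  simp

theorem evalSeries_reg {a : Fin (d + 1) → ℕ} (ha : StrictMono a) :
    evalSeries (q.comp INV) a s =
      MvPowerSeries.subst s (MvPowerSeries.map (q : Hsymb →+* R) (symSeries a)) := by
  rw [evalSeries, map_comp_INV, map_INV_reg ha]

end Inversion

/-! ### The relation between regular and inverted symbols of `H^symb` -/

section Recursion

/-- The numerators of the second sum in the recursion for inverted symbols. -/
def invNumerator (d : ℕ) (a : ℕ → ℕ) (j : Fin (d + 1)) : MvPowerSeries (Fin (d + 1)) Hsymb :=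
  MvPowerSeries.subst (fun r : Fin j => MvPowerSeries.X ⟨r, by omega⟩ - MvPowerSeries.X j)
      (invSeries j fun r => a r) * expSeries (logSym (a 0) (a (d + 1))) j *
    MvPowerSeries.subst (fun r : Fin (d - j) =>
      MvPowerSeries.X ⟨j + 1 + r, by omega⟩ - MvPowerSeries.X j) (symSeries fun r => a (j + 1 + r)) -
  MvPowerSeries.subst (fun r : Fin j => (MvPowerSeries.X ⟨r, by omega⟩ :
        MvPowerSeries (Fin (d + 1)) Hsymb))
      (invSeries j fun r => a r) *
    MvPowerSeries.subst (fun r : Fin (d - j) =>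
      (MvPowerSeries.X ⟨j + 1 + r, by omega⟩ : MvPowerSeries (Fin (d + 1)) Hsymb))
      (symSeries fun r => a (j + 1 + r))

theorem X_dvd_invNumerator (d : ℕ) (a : ℕ → ℕ) (j : Fin (d + 1)) :
    MvPowerSeries.X j ∣ invNumerator d a j := by
  refine X_dvd_of_subst_eq_zero ?_
  have hs : ∀ i, (if i = j then 0 else
      (MvPowerSeries.X i : MvPowerSeries (Fin (d + 1)) Hsymb)).constantCoeff = 0 := fun i => by
    split_ifs <;> simp
  have hmap : ∀ (k : ℕ) (f : MvPowerSeries (Fin k) Hsymb),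
      MvPowerSeries.map (AlgHom.id ℚ Hsymb : Hsymb →+* Hsymb) f = f := fun k f =>
    MvPowerSeries.ext fun m => by simp
  have h := evalHom_apply (AlgHom.id ℚ Hsymb) hs (invNumerator d a j)
  rw [hmap] at h
  rw [← h, invNumerator, map_sub, map_mul, map_mul, map_mul, evalHom_subst _ _ (by simp),
    evalHom_subst _ _ (by simp), evalHom_subst _ _ (by simp), evalHom_subst _ _ (by simp),
    evalHom_expSeries]
  simp only [map_sub, evalHom_X, if_pos, sub_zero, mul_zero, expOf_zero, mul_one, sub_self]

theorem invSeries_relation (d : ℕ) (a : ℕ → ℕ) :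
    (-1) ^ (d + 1) * invSeries (d + 1) (fun r => a r) +
      ∑ j : Fin (d + 1), (-1) ^ (j : ℕ) *
        (MvPowerSeries.subst (fun r : Fin j => (MvPowerSeries.X ⟨r, by omega⟩ :
            MvPowerSeries (Fin (d + 1)) Hsymb)) (invSeries j fun r => a r) *
          MvPowerSeries.subst (fun r : Fin (d + 1 - j) => (MvPowerSeries.X ⟨j + r, by omega⟩ :
            MvPowerSeries (Fin (d + 1)) Hsymb)) (symSeries fun r => a (j + r))) +
      ∑ j : Fin (d + 1), (-1) ^ (j : ℕ) * divX j (invNumerator d a j) = 0 := by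
  have hsq : ∀ k : ℕ, ((-1) ^ k * (-1) ^ k : MvPowerSeries (Fin (d + 1)) Hsymb) = 1 := fun k => by
    rw [← mul_pow]; simp
  rw [invSeries, mul_add, Finset.mul_sum, Finset.mul_sum]
  have h : ∀ x y z w : MvPowerSeries (Fin (d + 1)) Hsymb, x = -z → y = -w → x + y + z + w = 0 := by
    rintro _ _ z w rfl rfl
    ring
  refine h _ _ _ _ ?_ ?_
  · rw [← Finset.sum_neg_distrib]
    refine Finset.sum_congr rfl fun j _ => ?_
    have hj : ∀ x y : MvPowerSeries (Fin (d + 1)) Hsymb,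
        (-1) ^ (d + 1) * ((-1) ^ (d + j : ℕ) * x * y) = -((-1) ^ (j : ℕ) * (x * y)) := fun x y => by
      rw [pow_add, pow_add]
      linear_combination (-(-1) ^ (j : ℕ) * x * y) * hsq d
    exact hj _ _
  · rw [← Finset.sum_neg_distrib]
    refine Finset.sum_congr rfl fun j _ => ?_
    rw [← mul_assoc, pow_add _ (d + 1), ← mul_assoc, hsq, one_mul, ← mul_neg, ← divX_neg,
      invNumerator, neg_sub]
    rfl

end Recursion

namespace PathSeries

variable {τ R K : Type} [CommRing R] [Algebra ℚ R] [CommRing K] {ψ : MvPowerSeries τ R →+* K}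

theorem relationSum_comp_INV (q : Hsymb →ₐ[ℚ] R) {d : ℕ} (hd : d ≠ 0) {a : ℕ → ℕ}
    (ha : ∀ r s, r < s → s ≤ d → a r < a s) {s : ℕ → MvPowerSeries τ R}
    (hs : ∀ r, (s r).constantCoeff = 0) {c : ℕ → K} (hc : ∀ r < d, c r * ψ (s r) = 1) :
    relationSum (q.comp INV) ψ d a s c = 0 := by
  obtain ⟨d, rfl⟩ : ∃ k, d = k + 1 := Nat.exists_eq_succ_of_ne_zero hd
  have hs' : ∀ r : Fin (d + 1), (s r).constantCoeff = 0 := fun r => hs r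
  have hI : ∀ (j : ℕ) (x : ℕ → MvPowerSeries τ R), j ≤ d + 1 → (∀ r, (x r).constantCoeff = 0) →
      evalSeries (q.comp INV) (d := j) (fun r => a (j - r)) (fun r => -x (j - 1 - r)) =
      MvPowerSeries.subst (fun r : Fin j => x r)
        (MvPowerSeries.map (q : Hsymb →+* R) (invSeries j fun r => a r)) := by
    intro j x hj hx
    rw [evalSeries_inv q (a := fun r : Fin (j + 1) => a r) (fun r t h => ha _ _ h (by omega))
      (fun r => by simp [Fin.rev]) (by simp [hx])]
    congr 1
    funext r
    rw [neg_neg, Fin.val_rev]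
    congr 1
    omega
  have hP : ∀ (j k : ℕ) (x : ℕ → MvPowerSeries τ R), j + k = d + 1 →
      evalSeries (q.comp INV) (d := k) (fun r => a (j + r)) (fun r => x (j + r)) =
      MvPowerSeries.subst (fun r : Fin k => x (j + r))
        (MvPowerSeries.map (q : Hsymb →+* R) (symSeries fun r => a (j + r))) := by
    intro j k x hj
    exact evalSeries_reg q fun r t h => ha _ _ (by simpa using h) (by omega)
  have hl : logAt (q.comp INV) (a (d + 1)) - logAt (q.comp INV) (a 0) =
      q (logSym (a 0) (a (d + 1))) := by
    rw [← apply_logSym, AlgHom.comp_apply]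
    congr 1
    simp [logSym, toBar, INV]
  have hrel := congrArg (fun f => ψ (evalHom q hs' f)) (invSeries_relation d a)
  simp only [map_add, map_sum, map_mul, map_pow, map_neg, map_one, map_zero] at hrel
  have hD : ∀ j : Fin (d + 1), ψ (evalHom q hs' (divX j (invNumerator d a j))) =
      c j * ψ (evalHom q hs' (invNumerator d a j)) := by
    intro j
    conv_rhs => rw [← X_mul_divX (X_dvd_invNumerator d a j), map_mul, map_mul, evalHom_X, ← mul_assoc,
      hc j j.2, one_mul]
  have hP₀ : evalSeries (q.comp INV) (d := d + 1 - (d + 1)) (fun r => a (d + 1 + r))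
      (fun r => s (d + 1 + r)) = 1 :=
    (evalSeries_congr _ (Nat.sub_self _) (fun _ _ _ => rfl) fun _ _ _ => rfl).trans
      (evalSeries_zero _ (fun r => a (d + 1 + r)) fun r => s (d + 1 + r))
  rw [relationSum, Finset.sum_range, Finset.sum_range_succ _ (d + 1), Finset.sum_range, ← hrel,
    add_comm, add_comm (∑ _, _)]
  congr 1
  · congr 1
    · rw [hI _ _ le_rfl hs, hP₀, mul_one, evalHom_apply]
    · refine Finset.sum_congr rfl fun j _ => ?_
      rw [hI _ _ j.2.le hs, hP j (d + 1 - j) s (by omega), evalHom_subst _ _ (by simp),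
        evalHom_subst _ _ (by simp)]
      simp only [evalHom_X, map_mul]
  · refine Finset.sum_congr rfl fun j _ => ?_
    have hx : ∀ r, (s r - s j).constantCoeff = 0 := fun r => by simp [hs]
    have h₁ : evalSeries (q.comp INV) (d := j) (fun r => a (j - r)) (fun r => s j - s (j - 1 - r)) = _ :=
      (evalSeries_congr _ rfl (fun _ _ _ => rfl) fun r _ _ => (neg_sub _ _).symm).trans
        (hI j (fun r => s r - s j) j.2.le hx)
    have h₂ : ∀ x : ℕ → MvPowerSeries τ R, evalSeries (q.comp INV) (d := d + 1 - (j + 1))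
        (fun r => a (j + 1 + r)) (fun r => x (j + 1 + r)) =
        MvPowerSeries.subst (fun r : Fin (d - j) => x (j + 1 + r))
        (MvPowerSeries.map (q : Hsymb →+* R) (symSeries fun r => a (j + 1 + r))) := fun x => by
      rw [← hP (j + 1) (d - j) x (by omega)]
      exact evalSeries_congr _ (by omega) (fun _ _ _ => rfl) fun _ _ _ => rfl
    rw [mul_assoc, hD, invNumerator, map_sub (evalHom q hs'), map_mul (evalHom q hs'),
      map_mul (evalHom q hs'), map_mul (evalHom q hs'), evalHom_subst _ _ (by simp),
      evalHom_subst _ _ (by simp), evalHom_subst _ _ (by simp), evalHom_subst _ _ (by simp),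
      evalHom_expSeries, h₁, hI _ _ j.2.le hs, h₂ s, h₂ fun r => s r - s j, hl]
    simp only [evalHom_X, map_sub (evalHom q hs')]

/-- The relation between regular and inverted symbols holds for the inverted symbols in `H^symb`. -/
theorem interfaceRel_comp_INV {J : Type} (M : ℕ) (q : Hsymb →ₐ[ℚ] R)
    {u : Option J → MvPowerSeries τ R} (hu : ∀ n, (u n).constantCoeff = 0) (hu0 : u none = 0)
    {v' : Option J → K} (hv' : ∀ n, n ≠ none → ψ (u n) * v' n = 1) :
    InterfaceRel M (q.comp INV) u ψ v' := by
  rw [interfaceRel_iff hu hu0]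
  intro d a n hd ha hn
  refine relationSum_comp_INV q hd (fun r s hrs hs => ha r s hrs hs) (fun r => hu _) fun r hr => ?_
  rw [mul_comm, hv' _ (hn _ (by omega))]

end PathSeries

end SymbPolylog

end

noncomputable section

namespace SymbPolylog

namespace PathSeries

/-! ### Points are determined by the regular symbols and the relation -/

section Unique

variable {R : Type} [CommRing R] [Algebra ℚ R]

/-- The inverses of the values `genericValue`. -/
def genericInv (d : ℕ) (R : Type) [CommRing R] :
    Option (Fin d) → FractionRing (MvPowerSeries (Fin d) R)
  | none => 0
  | some j => IsLocalization.mk' (M := nonZeroDivisors (MvPowerSeries (Fin d) R)) _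
      (1 : MvPowerSeries (Fin d) R) ⟨MvPowerSeries.X j, MvPowerSeries.X_mem_nonzeroDivisors⟩

omit [Algebra ℚ R] in
theorem genericValue_mul_genericInv {d : ℕ} (n : Option (Fin d)) (hn : n ≠ none) :
    algebraMap (MvPowerSeries (Fin d) R) (FractionRing (MvPowerSeries (Fin d) R)) (genericValue n) *
      genericInv d R n = 1 := by
  obtain ⟨j, rfl⟩ := Option.ne_none_iff_exists'.1 hn
  have := IsLocalization.mk'_spec (M := nonZeroDivisors (MvPowerSeries (Fin d) R))
    (FractionRing (MvPowerSeries (Fin d) R)) 1 ⟨MvPowerSeries.X j, MvPowerSeries.X_mem_nonzeroDivisors⟩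
  rw [map_one, mul_comm] at this
  exact this

/-- A point satisfies the relations between regular and inverted symbols. -/
def Inversive (g : Hbar →ₐ[ℚ] R) : Prop :=
  ∀ d M : ℕ, InterfaceRel M g (genericValue (d := d)) (algebraMap _ (FractionRing _)) (genericInv d R)

theorem Inversive.prodPoint {g h : Hbar →ₐ[ℚ] R} (hh : Inversive h) (hg : Inversive g) :
    Inversive (prodPoint h g) := fun d M =>
  (hh d M).prodPoint constantCoeff_genericValue rfl genericValue_mul_genericInv (hg d M)

theorem inversive_comp_INV (q : Hsymb →ₐ[ℚ] R) : Inversive (q.comp INV) := fun _ M =>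
  interfaceRel_comp_INV M q constantCoeff_genericValue rfl genericValue_mul_genericInv

variable {g g' : Hbar →ₐ[ℚ] R}

theorem map_barSeries_eq (hreg : ∀ d i n, g (.X (.reg d i n)) = g' (.X (.reg d i n))) {d : ℕ}
    {a : Fin (d + 1) → ℕ} (ha : StrictMono a) :
    MvPowerSeries.map (g : Hbar →+* R) (barSeries a) =
      MvPowerSeries.map (g' : Hbar →+* R) (barSeries a) := by
  cases d with
  | zero => exact (map_one _).trans (map_one _).symm
  | succ d =>
    refine MvPowerSeries.ext fun m => ?_
    rw [MvPowerSeries.coeff_map, MvPowerSeries.coeff_map]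
    change g (barSym _ _) = g' (barSym _ _)
    rw [barSym, dif_pos ha]
    exact hreg _ _ _

theorem map_barSeries_rev_eq (hlog : ∀ r, g (.X (.log r)) = g' (.X (.log r)))
    (hreg : ∀ d i n, g (.X (.reg d i n)) = g' (.X (.reg d i n))) (hg : Inversive g)
    (hg' : Inversive g') (d : ℕ) {a : Fin (d + 1) → ℕ} (ha : StrictMono a) :
    MvPowerSeries.map (g : Hbar →+* R) (barSeries (a ∘ Fin.rev)) =
      MvPowerSeries.map (g' : Hbar →+* R) (barSeries (a ∘ Fin.rev)) := by
  induction d using Nat.strong_induction_on with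
  | _ d ih =>
  rcases d with _ | d
  · exact (map_one _).trans (map_one _).symm
  set M := a (Fin.last _) + 1
  obtain ⟨b, hb⟩ : ∃ b : ℕ → Fin M, ∀ r : Fin (d + 2), (b r : ℕ) = a r :=
    ⟨fun r => ⟨a ⟨min r (d + 1), by omega⟩, Nat.lt_succ_of_le (ha.monotone (Fin.le_last _))⟩,
      fun r => by
        have : min (r : ℕ) (d + 1) = r := by omega
        simp [this]⟩
  have hb' : ∀ r s, r < s → s ≤ d + 1 → b r < b s := by
    intro r s hrs hs
    rw [Fin.lt_def, hb ⟨r, by omega⟩, hb ⟨s, by omega⟩]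
    exact ha hrs
  obtain ⟨n, hn, hn'⟩ : ∃ n : ℕ → Option (Fin (d + 1)), (∀ r, n r ≠ none) ∧
      ∀ r : Fin (d + 1), n (r + 1) = some r :=
    ⟨fun r => some ⟨min (r - 1) d, by omega⟩, by simp, fun r => by
      have : min (r : ℕ) d = r := by omega
      simp [this]⟩
  have key := (((interfaceRel_iff constantCoeff_genericValue rfl).1 (hg (d + 1) M)) (d + 1) b n
    (by omega) hb' fun r _ => hn r).trans
    (((interfaceRel_iff constantCoeff_genericValue rfl).1 (hg' (d + 1) M)) (d + 1) b n
    (by omega) hb' fun r _ => hn r).symm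
  have hlogAt : ∀ r, logAt g r = logAt g' r := by
    intro r
    simp [logAt, logSym, toBar, hlog]
  have hI : ∀ j ≤ d, ∀ s : Fin j → MvPowerSeries (Fin (d + 1)) R,
      evalSeries g (fun r : Fin (j + 1) => (b (j - r) : ℕ)) s =
        evalSeries g' (fun r : Fin (j + 1) => (b (j - r) : ℕ)) s := by
    intro j hj s
    have h : (fun r : Fin (j + 1) => (b (j - r) : ℕ)) = (fun r : Fin (j + 1) => (b r : ℕ)) ∘ Fin.rev := by
      funext r
      simp [Fin.rev]
    rw [evalSeries, evalSeries, h, ih j (by omega) fun r t h => hb' _ _ h (by omega)]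
  have hP : ∀ j k, j + k ≤ d + 1 → ∀ s : Fin k → MvPowerSeries (Fin (d + 1)) R,
      evalSeries g (fun r : Fin (k + 1) => (b (j + r) : ℕ)) s =
        evalSeries g' (fun r : Fin (k + 1) => (b (j + r) : ℕ)) s := by
    intro j k hj s
    rw [evalSeries, evalSeries, map_barSeries_eq hreg fun r t h => hb' _ _ (by simpa using h) (by omega)]
  rw [relationSum, relationSum, Finset.sum_range_succ _ (d + 1), Finset.sum_range_succ _ (d + 1),
    Finset.sum_congr rfl fun j hj => ?_, add_right_inj, Finset.sum_congr rfl fun j hj => ?_,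
    add_right_inj] at key
  rotate_left
  · rw [Finset.mem_range] at hj
    rw [hI j (by omega), hP _ _ (by omega)]
  · rw [Finset.mem_range] at hj
    rw [hI j (by omega), hI j (by omega), hP _ _ (by omega), hP _ _ (by omega), hlogAt, hlogAt]
  have hone : ((-1) ^ (d + 1) * (-1) ^ (d + 1) :
      FractionRing (MvPowerSeries (Fin (d + 1)) R)) = 1 := by
    rw [← mul_pow]; simp
  replace key := congrArg ((-1) ^ (d + 1) * ·) key
  simp only [← mul_assoc, hone, one_mul] at key
  replace key := IsFractionRing.injective _ _ key
  have hP₀ : ∀ g : Hbar →ₐ[ℚ] R, evalSeries g (d := d + 1 - (d + 1)) (fun r => b (d + 1 + r))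
      (fun r => genericValue (R := R) (n (d + 1 + r + 1))) = 1 := fun g =>
    (evalSeries_congr _ (Nat.sub_self _) (fun _ _ _ => rfl) fun _ _ _ => rfl).trans
      (evalSeries_zero _ (fun r => b (d + 1 + r)) fun r => genericValue (n (d + 1 + r + 1)))
  rw [hP₀, hP₀, mul_one, mul_one] at key
  have hb'' : (fun r : Fin (d + 1 + 1) => (b (d + 1 - r) : ℕ)) = a ∘ Fin.rev := by
    funext r
    rw [Function.comp_apply, ← hb, Fin.val_rev]
    congr 2
    omega
  have hn'' : (fun r : Fin (d + 1) => -(genericValue (n (d + 1 - 1 - r + 1)) :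
      MvPowerSeries (Fin (d + 1)) R)) = fun r => -MvPowerSeries.X r.rev := by
    funext r
    have : d + 1 - 1 - (r : ℕ) + 1 = r.rev + 1 := by rw [Fin.val_rev]; omega
    rw [this, hn']
    rfl
  rw [hb'', hn'', evalSeries, evalSeries] at key
  replace key := congrArg (MvPowerSeries.subst
    (fun r => -MvPowerSeries.X r.rev : Fin (d + 1) → MvPowerSeries (Fin (d + 1)) R)) key
  have hs : MvPowerSeries.HasSubst
      (fun r => -MvPowerSeries.X r.rev : Fin (d + 1) → MvPowerSeries (Fin (d + 1)) R) :=
    hasSubst_of_zero (by simp)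
  have hX : ∀ r : Fin (d + 1), MvPowerSeries.subst
    (fun r => -MvPowerSeries.X r.rev : Fin (d + 1) → MvPowerSeries (Fin (d + 1)) R)
      (-MvPowerSeries.X r.rev : MvPowerSeries (Fin (d + 1)) R) = MvPowerSeries.X r := by
    intro r
    rw [← MvPowerSeries.coe_substAlgHom (R := R) hs, map_neg, MvPowerSeries.coe_substAlgHom,
      MvPowerSeries.subst_X hs]
    simp
  rw [MvPowerSeries.subst_comp_subst_apply hs hs, MvPowerSeries.subst_comp_subst_apply hs hs] at key
  simp only [hX] at key
  rwa [MvPowerSeries.subst_self] at key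

/-- A point that satisfies the relations is determined by its values on the regular symbols. -/
theorem algHom_ext_of_inversive (hlog : ∀ r, g (.X (.log r)) = g' (.X (.log r)))
    (hreg : ∀ d i n, g (.X (.reg d i n)) = g' (.X (.reg d i n))) (hg : Inversive g)
    (hg' : Inversive g') : g = g' := by
  refine MvPolynomial.algHom_ext fun x => ?_
  rcases x with r | ⟨d, i, n⟩ | ⟨d, i, n⟩
  · exact hlog r
  · exact hreg d i n
  · have h := congrArg (MvPowerSeries.coeff (shift (n ∘ Fin.rev)))
      (map_barSeries_rev_eq hlog hreg hg hg' (d + 1) i.strictMono)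
    have hb : MvPowerSeries.coeff (shift (n ∘ Fin.rev)) (barSeries (d := d + 1) (i ∘ Fin.rev)) =
        MvPolynomial.X (.inv d i n) := by
      change barSym _ _ = _
      have hn : ¬ StrictMono (i ∘ Fin.rev) := fun h' =>
        lt_asymm (h' (show (0 : Fin (d + 2)) < Fin.last _ from Fin.last_pos))
          (i.strictMono (show (Fin.last (d + 1)).rev < Fin.rev 0 by
            rw [Fin.rev_last, Fin.rev_zero]; exact Fin.last_pos))
      rw [barSym, dif_neg hn, dif_pos (i.strictMono.comp_strictAnti Fin.rev_strictAnti)]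
      congr 2
      · ext r; simp
      · funext r
        refine PNat.eq ?_
        have := (n r).pos
        simp [shift]
        omega
    rwa [MvPowerSeries.coeff_map, MvPowerSeries.coeff_map, hb] at h

end Unique

/-! ### The coproduct of `H^symb` -/

section Comul

variable {R : Type} [CommRing R] [Algebra ℚ R]

@[simp] theorem comulBar_log (r : ℕ) : comulBar (.X (.log r)) = .X (.log r) ⊗ₜ 1 + 1 ⊗ₜ .X (.log r) := by
  simp [comulBar]

@[simp] theorem INV_log (r : ℕ) : INV (.X (.log r)) = .X (.log r) := by simp [INV]

@[simp] theorem INV_reg (d : ℕ) (i : Fin (d + 2) ↪o ℕ) (n : Fin (d + 1) → ℕ+) :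
    INV (.X (.reg d i n)) = .X (.poly d i n) := by simp [INV]

@[simp] theorem toBar_log (r : ℕ) : toBar (.X (.log r)) = .X (.log r) := by simp [toBar]

@[simp] theorem toBar_poly (d : ℕ) (i : Fin (d + 2) ↪o ℕ) (n : Fin (d + 1) → ℕ+) :
    toBar (.X (.poly d i n)) = .X (.reg d i n) := by simp [toBar]

theorem comulH_log (r : ℕ) : comulH (.X (.log r)) = .X (.log r) ⊗ₜ 1 + 1 ⊗ₜ .X (.log r) := by
  simp [comulH]

theorem productMap_comp_map_INV (p q : Hsymb →ₐ[ℚ] R) :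
    ((Algebra.TensorProduct.productMap p q).comp (Algebra.TensorProduct.map INV INV)).comp comulBar =
      prodPoint (p.comp INV) (q.comp INV) := by
  rw [prodPoint]
  congr 1
  ext <;> simp

theorem productMap_comp_comulH (p q : Hsymb →ₐ[ℚ] R) :
    (Algebra.TensorProduct.productMap p q).comp comulH =
      (prodPoint (p.comp INV) (q.comp INV)).comp toBar := by
  rw [← productMap_comp_map_INV]
  rfl

theorem comulH_comp_INV : comulH.comp INV = (Algebra.TensorProduct.map INV INV).comp comulBar := by
  have h : (Algebra.TensorProduct.map INV INV).comp comulBar =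
      prodPoint ((Algebra.TensorProduct.includeLeft : Hsymb →ₐ[ℚ] Hsymb ⊗[ℚ] Hsymb).comp INV)
        ((Algebra.TensorProduct.includeRight : Hsymb →ₐ[ℚ] Hsymb ⊗[ℚ] Hsymb).comp INV) := by
    rw [← productMap_comp_map_INV, show Algebra.TensorProduct.productMap
      (Algebra.TensorProduct.includeLeft : Hsymb →ₐ[ℚ] Hsymb ⊗[ℚ] Hsymb)
      Algebra.TensorProduct.includeRight = AlgHom.id ℚ _ by ext <;> simp, AlgHom.id_comp]
  refine algHom_ext_of_inversive (fun r => ?_) (fun d i n => ?_) (inversive_comp_INV _) ?_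
  · simp [comulH]
  · simp [comulH]
  · rw [h]
    exact (inversive_comp_INV _).prodPoint (inversive_comp_INV _)

theorem productMap_comp_comulH_comp_INV (p q : Hsymb →ₐ[ℚ] R) :
    ((Algebra.TensorProduct.productMap p q).comp comulH).comp INV =
      prodPoint (p.comp INV) (q.comp INV) := by
  rw [← productMap_comp_map_INV, AlgHom.comp_assoc, comulH_comp_INV, AlgHom.comp_assoc]

theorem algHom_ext_of_phi {p p' : Hsymb →ₐ[ℚ] R} {g g' : Hbar →ₐ[ℚ] R} (hp : p = g.comp toBar)
    (hp' : p' = g'.comp toBar) (hlog : ∀ r, p (.X (.log r)) = p' (.X (.log r)))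
    (h : ∀ (d M : ℕ) (b : Fin M), Agree (fun l => (l ++ [b]).Pairwise (· < ·)) (fun _ => True)
      (phi g (genericValue (d := d + 1)) (RingHom.id _) b) (phi g' genericValue (RingHom.id _) b)) :
    p = p' := by
  refine MvPolynomial.algHom_ext fun x => ?_
  rcases x with r | ⟨d, i, n⟩
  · exact hlog r
  · rw [hp, hp', AlgHom.comp_apply, AlgHom.comp_apply, toBar_poly]
    exact apply_reg_eq i n (h d)

theorem productMap_comul_assoc (p q r : Hsymb →ₐ[ℚ] R) :
    (Algebra.TensorProduct.productMap p ((Algebra.TensorProduct.productMap q r).comp comulH)).comp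
      comulH = (Algebra.TensorProduct.productMap
        ((Algebra.TensorProduct.productMap p q).comp comulH) r).comp comulH := by
  refine algHom_ext_of_phi (productMap_comp_comulH _ _) (productMap_comp_comulH _ _) (fun s => ?_)
    fun d M b => ?_
  · simp [comulH_log, add_assoc]
  · rw [productMap_comp_comulH_comp_INV, productMap_comp_comulH_comp_INV]
    exact phi_prodPoint_assoc _ constantCoeff_genericValue b

/-- The homomorphism that kills all symbols. -/
def trivialPoint (R : Type) [CommRing R] [Algebra ℚ R] : Hsymb →ₐ[ℚ] R := MvPolynomial.aeval 0

theorem evalSeries_trivial {τ : Type} {d : ℕ} (a : Fin (d + 1) → ℕ) (s : Fin d → MvPowerSeries τ R)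
    (hs : ∀ r, (s r).constantCoeff = 0) :
    evalSeries (MvPolynomial.aeval 0 : Hbar →ₐ[ℚ] R) a s = if d = 0 then 1 else 0 := by
  cases d with
  | zero => exact evalSeries_zero _ _ _
  | succ d =>
    have h : MvPowerSeries.map ((MvPolynomial.aeval 0 : Hbar →ₐ[ℚ] R) : Hbar →+* R) (barSeries a) = 0 := by
      refine MvPowerSeries.ext fun m => ?_
      rw [MvPowerSeries.coeff_map]
      change (MvPolynomial.aeval 0 : Hbar →ₐ[ℚ] R) (barSym _ _) = 0
      rw [barSym]
      split_ifs <;> simp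
    rw [if_neg (by omega), evalSeries, h, ← MvPowerSeries.coe_substAlgHom (R := R) (hasSubst_of_zero hs),
      map_zero]

theorem inversive_trivial : Inversive (MvPolynomial.aeval 0 : Hbar →ₐ[ℚ] R) := by
  intro k M
  rw [interfaceRel_iff constantCoeff_genericValue rfl]
  intro d a n hd _ _
  have hu := constantCoeff_genericValue (R := R) (d := k)
  have hl : ∀ b, logAt (MvPolynomial.aeval 0 : Hbar →ₐ[ℚ] R) b = 0 := fun b => by
    simp [logAt, logSym, toBar]
  rw [relationSum, Finset.sum_eq_zero, Finset.sum_eq_zero, add_zero]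
  · intro j hj
    rw [Finset.mem_range] at hj
    rw [evalSeries_trivial _ _ (by simp [hu]), evalSeries_trivial _ _ (by simp [hu])]
    have : ¬ (j = 0 ∧ d - j = 0) := by omega
    split_ifs <;> simp
    omega
  · intro j hj
    rw [evalSeries_trivial _ _ (by simp [hu]), evalSeries_trivial _ _ (by simp [hu]),
      evalSeries_trivial _ _ (by simp [hu]), evalSeries_trivial _ _ (by simp [hu]), hl, hl, sub_self,
      expMul_zero_left, mul_one, sub_self, map_zero, mul_zero]

theorem trivialPoint_comp_INV :
    (trivialPoint R).comp INV = (MvPolynomial.aeval 0 : Hbar →ₐ[ℚ] R) :=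
  algHom_ext_of_inversive (fun r => by simp [trivialPoint]) (fun d i n => by simp [trivialPoint])
    (inversive_comp_INV _) inversive_trivial

section Trivial

variable {τ N K : Type} [CommRing K] {M : ℕ} {u : N → MvPowerSeries τ R} {ψ : MvPowerSeries τ R →+* K}

theorem phi_trivial (hu : ∀ n, (u n).constantCoeff = 0) (b : Fin M) :
    phi (MvPolynomial.aeval 0 : Hbar →ₐ[ℚ] R) u ψ b = 1 := by
  have hl : ∀ b, logAt (MvPolynomial.aeval 0 : Hbar →ₐ[ℚ] R) b = 0 := fun b => by
    simp [logAt, logSym, toBar]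
  ext n w
  rw [phi, hl, expMul_zero_left, one_mul, evalSeries_trivial _ _ (by simp [hu])]
  cases w <;> simp

theorem image_trivial (hu : ∀ n, (u n).constantCoeff = 0) (b : Fin M) :
    image (MvPolynomial.aeval 0 : Hbar →ₐ[ℚ] R) u ψ b = letter b := by
  rw [image, psi, phi_trivial hu, phi_trivial (by simp [hu]), one_def, reverse_diag, ← one_def, one_mul,
    mul_one]

end Trivial

theorem INV_comp_toBar : INV.comp toBar = AlgHom.id ℚ Hsymb := by
  refine MvPolynomial.algHom_ext fun x => ?_
  cases x <;> simp

theorem productMap_trivialPoint_left (q : Hsymb →ₐ[ℚ] R) :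
    (Algebra.TensorProduct.productMap (trivialPoint R) q).comp comulH = q := by
  refine algHom_ext_of_phi (g' := q.comp INV) (productMap_comp_comulH _ _)
    (by rw [AlgHom.comp_assoc, INV_comp_toBar, AlgHom.comp_id]) (fun r => ?_) fun d M b => ?_
  · simp [comulH_log, trivialPoint]
  · rw [trivialPoint_comp_INV]
    refine ((phi_prodPoint constantCoeff_genericValue b).mono (fun _ => .inl) fun _ h => h).trans ?_
    rw [phi_trivial constantCoeff_genericValue, substSeries_one image_nil, one_mul]
    exact Agree.refl _

theorem productMap_trivialPoint_right (q : Hsymb →ₐ[ℚ] R) :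
    (Algebra.TensorProduct.productMap q (trivialPoint R)).comp comulH = q := by
  refine algHom_ext_of_phi (g' := q.comp INV) (productMap_comp_comulH _ _)
    (by rw [AlgHom.comp_assoc, INV_comp_toBar, AlgHom.comp_id]) (fun r => ?_) fun d M b => ?_
  · simp [comulH_log, trivialPoint]
  · rw [trivialPoint_comp_INV]
    refine ((phi_prodPoint constantCoeff_genericValue b).mono (fun _ => .inl) fun _ h => h).trans ?_
    have h : image (MvPolynomial.aeval 0 : Hbar →ₐ[ℚ] R) (genericValue (d := d + 1)) (RingHom.id _) =
        (letter : Fin M → _) := funext fun b => image_trivial constantCoeff_genericValue b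
    rw [phi_trivial constantCoeff_genericValue, mul_one, h, substSeries_letter_self]
    exact Agree.refl _

end Comul

end PathSeries

end SymbPolylog

end

noncomputable section

namespace SymbPolylog

open PathSeries

/-! ### Naturality of the coproduct in the arguments -/

section Matches

variable {R τ : Type} [CommRing R] [Algebra ℚ R] {D : ℕ}

/-- The values of the point `g` on the symbols with arguments from `a` are those of the point `g'` on
the symbols with arguments from `b`, up to the powers of `l` given by the weight. -/
def Matches (τ : Type) (l : R) (g g' : Hbar →ₐ[ℚ] R) (a b : Fin (D + 1) → ℕ) : Prop :=
  (∀ x y, g (toBar (logSym (a x) (a y))) = l * g' (toBar (logSym (b x) (b y)))) ∧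
    ∀ (e : ℕ) (c : Fin (e + 1) → Fin (D + 1)) (s : Fin e → MvPowerSeries τ R),
      StrictMono c ∨ StrictAnti c → (∀ r, (s r).constantCoeff = 0) →
        evalSeries g (a ∘ c) s =
          MvPowerSeries.C l ^ e * evalSeries g' (b ∘ c) fun r => MvPowerSeries.C l * s r

theorem sum_coproductIndex_lengths {d k : ℕ} (p : CoproductIndex d k) :
    k + (p.i 0 + ∑ q : Fin k, ((p.j q - p.i q.castSucc : ℕ) + (p.i q.succ - p.j q - 1))) = d := by
  have h : ∀ (k : ℕ) (i : Fin (k + 1) → ℕ) (j : Fin k → ℕ), (∀ q : Fin k, i q.castSucc ≤ j q) →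
      (∀ q : Fin k, j q < i q.succ) →
      k + (i 0 + ∑ q : Fin k, ((j q - i q.castSucc) + (i q.succ - j q - 1))) = i (Fin.last k) := by
    intro k
    induction k with
    | zero => intro i j _ _; simp
    | succ k ih =>
      intro i j h₁ h₂
      have := ih (fun q => i q.castSucc) (fun q => j q.castSucc) (fun q => h₁ _) fun q => h₂ _
      rw [Fin.sum_univ_castSucc]
      have h₃ := h₁ (Fin.last k)
      have h₄ : j (Fin.last k) < i (Fin.last (k + 1)) := h₂ (Fin.last k)
      rw [show (Fin.last k).succ = Fin.last (k + 1) from rfl]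
      simp only [Fin.castSucc_zero, Fin.succ_castSucc] at this ⊢
      omega
  exact (h k (fun q => p.i q) (fun q => p.j q) p.i_le_j p.j_lt_i).trans p.i_last

theorem Matches.prodPoint {l : R} {g g' h h' : Hbar →ₐ[ℚ] R} {a b : Fin (D + 1) → ℕ}
    (ha : StrictMono a) (hb : StrictMono b) (hh : Matches τ l h h' a b) (hg : Matches τ l g g' a b)
    {e : ℕ} {c : Fin (e + 1) → Fin (D + 1)} {s : Fin e → MvPowerSeries τ R}
    (hc : StrictMono c ∨ StrictAnti c) (hs : ∀ r, (s r).constantCoeff = 0) :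
    evalSeries (prodPoint h g) (a ∘ c) s = MvPowerSeries.C l ^ e *
      evalSeries (prodPoint h' g') (b ∘ c) fun r => MvPowerSeries.C l * s r := by
  have hs' : ∀ r, (MvPowerSeries.C l * s r).constantCoeff = 0 := fun r => by simp [hs]
  rw [evalSeries_prodPoint h g _ (hc.imp ha.comp ha.comp_strictAnti) hs,
    evalSeries_prodPoint h' g' _ (hc.imp hb.comp hb.comp_strictAnti) hs', Finset.mul_sum]
  refine Finset.sum_congr rfl fun k _ => ?_
  rw [Finset.mul_sum]
  refine Finset.sum_congr rfl fun p _ => ?_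
  have hi : StrictMono p.i := by
    rw [Fin.strictMono_iff_lt_succ]
    intro q
    have := p.i_le_j q
    have := p.j_lt_i q
    rw [Fin.lt_def]
    omega
  have h₁ : ∀ (e' : ℕ) (f : Fin (e' + 1) → Fin (e + 1)) (x : Fin e' → MvPowerSeries τ R),
      StrictMono f ∨ StrictAnti f → (∀ r, (x r).constantCoeff = 0) →
      evalSeries g (fun r => (a ∘ c) (f r)) x = MvPowerSeries.C l ^ e' *
        evalSeries g' (fun r => (b ∘ c) (f r)) fun r => MvPowerSeries.C l * x r := by
    intro e' f x hf hx
    refine hg.2 e' (c ∘ f) x ?_ hx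
    rcases hc with hc | hc <;> rcases hf with hf | hf
    · exact .inl (hc.comp hf)
    · exact .inr (hc.comp_strictAnti hf)
    · exact .inr (hc.comp_strictMono hf)
    · exact .inl (hc.comp hf)
  have h₂ : evalSeries h ((a ∘ c) ∘ p.i) (s ∘ p.j) = MvPowerSeries.C l ^ k *
        evalSeries h' ((b ∘ c) ∘ p.i) ((fun r => MvPowerSeries.C l * s r) ∘ p.j) :=
    hh.2 k (c ∘ p.i) (s ∘ p.j) (hc.imp (fun hc => hc.comp hi) fun hc => hc.comp_strictMono hi)
      fun r => hs _
  have h₃ : ∀ q : Fin k, g (toBar (logSym ((a ∘ c) (p.i q.castSucc)) ((a ∘ c) (p.i q.succ)))) =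
      l * g' (toBar (logSym ((b ∘ c) (p.i q.castSucc)) ((b ∘ c) (p.i q.succ)))) :=
    fun q => hg.1 _ _
  rw [h₂, h₁ (p.i 0) (fun r => ⟨r, by omega⟩) (fun r => s ⟨r, by omega⟩) (.inl fun r t hrt => hrt)
    fun r => hs _]
  have h₄ : ∀ q : Fin k, _ := fun q => h₁ (p.j q - p.i q.castSucc) (fun r => ⟨p.j q - r, by omega⟩)
    (fun r => s (p.j q) - s ⟨p.j q - 1 - r, by omega⟩)
    (.inr fun r t hrt => by rw [Fin.lt_def] at hrt ⊢; dsimp only; omega) fun r => by simp [hs]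
  have h₅ : ∀ q : Fin k, _ := fun q => h₁ (p.i q.succ - p.j q - 1)
    (fun r => ⟨p.j q + 1 + r, by have := p.j_lt_i q; omega⟩)
    (fun r => s ⟨p.j q + 1 + r, by omega⟩ - s (p.j q))
    (.inl fun r t hrt => Nat.add_lt_add_left hrt _) fun r => by simp [hs]
  have h₆ : ∀ (x : R) (y : MvPowerSeries τ R), MvPowerSeries.C (l * x) * y =
      MvPowerSeries.C x * (MvPowerSeries.C l * y) := fun x y => by
    rw [map_mul]
    ring
  have h₇ : (MvPowerSeries.C l : MvPowerSeries τ R) ^ e = MvPowerSeries.C l ^ k *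
      (MvPowerSeries.C l ^ (p.i 0 : ℕ) * ∏ q : Fin k, (MvPowerSeries.C l ^ (p.j q - p.i q.castSucc : ℕ) *
        MvPowerSeries.C l ^ (p.i q.succ - p.j q - 1 : ℕ))) := by
    simp only [← pow_add, Finset.prod_pow_eq_pow_sum]
    rw [sum_coproductIndex_lengths p]
  rw [h₇]
  simp only [h₃, h₄, h₅, h₆, mul_sub, Finset.prod_mul_distrib]
  ring

omit [Algebra ℚ R] in
theorem subst_eq_of_eq {e : ℕ} {l : R} {f f' : MvPowerSeries (Fin e) R}
    (h : f = MvPowerSeries.C l ^ e *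
      MvPowerSeries.subst (fun r => MvPowerSeries.C l * MvPowerSeries.X r :
        Fin e → MvPowerSeries (Fin e) R) f')
    {s : Fin e → MvPowerSeries τ R} (hs : ∀ r, (s r).constantCoeff = 0) :
    MvPowerSeries.subst s f =
      MvPowerSeries.C l ^ e * MvPowerSeries.subst (fun r => MvPowerSeries.C l * s r) f' := by
  have hX : MvPowerSeries.HasSubst (fun r => MvPowerSeries.C l * MvPowerSeries.X r :
      Fin e → MvPowerSeries (Fin e) R) := hasSubst_of_zero (by simp)
  have hs' := hasSubst_of_zero hs
  rw [h, ← MvPowerSeries.coe_substAlgHom hs', map_mul, map_pow, MvPowerSeries.coe_substAlgHom hs',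
    MvPowerSeries.subst_comp_subst_apply hX hs', MvPowerSeries.subst_C]
  congr 2
  funext r
  rw [← MvPowerSeries.coe_substAlgHom hs', map_mul, MvPowerSeries.coe_substAlgHom hs',
    MvPowerSeries.subst_C, MvPowerSeries.subst_X hs']

omit [Algebra ℚ R] in
theorem coeff_subst_C_mul_X {e : ℕ} (l : R) (f : MvPowerSeries (Fin e) R) (m : Fin e →₀ ℕ) :
    MvPowerSeries.coeff m (MvPowerSeries.C l ^ e *
      MvPowerSeries.subst (fun r => MvPowerSeries.C l * MvPowerSeries.X r :
        Fin e → MvPowerSeries (Fin e) R) f) = l ^ (e + ∑ r, m r) * MvPowerSeries.coeff m f := by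
  have := coeff_subst_smul_X (Equiv.refl _) (fun _ => l) f m
  simp only [Equiv.refl_apply] at this
  rw [← map_pow, MvPowerSeries.coeff_C_mul, this, pow_add, Finset.prod_pow_eq_pow_sum, mul_assoc]
  congr 3
  exact congrArg _ (by ext; rfl)

theorem evalHom_invNumerator {d : ℕ} (q : Hsymb →ₐ[ℚ] R) {s : Fin (d + 1) → MvPowerSeries τ R}
    (hs : ∀ r, (s r).constantCoeff = 0) (a : ℕ → ℕ) (j : Fin (d + 1)) :
    evalHom q hs (invNumerator d a j) =
      MvPowerSeries.subst (fun r : Fin j => s ⟨r, by omega⟩ - s j)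
          (MvPowerSeries.map (q : Hsymb →+* R) (invSeries j fun r => a r)) *
        expOf (MvPowerSeries.C (q (logSym (a 0) (a (d + 1)))) * s j) *
        MvPowerSeries.subst (fun r : Fin (d - j) => s ⟨j + 1 + r, by omega⟩ - s j)
          (MvPowerSeries.map (q : Hsymb →+* R) (symSeries fun r => a (j + 1 + r))) -
      MvPowerSeries.subst (fun r : Fin j => s ⟨r, by omega⟩)
          (MvPowerSeries.map (q : Hsymb →+* R) (invSeries j fun r => a r)) *
        MvPowerSeries.subst (fun r : Fin (d - j) => s ⟨j + 1 + r, by omega⟩)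
          (MvPowerSeries.map (q : Hsymb →+* R) (symSeries fun r => a (j + 1 + r))) := by
  rw [invNumerator, map_sub (evalHom q hs), map_mul (evalHom q hs), map_mul (evalHom q hs),
    map_mul (evalHom q hs), evalHom_subst _ _ (by simp), evalHom_subst _ _ (by simp),
    evalHom_subst _ _ (by simp), evalHom_subst _ _ (by simp), evalHom_expSeries]
  simp only [evalHom_X, map_sub (evalHom q hs)]

theorem evalHom_divX {d : ℕ} {p p' : Hsymb →ₐ[ℚ] R} {l : R}
    {s s' : Fin (d + 1) → MvPowerSeries (Fin (d + 1)) R} (hs : ∀ r, (s r).constantCoeff = 0)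
    (hs' : ∀ r, (s' r).constantCoeff = 0) {j : Fin (d + 1)} (hj : s j = MvPowerSeries.X j)
    (hj' : s' j = MvPowerSeries.C l * MvPowerSeries.X j) {f f' : MvPowerSeries (Fin (d + 1)) Hsymb}
    (hf : MvPowerSeries.X j ∣ f) (hf' : MvPowerSeries.X j ∣ f')
    (h : evalHom p hs f = MvPowerSeries.C l ^ d * evalHom p' hs' f') :
    evalHom p hs (divX j f) = MvPowerSeries.C l ^ (d + 1) * evalHom p' hs' (divX j f') := by
  rw [← X_mul_divX hf, ← X_mul_divX hf', map_mul, map_mul, evalHom_X, evalHom_X, hj, hj'] at h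
  have hz : (MvPowerSeries.X j : MvPowerSeries (Fin (d + 1)) R) ∈ nonZeroDivisors _ :=
    MvPowerSeries.X_mem_nonzeroDivisors
  refine (mul_cancel_left_mem_nonZeroDivisors hz).1 (h.trans ?_)
  ring

/-- The values of `p` on the symbols with arguments from `a` are those of `p'` on the symbols with
arguments from `b`, up to the powers of `l` given by the weight. -/
structure SymMatches (l : R) (p p' : Hsymb →ₐ[ℚ] R) (a b : Fin (D + 1) ↪o ℕ) : Prop where
  log : ∀ x y, p (logSym (a x) (a y)) = l * p' (logSym (b x) (b y))
  poly : ∀ (e : ℕ) (c : Fin (e + 2) ↪o Fin (D + 1)) (n : Fin (e + 1) → ℕ+),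
    p (.X (.poly e (c.trans a) n)) = l ^ (∑ r, (n r : ℕ)) * p' (.X (.poly e (c.trans b) n))

namespace SymMatches

variable {l : R} {p p' : Hsymb →ₐ[ℚ] R} {a b : Fin (D + 1) ↪o ℕ} (h : SymMatches l p p' a b)
include h

theorem subst_symSeries {e : ℕ} {c : Fin (e + 1) → Fin (D + 1)} (hc : StrictMono c)
    {s : Fin e → MvPowerSeries τ R} (hs : ∀ r, (s r).constantCoeff = 0) :
    MvPowerSeries.subst s (MvPowerSeries.map (p : Hsymb →+* R) (symSeries (a ∘ c))) =
      MvPowerSeries.C l ^ e * MvPowerSeries.subst (fun r => MvPowerSeries.C l * s r)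
        (MvPowerSeries.map (p' : Hsymb →+* R) (symSeries (b ∘ c))) := by
  refine subst_eq_of_eq (MvPowerSeries.ext fun m => ?_) hs
  rw [coeff_subst_C_mul_X, MvPowerSeries.coeff_map, MvPowerSeries.coeff_map]
  cases e with
  | zero =>
    have : m = 0 := Subsingleton.elim _ _
    subst this
    change p (MvPowerSeries.coeff 0 1) = _ * p' (MvPowerSeries.coeff 0 1)
    simp
  | succ e =>
    have h₁ : ∀ a : Fin (D + 1) ↪o ℕ, MvPowerSeries.coeff m (symSeries (a ∘ c)) = MvPolynomial.X
        (.poly e ((OrderEmbedding.ofStrictMono c hc).trans a) fun r => (m r).succPNat) := fun a =>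
      dif_pos (a.strictMono.comp hc)
    rw [h₁, h₁]
    refine (h.poly e _ _).trans ?_
    simp [Finset.sum_add_distrib, add_comm]

theorem subst_invSeries (e : ℕ) {c : ℕ → Fin (D + 1)} (hc : ∀ r s, r < s → s ≤ e → c r < c s)
    {s : Fin e → MvPowerSeries τ R} (hs : ∀ r, (s r).constantCoeff = 0) :
    MvPowerSeries.subst s (MvPowerSeries.map (p : Hsymb →+* R) (invSeries e fun r => a (c r))) =
      MvPowerSeries.C l ^ e * MvPowerSeries.subst (fun r => MvPowerSeries.C l * s r)
        (MvPowerSeries.map (p' : Hsymb →+* R) (invSeries e fun r => b (c r))) := by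
  induction e using Nat.strong_induction_on generalizing τ with
  | _ e ih =>
  refine subst_eq_of_eq ?_ hs
  rcases e with _ | d
  · rw [invSeries, invSeries, pow_zero, one_mul, map_one, map_one,
      ← MvPowerSeries.coe_substAlgHom (R := R) (hasSubst_of_zero (by simp)), map_one]
  have hX : ∀ r, (MvPowerSeries.X r : MvPowerSeries (Fin (d + 1)) R).constantCoeff = 0 := by simp
  have hlX : ∀ r, (MvPowerSeries.C l * MvPowerSeries.X r :
      MvPowerSeries (Fin (d + 1)) R).constantCoeff = 0 := by simp
  have hsym : ∀ (j k : ℕ) (s : Fin k → MvPowerSeries (Fin (d + 1)) R), j + k ≤ d + 1 →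
      (∀ r, (s r).constantCoeff = 0) →
      MvPowerSeries.subst s (MvPowerSeries.map (p : Hsymb →+* R)
        (symSeries fun r : Fin (k + 1) => a (c (j + r)))) =
      MvPowerSeries.C l ^ k * MvPowerSeries.subst (fun r => MvPowerSeries.C l * s r)
        (MvPowerSeries.map (p' : Hsymb →+* R) (symSeries fun r : Fin (k + 1) => b (c (j + r)))) :=
    fun j k s hj hs => h.subst_symSeries (c := fun r : Fin (k + 1) => c (j + r))
      (fun r t hrt => hc _ _ (Nat.add_lt_add_left hrt j) (by omega)) hs
  have hinv : ∀ (j : ℕ) (s : Fin j → MvPowerSeries (Fin (d + 1)) R), j < d + 1 →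
      (∀ r, (s r).constantCoeff = 0) →
      MvPowerSeries.subst s (MvPowerSeries.map (p : Hsymb →+* R)
        (invSeries j fun r => a (c r))) =
      MvPowerSeries.C l ^ j * MvPowerSeries.subst (fun r => MvPowerSeries.C l * s r)
        (MvPowerSeries.map (p' : Hsymb →+* R) (invSeries j fun r => b (c r))) :=
    fun j s hj hs => ih j hj (fun r t hrt ht => hc r t hrt (by omega)) hs
  have hA := congrArg (evalHom p hX) (invSeries_relation d fun r => a (c r))
  have hB := congrArg (fun f => MvPowerSeries.C l ^ (d + 1) * evalHom p' hlX f)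
    (invSeries_relation d fun r => b (c r))
  have hN : ∀ j : Fin (d + 1), evalHom p hX (invNumerator d (fun r => a (c r)) j) =
      MvPowerSeries.C l ^ d * evalHom p' hlX (invNumerator d (fun r => b (c r)) j) := by
    intro j
    have hp : (MvPowerSeries.C l ^ d : MvPowerSeries (Fin (d + 1)) R) =
        MvPowerSeries.C l ^ (j : ℕ) * MvPowerSeries.C l ^ (d - j) := by
      rw [← pow_add]
      congr 1
      omega
    have he : ∀ (y : MvPowerSeries (Fin (d + 1)) R) (z : R),
        MvPowerSeries.C (l * z) * y = MvPowerSeries.C z * (MvPowerSeries.C l * y) := fun y z => by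
      rw [map_mul]
      ring
    rw [evalHom_invNumerator, evalHom_invNumerator, h.log, he, hp,
      hinv j _ j.2 (by simp), hinv j _ j.2 (by simp), hsym _ _ _ (by omega) (by simp),
      hsym _ _ _ (by omega) (by simp)]
    simp only [mul_sub]
    ring
  have hD := fun j => evalHom_divX hX hlX rfl rfl (X_dvd_invNumerator d (fun r => (a (c r) : ℕ)) j)
    (X_dvd_invNumerator d (fun r => (b (c r) : ℕ)) j) (hN j)
  have hI : ∀ f : MvPowerSeries (Fin (d + 1)) Hsymb,
      evalHom p hX f = MvPowerSeries.map (p : Hsymb →+* R) f := fun f => by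
    rw [evalHom_apply]
    exact congrFun MvPowerSeries.subst_self _
  rw [← hI, ← evalHom_apply p' hlX]
  have hS : ∀ j : Fin (d + 1), evalHom p hX (MvPowerSeries.subst (fun r : Fin j =>
        (MvPowerSeries.X ⟨r, by omega⟩ : MvPowerSeries (Fin (d + 1)) Hsymb))
          (invSeries j fun r => a (c r))) *
      evalHom p hX (MvPowerSeries.subst (fun r : Fin (d + 1 - j) =>
        (MvPowerSeries.X ⟨j + r, by omega⟩ : MvPowerSeries (Fin (d + 1)) Hsymb))
          (symSeries fun r => a (c (j + r)))) =
      MvPowerSeries.C l ^ (d + 1) * (evalHom p' hlX (MvPowerSeries.subst (fun r : Fin j =>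
        (MvPowerSeries.X ⟨r, by omega⟩ : MvPowerSeries (Fin (d + 1)) Hsymb))
          (invSeries j fun r => b (c r))) *
      evalHom p' hlX (MvPowerSeries.subst (fun r : Fin (d + 1 - j) =>
        (MvPowerSeries.X ⟨j + r, by omega⟩ : MvPowerSeries (Fin (d + 1)) Hsymb))
          (symSeries fun r => b (c (j + r))))) := by
    intro j
    have hp : (MvPowerSeries.C l ^ (d + 1) : MvPowerSeries (Fin (d + 1)) R) =
        MvPowerSeries.C l ^ (j : ℕ) * MvPowerSeries.C l ^ (d + 1 - j) := by
      rw [← pow_add]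
      congr 1
      omega
    rw [evalHom_subst _ _ (by simp), evalHom_subst _ _ (by simp), evalHom_subst _ _ (by simp),
      evalHom_subst _ _ (by simp)]
    simp only [evalHom_X]
    rw [hinv j _ j.2 (by simp), hsym _ _ _ (by omega) (by simp), hp]
    ring
  simp only [map_add, map_sum, map_mul, map_pow, map_neg, map_one, map_zero, hD, mul_zero, hS,
    mul_left_comm _ (MvPowerSeries.C l ^ (d + 1)), ← Finset.mul_sum] at hA hB
  refine (IsUnit.pow (d + 1) (isUnit_one.neg : IsUnit (-1 : MvPowerSeries (Fin (d + 1)) R))).mul_left_cancel ?_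
  linear_combination hA - hB

/-- The values on inverted symbols match, too. -/
theorem comp_INV : Matches τ l (p.comp INV) (p'.comp INV) a b := by
  have hl : ∀ (p : Hsymb →ₐ[ℚ] R) (x y : ℕ), p.comp INV (toBar (logSym x y)) = p (logSym x y) :=
    fun p x y => by
      rw [AlgHom.comp_apply, ← AlgHom.comp_apply INV, INV_comp_toBar]
      rfl
  refine ⟨fun x y => by rw [hl, hl, h.log], fun e c s hc hs => ?_⟩
  have hs' : ∀ r, (MvPowerSeries.C l * s r).constantCoeff = 0 := fun r => by simp [hs]
  rcases hc with hc | hc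
  · rw [evalSeries_reg p (a.strictMono.comp hc), evalSeries_reg p' (b.strictMono.comp hc),
      h.subst_symSeries hc hs]
  · have hc' : StrictMono (c ∘ Fin.rev) := hc.comp Fin.rev_strictAnti
    obtain ⟨c', hcc'⟩ : ∃ c' : ℕ → Fin (D + 1), ∀ r : Fin (e + 1), c' r = c r.rev :=
      ⟨fun r => c (Fin.rev ⟨min r e, by omega⟩), fun r => by
        have : min (r : ℕ) e = r := by omega
        simp [this]⟩
    have hmono : ∀ r s, r < s → s ≤ e → c' r < c' s := fun r s hrs hs => by
      rw [hcc' ⟨r, by omega⟩, hcc' ⟨s, by omega⟩]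
      exact hc' hrs
    rw [evalSeries_inv p (a := fun r => a (c' r)) (fun r t hrt => a.strictMono (hmono _ _ hrt (by omega)))
        (fun r => by rw [hcc', Fin.rev_rev]; rfl) hs,
      evalSeries_inv p' (a := fun r => b (c' r)) (fun r t hrt => b.strictMono (hmono _ _ hrt (by omega)))
        (fun r => by rw [hcc', Fin.rev_rev]; rfl) hs', h.subst_invSeries e hmono (by simp [hs])]
    simp only [mul_neg]

end SymMatches

theorem apply_reg_eq_coeff (g : Hbar →ₐ[ℚ] R) {d : ℕ} (i : Fin (d + 2) ↪o ℕ) (n : Fin (d + 1) → ℕ+) :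
    g (.X (.reg d i n)) = MvPowerSeries.coeff (shift n)
      (evalSeries g i (MvPowerSeries.X : Fin (d + 1) → MvPowerSeries (Fin (d + 1)) R)) := by
  rw [evalSeries, MvPowerSeries.subst_self, id, MvPowerSeries.coeff_map]
  have hb : MvPowerSeries.coeff (shift n) (barSeries (d := d + 1) i) =
      MvPolynomial.X (.reg d i n) := by
    change barSym _ _ = _
    rw [barSym, dif_pos i.strictMono]
    congr 2
    funext r
    refine PNat.eq ?_
    have := (n r).pos
    simp [shift]
    omega
  rw [hb]
  rfl

/-- The coproducts match if the values on symbols do. -/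
theorem productMap_comulH_eq {l : R} {p p' q q' : Hsymb →ₐ[ℚ] R} {d : ℕ} {a b : Fin (d + 2) ↪o ℕ}
    (hp : SymMatches l p p' a b) (hq : SymMatches l q q' a b) (n : Fin (d + 1) → ℕ+) :
    Algebra.TensorProduct.productMap p q (comulH (.X (.poly d a n))) =
      l ^ (∑ r, (n r : ℕ)) *
        Algebra.TensorProduct.productMap p' q' (comulH (.X (.poly d b n))) := by
  have h : ∀ (p q : Hsymb →ₐ[ℚ] R) (a : Fin (d + 2) ↪o ℕ),
      Algebra.TensorProduct.productMap p q (comulH (.X (.poly d a n))) =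
      MvPowerSeries.coeff (shift n) (evalSeries (prodPoint (p.comp INV) (q.comp INV)) a
        (MvPowerSeries.X : Fin (d + 1) → MvPowerSeries (Fin (d + 1)) R)) := fun p q a => by
    rw [← AlgHom.comp_apply, PathSeries.productMap_comp_comulH, AlgHom.comp_apply,
      PathSeries.toBar_poly, apply_reg_eq_coeff]
  rw [h, h]
  have key := Matches.prodPoint a.strictMono b.strictMono (hp.comp_INV (τ := Fin (d + 1)))
    hq.comp_INV (c := id) (s := MvPowerSeries.X) (.inl strictMono_id) (by simp)
  rw [Function.comp_id, Function.comp_id] at key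
  rw [key, evalSeries, evalSeries, coeff_subst_C_mul_X, MvPowerSeries.subst_self, id]
  congr 2
  have h₁ : ∑ _r : Fin (d + 1), 1 = d + 1 := by simp
  rw [← Nat.add_right_cancel_iff (n := 0), ← Finset.sum_congr rfl fun r _ => Nat.add_sub_cancel' (n r).pos,
    Finset.sum_add_distrib]
  exact congrArg (· + ∑ r, ((n r : ℕ) - 1) + 0) h₁.symm

end Matches

end SymbPolylog

end

noncomputable section
namespace SymbPolylog

theorem eq_of_productMap_eq {A : Type} [CommRing A] [Algebra ℚ A] {x y : A ⊗[ℚ] A}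
    (h : ∀ (R : Type) [CommRing R] [Algebra ℚ R] (p q : A →ₐ[ℚ] R),
      Algebra.TensorProduct.productMap p q x = Algebra.TensorProduct.productMap p q y) : x = y := by
  have h₁ : Algebra.TensorProduct.productMap (Algebra.TensorProduct.includeLeft : A →ₐ[ℚ] A ⊗[ℚ] A)
      Algebra.TensorProduct.includeRight = AlgHom.id ℚ _ := by
    ext <;> simp
  have := h (A ⊗[ℚ] A) Algebra.TensorProduct.includeLeft Algebra.TensorProduct.includeRight
  rwa [h₁] at this

theorem eq_of_productMap_productMap_eq {A : Type} [CommRing A] [Algebra ℚ A] {x y : A ⊗[ℚ] (A ⊗[ℚ] A)}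
    (h : ∀ (R : Type) [CommRing R] [Algebra ℚ R] (p q r : A →ₐ[ℚ] R),
      Algebra.TensorProduct.productMap p (Algebra.TensorProduct.productMap q r) x =
        Algebra.TensorProduct.productMap p (Algebra.TensorProduct.productMap q r) y) : x = y := by
  let j : A ⊗[ℚ] A →ₐ[ℚ] A ⊗[ℚ] (A ⊗[ℚ] A) := Algebra.TensorProduct.includeRight
  have h₁ : Algebra.TensorProduct.productMap
      (Algebra.TensorProduct.includeLeft : A →ₐ[ℚ] A ⊗[ℚ] (A ⊗[ℚ] A))
      (Algebra.TensorProduct.productMap (j.comp Algebra.TensorProduct.includeLeft)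
        (j.comp Algebra.TensorProduct.includeRight)) = AlgHom.id ℚ _ := by
    ext <;> simp [j]
  have := h (A ⊗[ℚ] (A ⊗[ℚ] A)) Algebra.TensorProduct.includeLeft
    (j.comp Algebra.TensorProduct.includeLeft) (j.comp Algebra.TensorProduct.includeRight)
  rwa [h₁] at this

theorem SymMatches.comp_left {A R : Type} [CommRing A] [Algebra ℚ A] [CommRing R] [Algebra ℚ R]
    {D : ℕ} {l : A} {p p' : Hsymb →ₐ[ℚ] A} {a b : Fin (D + 1) ↪o ℕ} (h : SymMatches l p p' a b)
    (f : A →ₐ[ℚ] R) : SymMatches (f l) (f.comp p) (f.comp p') a b :=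
  ⟨fun x y => by simp [h.log], fun e c n => by simp [h.poly]⟩

theorem productMap_map {A B R : Type} [CommRing A] [Algebra ℚ A] [CommRing B] [Algebra ℚ B] [CommRing R]
    [Algebra ℚ R] (p q : B →ₐ[ℚ] R) (f g : A →ₐ[ℚ] B) (x : A ⊗[ℚ] A) :
    Algebra.TensorProduct.productMap p q (Algebra.TensorProduct.map f g x) =
      Algebra.TensorProduct.productMap (p.comp f) (q.comp g) x := by
  rw [← AlgHom.comp_apply]
  congr 1
  ext <;> simp

theorem map_comulH_eq {l : ℚ} {f f' g g' : Hsymb →ₐ[ℚ] Hsymb} {d : ℕ} {a b : Fin (d + 2) ↪o ℕ}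
    (hf : SymMatches (algebraMap ℚ Hsymb l) f f' a b) (hg : SymMatches (algebraMap ℚ Hsymb l) g g' a b)
    (n : Fin (d + 1) → ℕ+) :
    Algebra.TensorProduct.map f g (comulH (.X (.poly d a n))) =
      l ^ (∑ r, (n r : ℕ)) • Algebra.TensorProduct.map f' g' (comulH (.X (.poly d b n))) := by
  refine eq_of_productMap_eq fun R _ _ p q => ?_
  have h₁ := hf.comp_left p
  have h₂ := hg.comp_left q
  rw [AlgHom.commutes] at h₁ h₂
  rw [map_smul, productMap_map, productMap_map, productMap_comulH_eq h₁ h₂, ← map_pow, Algebra.smul_def]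

theorem logSym_of_le {a b : ℕ} (h : a ≤ b) :
    logSym a b = ∑ r ∈ Finset.Ico a b, MvPolynomial.X (.log r) := by
  rw [logSym, Finset.Ico_eq_empty_of_le h, Finset.sum_empty, sub_zero]

theorem logSym_swap (a b : ℕ) : logSym a b = -logSym b a := by simp [logSym]

theorem logSym_succ (a : ℕ) : logSym a (a + 1) = MvPolynomial.X (.log a) := by
  simp [logSym_of_le]

theorem logSym_add_logSym {a b c : ℕ} (h : a ≤ b) (h' : b ≤ c) :
    logSym a b + logSym b c = logSym a c := by
  rw [logSym_of_le h, logSym_of_le h', logSym_of_le (h.trans h'), Finset.sum_Ico_consecutive _ h h']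

/-! ### The subalgebras of the first variables -/

theorem Hsymb.X_mem_first {N : ℕ} {g : Gen} (h : g.InFirst N) : MvPolynomial.X g ∈ first N :=
  Algebra.subset_adjoin ⟨g, h, rfl⟩

theorem Hsymb.logSym_mem_first {N a b : ℕ} (ha : a ≤ N) (hb : b ≤ N) : logSym a b ∈ first N :=
  sub_mem (sum_mem fun _ hr => X_mem_first ((Finset.mem_Ico.1 hr).2.trans_le hb))
    (sum_mem fun _ hr => X_mem_first ((Finset.mem_Ico.1 hr).2.trans_le ha))

open Classical in
/-- The retraction of `H^symb` to the subalgebra of the first `N` variables. -/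
def Hsymb.toFirst (N : ℕ) : Hsymb →ₐ[ℚ] first N :=
  MvPolynomial.aeval fun g => if h : g.InFirst N then ⟨.X g, X_mem_first h⟩ else 0

theorem Hsymb.eqOn_first {A : Type v} [CommRing A] [Algebra ℚ A] {N : ℕ} {f g : Hsymb →ₐ[ℚ] A}
    (h : ∀ x : Gen, x.InFirst N → f (.X x) = g (.X x)) : ∀ x ∈ first N, f x = g x := by
  have : first N ≤ AlgHom.equalizer f g := Algebra.adjoin_le (by
    rintro _ ⟨x, hx, rfl⟩
    exact h x hx)
  exact fun x hx => this hx

theorem Hsymb.coe_toFirst {N : ℕ} : ∀ x ∈ first N, (toFirst N x : Hsymb) = x :=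
  eqOn_first (f := (first N).val.comp (toFirst N)) (g := AlgHom.id ℚ _) fun x hx => by
    simp [toFirst, hx]

theorem Gen.inFirst_trans_valOrderEmb {D e : ℕ} (c : Fin (e + 2) ↪o Fin (D + 2)) (n : Fin (e + 1) → ℕ+) :
    (Gen.poly e (c.trans (Fin.valOrderEmb (D + 2))) n).InFirst (D + 1) := fun r => (c r).2

theorem comulH_stdSym_mem {d : ℕ} (n : Fin (d + 1) → ℕ+) :
    comulH (stdSym n) ∈ (Algebra.TensorProduct.map
      (Hsymb.first (d + 1)).val (Hsymb.first (d + 1)).val).range := by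
  have h : SymMatches (algebraMap ℚ Hsymb 1) ((Hsymb.first (d + 1)).val.comp (Hsymb.toFirst (d + 1)))
      (AlgHom.id ℚ _) (Fin.valOrderEmb (d + 2)) (Fin.valOrderEmb (d + 2)) := by
    refine ⟨fun x y => ?_, fun e c n => ?_⟩
    · rw [map_one, one_mul]
      exact Hsymb.coe_toFirst _ (Hsymb.logSym_mem_first (by simp; omega) (by simp; omega))
    · rw [map_one, one_pow, one_mul]
      exact Hsymb.coe_toFirst _ (Hsymb.X_mem_first (Gen.inFirst_trans_valOrderEmb c n))
  have := map_comulH_eq h h n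
  rw [one_pow, one_smul, Algebra.TensorProduct.map_id, Algebra.TensorProduct.map_comp] at this
  exact ⟨_, this⟩

/-! ### Substitution of consecutive products for the variables -/

open Classical in
/-- The homomorphism `H^symb → H^symb` that replaces `x r` by `x_{i r → i (r+1)}`. It matters only on
the symbols in the first `d + 1` variables, and is `0` on the other ones. -/
def relabel {d : ℕ} (i : Fin (d + 2) ↪o ℕ) : Hsymb →ₐ[ℚ] Hsymb :=
  MvPolynomial.aeval fun g => match g with
    | .log r => if h : r < d + 1 then logSym (i ⟨r, by omega⟩) (i ⟨r + 1, by omega⟩) else 0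
    | .poly e c n =>
      if h : ∀ r, c r < d + 2 then
        .X (.poly e ((OrderEmbedding.ofStrictMono (fun r => (⟨c r, h r⟩ : Fin (d + 2)))
          fun _ _ hrs => c.strictMono hrs).trans i) n)
      else 0

theorem relabel_logSym {d : ℕ} (i : Fin (d + 2) ↪o ℕ) {x y : Fin (d + 2)} (h : x ≤ y) :
    relabel i (logSym x y) = logSym (i x) (i y) := by
  induction y using Fin.induction with
  | zero =>
    obtain rfl : x = 0 := le_antisymm h (Fin.zero_le x)
    simp [logSym]
  | succ y ih =>
    rcases h.eq_or_lt with rfl | h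
    · simp [logSym]
    · have h' : x ≤ y.castSucc := Fin.le_castSucc_iff.2 h
      have hy : y.castSucc ≤ y.succ := y.castSucc_le_succ
      rw [← logSym_add_logSym (show (x : ℕ) ≤ y.castSucc from h') (show (y.castSucc : ℕ) ≤ y.succ from hy),
        map_add, ih h', ← logSym_add_logSym (i.monotone h') (i.monotone hy)]
      congr 1
      rw [Fin.val_succ, Fin.val_castSucc, logSym_succ, relabel, MvPolynomial.aeval_X]
      simp only [y.2, dif_pos]
      rfl

theorem map_relabel_comulH {d : ℕ} (i : Fin (d + 2) ↪o ℕ) (n : Fin (d + 1) → ℕ+) :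
    Algebra.TensorProduct.map (relabel i) (relabel i) (comulH (stdSym n)) = comulH (.X (.poly d i n)) := by
  have h : SymMatches (algebraMap ℚ Hsymb 1) (relabel i) (AlgHom.id ℚ _) (Fin.valOrderEmb (d + 2)) i := by
    refine ⟨fun x y => ?_, fun e c n => ?_⟩
    · rw [map_one, one_mul, AlgHom.id_apply]
      rcases le_total x y with hxy | hxy
      · exact relabel_logSym i hxy
      · rw [logSym_swap, map_neg, logSym_swap (i x)]
        exact congrArg _ (relabel_logSym i hxy)
    · rw [map_one, one_pow, one_mul, AlgHom.id_apply, relabel, MvPolynomial.aeval_X]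
      exact dif_pos fun r => (c r).2
  have := map_comulH_eq h h n
  rwa [one_pow, one_smul, Algebra.TensorProduct.map_id] at this

/-! ### The weight -/

/-- The weight of a symbol; `[x r]_0` has weight `1`. -/
def Gen.weight : Gen → ℕ
  | .log _ => 1
  | .poly _ _ n => ∑ r, (n r : ℕ)

/-- The endomorphism of `H^symb` that multiplies the symbols of weight `n` by `2 ^ n`. -/
def doubling : Hsymb →ₐ[ℚ] Hsymb :=
  MvPolynomial.aeval fun g => (2 : ℚ) ^ g.weight • MvPolynomial.X g

theorem doubling_log (r : ℕ) : doubling (.X (.log r)) = (2 : ℚ) • .X (.log r) := by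
  simp [doubling, Gen.weight]

theorem doubling_poly (d : ℕ) (i : Fin (d + 2) ↪o ℕ) (n : Fin (d + 1) → ℕ+) :
    doubling (.X (.poly d i n)) = (2 : ℚ) ^ (∑ r, (n r : ℕ)) • .X (.poly d i n) := by
  simp [doubling, Gen.weight]

theorem map_doubling_comulH {d : ℕ} (i : Fin (d + 2) ↪o ℕ) (n : Fin (d + 1) → ℕ+) :
    Algebra.TensorProduct.map doubling doubling (comulH (.X (.poly d i n))) =
      (2 : ℚ) ^ (∑ r, (n r : ℕ)) • comulH (.X (.poly d i n)) := by
  have h : SymMatches (algebraMap ℚ Hsymb 2) doubling (AlgHom.id ℚ _) i i := by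
    refine ⟨fun x y => ?_, fun e c n => ?_⟩
    · rw [← Algebra.smul_def]
      simp only [logSym, map_sub, map_sum, doubling_log, AlgHom.id_apply, smul_sub, Finset.smul_sum]
    · rw [← map_pow, ← Algebra.smul_def, doubling_poly, AlgHom.id_apply]
  have := map_comulH_eq h h n
  rwa [Algebra.TensorProduct.map_id] at this

/-! ### Coassociativity and counit -/

theorem comulH_coassoc :
    (Algebra.TensorProduct.assoc ℚ ℚ ℚ Hsymb Hsymb Hsymb).toAlgHom.comp
        ((Algebra.TensorProduct.map comulH (.id ℚ Hsymb)).comp comulH) =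
      (Algebra.TensorProduct.map (.id ℚ Hsymb) comulH).comp comulH := by
  refine AlgHom.ext fun x => eq_of_productMap_productMap_eq fun R _ _ p q r => ?_
  have h := DFunLike.congr_fun (PathSeries.productMap_comul_assoc p q r) x
  have h₂ : (Algebra.TensorProduct.productMap p (Algebra.TensorProduct.productMap q r)).comp
      (Algebra.TensorProduct.map (.id ℚ Hsymb) comulH) =
      Algebra.TensorProduct.productMap p ((Algebra.TensorProduct.productMap q r).comp comulH) := by
    apply Algebra.TensorProduct.ext'
    simp
  have h₃ : ((Algebra.TensorProduct.productMap p (Algebra.TensorProduct.productMap q r)).comp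
      (Algebra.TensorProduct.assoc ℚ ℚ ℚ Hsymb Hsymb Hsymb).toAlgHom).comp
      (Algebra.TensorProduct.map comulH (.id ℚ Hsymb)) =
      Algebra.TensorProduct.productMap ((Algebra.TensorProduct.productMap p q).comp comulH) r := by
    have h₄ : (Algebra.TensorProduct.productMap p (Algebra.TensorProduct.productMap q r)).comp
        (Algebra.TensorProduct.assoc ℚ ℚ ℚ Hsymb Hsymb Hsymb).toAlgHom =
        Algebra.TensorProduct.productMap (Algebra.TensorProduct.productMap p q) r := by
      ext <;> simp [Algebra.TensorProduct.one_def]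
    rw [h₄]
    apply Algebra.TensorProduct.ext'
    simp
  rw [← h₂, ← h₃] at h
  exact h.symm

theorem trivialPoint_comulH_left :
    (Algebra.TensorProduct.map (PathSeries.trivialPoint ℚ) (.id ℚ Hsymb)).comp comulH =
      (Algebra.TensorProduct.lid ℚ Hsymb).symm := by
  have h := PathSeries.productMap_trivialPoint_left (AlgHom.id ℚ Hsymb)
  have h' : (Algebra.TensorProduct.lid ℚ Hsymb).toAlgHom.comp
      (Algebra.TensorProduct.map (PathSeries.trivialPoint ℚ) (.id ℚ Hsymb)) =
      Algebra.TensorProduct.productMap (PathSeries.trivialPoint Hsymb) (AlgHom.id ℚ Hsymb) := by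
    ext <;> simp [PathSeries.trivialPoint]
  rw [← h'] at h
  refine AlgHom.ext fun x => (Algebra.TensorProduct.lid ℚ Hsymb).injective ?_
  simpa using DFunLike.congr_fun h x

theorem trivialPoint_comulH_right :
    (Algebra.TensorProduct.map (.id ℚ Hsymb) (PathSeries.trivialPoint ℚ)).comp comulH =
      (Algebra.TensorProduct.rid ℚ ℚ Hsymb).symm := by
  have h := PathSeries.productMap_trivialPoint_right (AlgHom.id ℚ Hsymb)
  have h' : (Algebra.TensorProduct.rid ℚ ℚ Hsymb).toAlgHom.comp
      (Algebra.TensorProduct.map (.id ℚ Hsymb) (PathSeries.trivialPoint ℚ)) =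
      Algebra.TensorProduct.productMap (AlgHom.id ℚ Hsymb) (PathSeries.trivialPoint Hsymb) := by
    ext <;> simp [PathSeries.trivialPoint]
  rw [← h'] at h
  refine AlgHom.ext fun x => (Algebra.TensorProduct.rid ℚ ℚ Hsymb).injective ?_
  simpa using DFunLike.congr_fun h x

end SymbPolylog
end

noncomputable section
namespace SymbPolylog

theorem map_eq_map_of_mem_range {A B C : Type*} [CommRing A] [Algebra ℚ A] [Semiring B] [Algebra ℚ B]
    [Semiring C] [Algebra ℚ C] {K : Subalgebra ℚ A}
    {f f' : A →ₐ[ℚ] B} {g g' : A →ₐ[ℚ] C} (hf : ∀ x ∈ K, f x = f' x) (hg : ∀ x ∈ K, g x = g' x)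
    {z : A ⊗[ℚ] A} (hz : z ∈ (Algebra.TensorProduct.map K.val K.val).range) :
    Algebra.TensorProduct.map f g z = Algebra.TensorProduct.map f' g' z := by
  obtain ⟨y, rfl⟩ := hz
  have hf' : f.comp K.val = f'.comp K.val := AlgHom.ext fun x => hf x x.2
  have hg' : g.comp K.val = g'.comp K.val := AlgHom.ext fun x => hg x x.2
  change ((Algebra.TensorProduct.map f g).comp (Algebra.TensorProduct.map K.val K.val)) y =
    ((Algebra.TensorProduct.map f' g').comp (Algebra.TensorProduct.map K.val K.val)) y
  rw [← Algebra.TensorProduct.map_comp, ← Algebra.TensorProduct.map_comp, hf', hg']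

theorem map_map_apply {A B C A' B' C' : Type*} [Semiring A] [Algebra ℚ A] [Semiring B] [Algebra ℚ B]
    [Semiring C] [Algebra ℚ C] [Semiring A'] [Algebra ℚ A'] [Semiring B'] [Algebra ℚ B']
    [Semiring C'] [Algebra ℚ C'] (f : A →ₐ[ℚ] B) (g : B →ₐ[ℚ] C) (f' : A' →ₐ[ℚ] B') (g' : B' →ₐ[ℚ] C')
    (z : A ⊗[ℚ] A') :
    Algebra.TensorProduct.map g g' (Algebra.TensorProduct.map f f' z) =
      Algebra.TensorProduct.map (g.comp f) (g'.comp f') z := by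
  rw [Algebra.TensorProduct.map_comp]
  rfl

theorem assoc_map_map {A B : Type*} [CommRing A] [Algebra ℚ A] [CommRing B] [Algebra ℚ B] (f : A →ₐ[ℚ] B)
    (z : A ⊗[ℚ] A ⊗[ℚ] A) :
    Algebra.TensorProduct.assoc ℚ ℚ ℚ B B B
      (Algebra.TensorProduct.map (Algebra.TensorProduct.map f f) f z) =
    Algebra.TensorProduct.map f (Algebra.TensorProduct.map f f)
      (Algebra.TensorProduct.assoc ℚ ℚ ℚ A A A z) := by
  have h : (Algebra.TensorProduct.assoc ℚ ℚ ℚ B B B).toAlgHom.comp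
      (Algebra.TensorProduct.map (Algebra.TensorProduct.map f f) f) =
      (Algebra.TensorProduct.map f (Algebra.TensorProduct.map f f)).comp
      (Algebra.TensorProduct.assoc ℚ ℚ ℚ A A A).toAlgHom := by
    ext <;> simp [Algebra.TensorProduct.one_def]
  exact DFunLike.congr_fun h z

namespace ContractionSystem

variable {X : ContractionSystem.{u}}

theorem algHom_ext_semiring {A : Type v} [Semiring A] [Algebra ℚ A] {f g : X.Alg →ₐ[ℚ] A}
    (hL : ∀ α, f (logSym α) = g (logSym α))
    (hP : ∀ (d : ℕ) (α : X.obj d) (n : Fin (d + 1) → ℕ+), f (sym α n) = g (sym α n)) : f = g := by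
  apply Ideal.Quotient.algHom_ext
  apply MvPolynomial.algHom_ext
  rintro (α | ⟨d, α, n⟩)
  · exact hL α
  · exact hP d α n

theorem ev_logSym {N : ℕ} (α : X.obj N) {a b : Fin (N + 2)} (h : a < b) :
    ev α (SymbPolylog.logSym a b) = logSym (X.contract (pair h) α) := by
  induction b using Fin.induction with
  | zero => exact absurd h (Fin.not_lt_zero a)
  | succ b ih =>
    have hX : ev α (MvPolynomial.X (.log b)) = logSym (X.contract (pair b.castSucc_lt_succ) α) := by
      rw [ev, MvPolynomial.aeval_X]
      exact dif_pos b.2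
    rcases (Fin.le_castSucc_iff.2 h).eq_or_lt with rfl | h'
    · rw [Fin.val_succ, Fin.val_castSucc, logSym_succ, hX]
    · rw [← logSym_add_logSym (show (a : ℕ) ≤ b.castSucc from h'.le)
        (show (b.castSucc : ℕ) ≤ b.succ from b.castSucc_le_succ), map_add, ih h',
        ← logSym_rel α h' b.castSucc_lt_succ, Fin.val_succ, Fin.val_castSucc, logSym_succ, hX]

theorem ev_poly {N e : ℕ} (α : X.obj N) (c : Fin (e + 2) ↪o Fin (N + 2)) (n : Fin (e + 1) → ℕ+) :
    ev α (.X (.poly e (c.trans (Fin.valOrderEmb (N + 2))) n)) = sym (X.contract c α) n := by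
  rw [ev, MvPolynomial.aeval_X]
  exact dif_pos fun r => (c r).2

theorem ev_stdSym {N : ℕ} (α : X.obj N) (n : Fin (N + 1) → ℕ+) : ev α (stdSym n) = sym α n := by
  refine (ev_poly α (RelEmbedding.refl _) n).trans ?_
  rw [X.contract_refl]

theorem exists_of_inFirst {N e : ℕ} {i : Fin (e + 2) ↪o ℕ} {n : Fin (e + 1) → ℕ+}
    (h : (SymbPolylog.Gen.poly e i n).InFirst (N + 1)) :
    ∃ c : Fin (e + 2) ↪o Fin (N + 2), i = c.trans (Fin.valOrderEmb (N + 2)) :=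
  ⟨OrderEmbedding.ofStrictMono (fun r => ⟨i r, h r⟩) fun _ _ hrs => i.strictMono hrs, rfl⟩

theorem ev_relabel {N d : ℕ} (α : X.obj N) (i : Fin (d + 2) ↪o Fin (N + 2)) :
    ∀ y ∈ Hsymb.first (d + 1),
      ((ev α).comp (relabel (i.trans (Fin.valOrderEmb (N + 2))))) y = ev (X.contract i α) y := by
  refine Hsymb.eqOn_first fun x hx => ?_
  rcases x with r | ⟨e, c, n⟩
  · have hr : (⟨r, Nat.lt_succ_of_lt hx⟩ : Fin (d + 2)) < ⟨r + 1, Nat.succ_lt_succ hx⟩ := by simp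
    rw [← logSym_succ, AlgHom.comp_apply]
    have h := relabel_logSym (i.trans (Fin.valOrderEmb (N + 2))) hr.le
    have h' := ev_logSym (X.contract i α) hr
    have h'' := ev_logSym α (i.strictMono hr)
    simp only at h h'
    rw [h, h', X.contract_contract]
    refine Eq.trans h'' (congrArg (fun j => logSym (X.contract j α)) ?_)
    ext s
    fin_cases s <;> rfl
  · obtain ⟨c, rfl⟩ := exists_of_inFirst hx
    rw [ev_poly, X.contract_contract, ← ev_poly, AlgHom.comp_apply]
    congr 1
    rw [relabel, MvPolynomial.aeval_X]
    exact dif_pos fun r => (c r).2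

theorem comul_logSym (α : X.obj 0) : X.comul (logSym α) = logSym α ⊗ₜ 1 + 1 ⊗ₜ logSym α := by
  change MvPolynomial.aeval _ (MvPolynomial.X _) = _
  simp

theorem comul_sym {d : ℕ} (α : X.obj d) (n : Fin (d + 1) → ℕ+) :
    X.comul (sym α n) = Algebra.TensorProduct.map (ev α) (ev α) (comulH (stdSym n)) := by
  change MvPolynomial.aeval _ (MvPolynomial.X _) = _
  simp

theorem counit_logSym (α : X.obj 0) : X.counit (logSym α) = 0 := by
  change MvPolynomial.aeval _ (MvPolynomial.X _) = _
  simp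

theorem counit_sym {d : ℕ} (α : X.obj d) (n : Fin (d + 1) → ℕ+) : X.counit (sym α n) = 0 := by
  change MvPolynomial.aeval _ (MvPolynomial.X _) = _
  simp

/-- The coproduct is compatible with evaluation. -/
theorem comul_ev {N : ℕ} (α : X.obj N) :
    ∀ y ∈ Hsymb.first (N + 1), (X.comul.comp (ev α)) y =
      ((Algebra.TensorProduct.map (ev α) (ev α)).comp comulH) y := by
  refine Hsymb.eqOn_first (A := X.Alg ⊗[ℚ] X.Alg) fun x hx => ?_
  rcases x with r | ⟨e, c, n⟩
  · have hr : (⟨r, Nat.lt_succ_of_lt hx⟩ : Fin (N + 2)) < ⟨r + 1, Nat.succ_lt_succ hx⟩ := by simp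
    have h := ev_logSym α hr
    simp only [logSym_succ] at h
    rw [AlgHom.comp_apply, AlgHom.comp_apply, PathSeries.comulH_log, h, comul_logSym, map_add,
      Algebra.TensorProduct.map_tmul, Algebra.TensorProduct.map_tmul, map_one, h]
  · obtain ⟨c, rfl⟩ := exists_of_inFirst hx
    rw [AlgHom.comp_apply, AlgHom.comp_apply, ev_poly, comul_sym, ← map_relabel_comulH, map_map_apply]
    exact (map_eq_map_of_mem_range (ev_relabel α c) (ev_relabel α c) (comulH_stdSym_mem n)).symm

theorem counit_ev {N : ℕ} (α : X.obj N) :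
    ∀ y ∈ Hsymb.first (N + 1), (X.counit.comp (ev α)) y = PathSeries.trivialPoint ℚ y := by
  refine Hsymb.eqOn_first fun x hx => ?_
  rcases x with r | ⟨e, c, n⟩
  · have hr : (⟨r, Nat.lt_succ_of_lt hx⟩ : Fin (N + 2)) < ⟨r + 1, Nat.succ_lt_succ hx⟩ := by simp
    have h := ev_logSym α hr
    simp only [logSym_succ] at h
    rw [AlgHom.comp_apply, h, counit_logSym]
    simp [PathSeries.trivialPoint]
  · obtain ⟨c, rfl⟩ := exists_of_inFirst hx
    rw [AlgHom.comp_apply, ev_poly, counit_sym]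
    simp [PathSeries.trivialPoint]

theorem map_ev {Y : ContractionSystem.{u}} (f : X.Hom Y) {N : ℕ} (α : X.obj N) :
    f.map.comp (ev α) = ev (f.app N α) := by
  refine MvPolynomial.algHom_ext fun x => ?_
  rcases x with r | ⟨e, c, n⟩
  · simp only [ev, AlgHom.comp_apply, MvPolynomial.aeval_X]
    split_ifs <;> simp [f.app_contract]
  · simp only [ev, AlgHom.comp_apply, MvPolynomial.aeval_X]
    split_ifs <;> simp [f.app_contract]

theorem comul_comp_map {Y : ContractionSystem.{u}} (f : X.Hom Y) :
    Y.comul.comp f.map = (Algebra.TensorProduct.map f.map f.map).comp X.comul := by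
  refine algHom_ext (A := Y.Alg ⊗[ℚ] Y.Alg) _ (fun α => ?_) fun d α n => ?_
  · rw [AlgHom.comp_apply, AlgHom.comp_apply, Hom.map_logSym, comul_logSym, comul_logSym, map_add,
      Algebra.TensorProduct.map_tmul, Algebra.TensorProduct.map_tmul, map_one, Hom.map_logSym]
  · rw [AlgHom.comp_apply, AlgHom.comp_apply, Hom.map_sym, comul_sym, comul_sym, map_map_apply, map_ev]

theorem counit_comp_map {Y : ContractionSystem.{u}} (f : X.Hom Y) : Y.counit.comp f.map = X.counit := by
  refine algHom_ext _ (fun α => ?_) fun d α n => ?_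
  · rw [AlgHom.comp_apply, Hom.map_logSym, counit_logSym, counit_logSym]
  · rw [AlgHom.comp_apply, Hom.map_sym, counit_sym, counit_sym]

/-! ### The axioms of a bialgebra -/

variable (X)

theorem comul_coassoc :
    (Algebra.TensorProduct.assoc ℚ ℚ ℚ X.Alg X.Alg X.Alg).toAlgHom.comp
        ((Algebra.TensorProduct.map X.comul (.id ℚ X.Alg)).comp X.comul) =
      (Algebra.TensorProduct.map (.id ℚ X.Alg) X.comul).comp X.comul := by
  refine algHom_ext_semiring (fun α => ?_) fun d α n => ?_
  · have h : X.comul 1 = 1 ⊗ₜ 1 := X.comul.toRingHom.map_one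
    simp [comul_logSym, TensorProduct.add_tmul, TensorProduct.tmul_add, h, add_assoc]
  · have hid : ∀ y ∈ Hsymb.first (d + 1), ((AlgHom.id ℚ X.Alg).comp (ev α)) y =
        ((ev α).comp (AlgHom.id ℚ Hsymb)) y := fun _ _ => rfl
    simp only [AlgHom.comp_apply, comul_sym, map_map_apply]
    rw [map_eq_map_of_mem_range (comul_ev α) hid (comulH_stdSym_mem n),
      map_eq_map_of_mem_range hid (comul_ev α) (comulH_stdSym_mem n), ← map_map_apply, ← map_map_apply]
    refine (assoc_map_map _ _).trans ?_
    exact congrArg _ (DFunLike.congr_fun comulH_coassoc (stdSym n))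

theorem counit_comul_left :
    (Algebra.TensorProduct.map X.counit (.id ℚ X.Alg)).comp X.comul =
      (Algebra.TensorProduct.lid ℚ X.Alg).symm := by
  refine algHom_ext (A := ℚ ⊗[ℚ] X.Alg) _ (fun α => ?_) fun d α n => ?_
  · simp [comul_logSym, counit_logSym]
  · have hid : ∀ y ∈ Hsymb.first (d + 1), ((AlgHom.id ℚ X.Alg).comp (ev α)) y =
        ((ev α).comp (AlgHom.id ℚ Hsymb)) y := fun _ _ => rfl
    simp only [AlgHom.comp_apply, comul_sym, map_map_apply]
    rw [map_eq_map_of_mem_range (counit_ev α) hid (comulH_stdSym_mem n),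
      ← AlgHom.id_comp (PathSeries.trivialPoint ℚ), ← map_map_apply]
    have h := DFunLike.congr_fun trivialPoint_comulH_left (stdSym n)
    rw [AlgHom.comp_apply] at h
    rw [h]
    simp [ev_stdSym]

theorem counit_comul_right :
    (Algebra.TensorProduct.map (.id ℚ X.Alg) X.counit).comp X.comul =
      (Algebra.TensorProduct.rid ℚ ℚ X.Alg).symm := by
  refine algHom_ext (A := X.Alg ⊗[ℚ] ℚ) _ (fun α => ?_) fun d α n => ?_
  · simp [comul_logSym, counit_logSym]
  · have hid : ∀ y ∈ Hsymb.first (d + 1), ((AlgHom.id ℚ X.Alg).comp (ev α)) y =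
        ((ev α).comp (AlgHom.id ℚ Hsymb)) y := fun _ _ => rfl
    simp only [AlgHom.comp_apply, comul_sym, map_map_apply]
    rw [map_eq_map_of_mem_range hid (counit_ev α) (comulH_stdSym_mem n),
      ← AlgHom.id_comp (PathSeries.trivialPoint ℚ), ← map_map_apply]
    have h := DFunLike.congr_fun trivialPoint_comulH_right (stdSym n)
    rw [AlgHom.comp_apply] at h
    rw [h]
    simp [ev_stdSym]

end ContractionSystem
end SymbPolylog
end

noncomputable section
namespace SymbPolylog

/-! ### Gradings by eigenspaces -/

section Eigen

variable {V : Type u} [AddCommGroup V] [Module ℚ V] {T : V →ₗ[ℚ] V} {B : ℕ → Submodule ℚ V}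

theorem iSupIndep_eigenspace_two_pow (T : V →ₗ[ℚ] V) :
    iSupIndep fun n : ℕ => Module.End.eigenspace T ((2 : ℚ) ^ n) :=
  (Module.End.eigenspaces_iSupIndep T).comp (pow_right_injective₀ (by norm_num) (by norm_num))

theorem le_eigenspace_two_pow (hT : ∀ n, ∀ x ∈ B n, T x = (2 : ℚ) ^ n • x) (n : ℕ) :
    B n ≤ Module.End.eigenspace T ((2 : ℚ) ^ n) := fun x hx =>
  Module.End.mem_eigenspace_iff.2 (hT n x hx)

theorem isInternal_of_two_pow (hT : ∀ n, ∀ x ∈ B n, T x = (2 : ℚ) ^ n • x) (hB : ⨆ n, B n = ⊤) :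
    DirectSum.IsInternal B :=
  DirectSum.isInternal_submodule_of_iSupIndep_of_iSup_eq_top
    ((iSupIndep_eigenspace_two_pow T).mono (le_eigenspace_two_pow hT)) hB

theorem mem_of_two_pow (hT : ∀ n, ∀ x ∈ B n, T x = (2 : ℚ) ^ n • x) (hB : ⨆ n, B n = ⊤) {n : ℕ} {x : V}
    (hx : T x = (2 : ℚ) ^ n • x) : x ∈ B n := by
  have hx' : x ∈ B n ⊔ ⨆ (m) (_ : m ≠ n), B m := by
    rw [← iSup_split_single, hB]
    exact Submodule.mem_top
  obtain ⟨b, hb, c, hc, rfl⟩ := Submodule.mem_sup.1 hx'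
  have hc₀ : c = 0 := by
    refine Submodule.disjoint_def.1 (iSupIndep_eigenspace_two_pow T n) c ?_
      (iSup₂_mono (fun m _ => le_eigenspace_two_pow hT m) hc)
    rw [Module.End.mem_eigenspace_iff]
    rwa [map_add, smul_add, hT n b hb, add_right_inj] at hx
  rwa [hc₀, add_zero]

end Eigen

/-- The part of degree `n` of `A ⊗ A`, for a grading of `A`. -/
def tensorPart {A : Type u} [CommRing A] [Algebra ℚ A] (𝒜 : ℕ → Submodule ℚ A) (n : ℕ) :
    Submodule ℚ (A ⊗[ℚ] A) :=
  ⨆ p ∈ Finset.HasAntidiagonal.antidiagonal n,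
    LinearMap.range (TensorProduct.map (𝒜 p.1).subtype (𝒜 p.2).subtype)

section TensorPart

variable {A : Type u} [CommRing A] [Algebra ℚ A] {𝒜 : ℕ → Submodule ℚ A}

theorem tmul_mem_tensorPart {p q n : ℕ} (h : p + q = n) {a b : A} (ha : a ∈ 𝒜 p) (hb : b ∈ 𝒜 q) :
    a ⊗ₜ b ∈ tensorPart 𝒜 n :=
  Submodule.mem_iSup_of_mem (p, q) (Submodule.mem_iSup_of_mem (by simpa using h)
    ⟨⟨a, ha⟩ ⊗ₜ ⟨b, hb⟩, rfl⟩)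

theorem tensorPart_le {n : ℕ} {N : Submodule ℚ (A ⊗[ℚ] A)}
    (h : ∀ p q, p + q = n → ∀ a ∈ 𝒜 p, ∀ b ∈ 𝒜 q, a ⊗ₜ b ∈ N) : tensorPart 𝒜 n ≤ N := by
  refine iSup₂_le fun p hp => ?_
  rintro _ ⟨z, rfl⟩
  induction z with
  | zero => rw [map_zero]; exact zero_mem _
  | add z w hz hw => rw [map_add]; exact add_mem hz hw
  | tmul a b => exact h p.1 p.2 (by simpa using hp) a a.2 b b.2

theorem iSup_tensorPart (h : ⨆ n, 𝒜 n = ⊤) : ⨆ n, tensorPart 𝒜 n = ⊤ := by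
  refine eq_top_iff.2 fun z _ => ?_
  induction z with
  | zero => exact zero_mem _
  | add z w hz hw => exact add_mem (hz trivial) (hw trivial)
  | tmul a b =>
    refine Submodule.iSup_induction 𝒜 (motive := fun a => a ⊗ₜ b ∈ ⨆ n, tensorPart 𝒜 n)
      (h ▸ Submodule.mem_top : a ∈ ⨆ n, 𝒜 n) (fun p a ha => ?_) (by simp) fun a a' h h' => by
        rw [TensorProduct.add_tmul]
        exact add_mem h h'
    refine Submodule.iSup_induction 𝒜 (motive := fun b => a ⊗ₜ b ∈ ⨆ n, tensorPart 𝒜 n)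
      (h ▸ Submodule.mem_top : b ∈ ⨆ n, 𝒜 n) (fun q b hb => ?_) (by simp) fun b b' h h' => by
        rw [TensorProduct.tmul_add]
        exact add_mem h h'
    exact Submodule.mem_iSup_of_mem (p + q) (tmul_mem_tensorPart rfl ha hb)

theorem mem_tensorPart_of_two_pow {T : A →ₐ[ℚ] A} (hT : ∀ n, ∀ x ∈ 𝒜 n, T x = (2 : ℚ) ^ n • x)
    (h : ⨆ n, 𝒜 n = ⊤) {Δ : A →ₐ[ℚ] A ⊗[ℚ] A}
    (hΔ : Δ.comp T = (Algebra.TensorProduct.map T T).comp Δ) {n : ℕ} {a : A} (ha : a ∈ 𝒜 n) :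
    Δ a ∈ tensorPart 𝒜 n := by
  refine mem_of_two_pow (T := (Algebra.TensorProduct.map T T).toLinearMap) (fun m z hz => ?_)
    (iSup_tensorPart h) ?_
  · let N : Submodule ℚ (A ⊗[ℚ] A) := LinearMap.eqLocus (Algebra.TensorProduct.map T T).toLinearMap
      ((2 : ℚ) ^ m • LinearMap.id)
    refine (tensorPart_le (N := N) fun p q hpq a ha b hb => ?_) hz
    change Algebra.TensorProduct.map T T (a ⊗ₜ b) = (2 : ℚ) ^ m • a ⊗ₜ b
    rw [Algebra.TensorProduct.map_tmul, hT p a ha, hT q b hb, TensorProduct.smul_tmul_smul, ← pow_add,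
      hpq]
  · have := DFunLike.congr_fun hΔ a
    rw [AlgHom.comp_apply, hT n a ha, map_smul] at this
    exact this.symm

end TensorPart

/-! ### The antipode of a connected graded bialgebra -/

section Antipode

open WithConv

variable {A : Type u} [CommRing A] [Bialgebra ℚ A] {𝒜 : ℕ → Submodule ℚ A}

theorem conv_mem (hΔ : ∀ n, ∀ a ∈ 𝒜 n, Coalgebra.comul a ∈ tensorPart 𝒜 n)
    {f g : WithConv (A →ₗ[ℚ] A)} {n : ℕ} {N : Submodule ℚ A}
    (h : ∀ p q, p + q = n → ∀ a ∈ 𝒜 p, ∀ b ∈ 𝒜 q, f a * g b ∈ N) {x : A} (hx : x ∈ 𝒜 n) :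
    (f * g) x ∈ N := by
  rw [LinearMap.convMul_apply]
  refine (tensorPart_le (N := N.comap (LinearMap.mul' ℚ A ∘ₗ TensorProduct.map f.ofConv g.ofConv))
    fun p q hpq a ha b hb => ?_) (hΔ n x hx)
  simpa using h p q hpq a ha b hb

theorem conv_congr (hΔ : ∀ n, ∀ a ∈ 𝒜 n, Coalgebra.comul a ∈ tensorPart 𝒜 n)
    {f f' g g' : WithConv (A →ₗ[ℚ] A)} {n : ℕ} (hf : ∀ p ≤ n, ∀ a ∈ 𝒜 p, f a = f' a)
    (hg : ∀ p ≤ n, ∀ a ∈ 𝒜 p, g a = g' a) {x : A} (hx : x ∈ 𝒜 n) : (f * g) x = (f' * g') x := by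
  rw [LinearMap.convMul_apply, LinearMap.convMul_apply]
  have := tensorPart_le (N := LinearMap.eqLocus (LinearMap.mul' ℚ A ∘ₗ TensorProduct.map f.ofConv g.ofConv)
    (LinearMap.mul' ℚ A ∘ₗ TensorProduct.map f'.ofConv g'.ofConv)) (fun p q hpq a ha b hb => ?_)
      (hΔ n x hx)
  · exact this
  · change LinearMap.mul' ℚ A (TensorProduct.map f.ofConv g.ofConv (a ⊗ₜ b)) =
      LinearMap.mul' ℚ A (TensorProduct.map f'.ofConv g'.ofConv (a ⊗ₜ b))
    simp only [TensorProduct.map_tmul, LinearMap.mul'_apply]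
    exact congrArg₂ _ (hf p (by omega) a ha) (hg q (by omega) b hb)

theorem conv_ext (h : ⨆ n, 𝒜 n = ⊤) {f g : WithConv (A →ₗ[ℚ] A)} (hfg : ∀ n, ∀ a ∈ 𝒜 n, f a = g a) :
    f = g := by
  refine WithConv.ext (LinearMap.ext fun a => ?_)
  have : (⨆ n, 𝒜 n) ≤ LinearMap.eqLocus f.ofConv g.ofConv := iSup_le hfg
  exact this (h ▸ Submodule.mem_top)

/-- The convolution power of `1 - id`; their sum is the antipode. -/
def reducedPow (A : Type u) [CommRing A] [Bialgebra ℚ A] (k : ℕ) : WithConv (A →ₗ[ℚ] A) :=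
  (1 - toConv LinearMap.id) ^ k

theorem reducedPow_eq_zero (hΔ : ∀ n, ∀ a ∈ 𝒜 n, Coalgebra.comul a ∈ tensorPart 𝒜 n)
    (h₀ : ∀ a ∈ 𝒜 0, ∃ c : ℚ, a = algebraMap ℚ A c) {k n : ℕ} (h : n < k) {a : A} (ha : a ∈ 𝒜 n) :
    reducedPow A k a = 0 := by
  induction k generalizing n a with
  | zero => omega
  | succ k ih =>
    rw [reducedPow, pow_succ, ← Submodule.mem_bot ℚ]
    refine conv_mem hΔ (fun p q hpq a ha b hb => (Submodule.mem_bot ℚ).2 ?_) ha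
    rcases lt_or_ge p k with hp | hp
    · rw [show ((1 - toConv LinearMap.id) ^ k : WithConv (A →ₗ[ℚ] A)) a = 0 from ih hp ha, zero_mul]
    · obtain rfl : q = 0 := by omega
      obtain ⟨c, rfl⟩ := h₀ b hb
      have : (1 - toConv LinearMap.id : WithConv (A →ₗ[ℚ] A)) (algebraMap ℚ A c) = 0 := by
        change (1 : WithConv (A →ₗ[ℚ] A)) (algebraMap ℚ A c) - algebraMap ℚ A c = 0
        rw [LinearMap.convOne_apply, Bialgebra.counit_algebraMap, sub_self]
      rw [this, mul_zero]

theorem reducedPow_mem [SetLike.GradedMonoid 𝒜]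
    (hΔ : ∀ n, ∀ a ∈ 𝒜 n, Coalgebra.comul a ∈ tensorPart 𝒜 n)
    (hε : ∀ n, n ≠ 0 → ∀ a ∈ 𝒜 n, Coalgebra.counit (R := ℚ) a = 0) (k : ℕ) {n : ℕ} {a : A} (ha : a ∈ 𝒜 n) :
    reducedPow A k a ∈ 𝒜 n := by
  have h₁ : ∀ n, ∀ a ∈ 𝒜 n, (1 : WithConv (A →ₗ[ℚ] A)) a ∈ 𝒜 n := fun n a ha => by
    rw [LinearMap.convOne_apply]
    rcases eq_or_ne n 0 with rfl | hn
    · rw [Algebra.algebraMap_eq_smul_one]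
      exact Submodule.smul_mem _ _ SetLike.GradedOne.one_mem
    · rw [hε n hn a ha, map_zero]
      exact zero_mem _
  induction k generalizing n a with
  | zero => exact h₁ n a ha
  | succ k ih =>
    rw [reducedPow, pow_succ]
    refine conv_mem hΔ (fun p q hpq a ha b hb => ?_) ha
    exact hpq ▸ SetLike.GradedMul.mul_mem (ih ha) (sub_mem (h₁ q b hb) hb)

theorem exists_hopfAlgebra [GradedAlgebra 𝒜] (hΔ : ∀ n, ∀ a ∈ 𝒜 n, Coalgebra.comul a ∈ tensorPart 𝒜 n)
    (hε : ∀ n, n ≠ 0 → ∀ a ∈ 𝒜 n, Coalgebra.counit (R := ℚ) a = 0)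
    (h₀ : ∀ a ∈ 𝒜 0, ∃ c : ℚ, a = algebraMap ℚ A c) :
    ∃ H : HopfAlgebra ℚ A, H.toBialgebra = ‹Bialgebra ℚ A› ∧ ∀ n, ∀ a ∈ 𝒜 n, H.antipode a ∈ 𝒜 n := by
  let P : ℕ → WithConv (A →ₗ[ℚ] A) := fun n => ∑ k ∈ Finset.range n, reducedPow A k
  have hP : ∀ n a, P n a = ∑ k ∈ Finset.range n, reducedPow A k a := fun n a => by
    induction n with
    | zero => rfl
    | succ n ih =>
      rw [Finset.sum_range_succ, ← ih]
      change (∑ k ∈ Finset.range (n + 1), reducedPow A k) a = _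
      rw [Finset.sum_range_succ]
      rfl
  let S : A →ₗ[ℚ] A := (DirectSum.toModule ℚ ℕ A fun n => (P (n + 1)).ofConv ∘ₗ (𝒜 n).subtype) ∘ₗ
    (DirectSum.decomposeLinearEquiv 𝒜).toLinearMap
  have hS : ∀ n, ∀ a ∈ 𝒜 n, S a = P (n + 1) a := fun n a ha => by
    lift a to 𝒜 n using ha
    change DirectSum.toModule ℚ ℕ A _ (DirectSum.decomposeLinearEquiv 𝒜 (a : A)) = _
    rw [DirectSum.decomposeLinearEquiv_apply_coe, DirectSum.toModule_lof]
    rfl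
  have hS' : ∀ n, ∀ p ≤ n, ∀ a ∈ 𝒜 p, toConv S a = P (n + 1) a := fun n p hp a ha => by
    refine (hS p a ha).trans ?_
    rw [hP, hP]
    refine Finset.sum_subset (by simpa using hp) fun k _ hk => reducedPow_eq_zero hΔ h₀ ?_ ha
    simpa using hk
  have htop := (DirectSum.Decomposition.isInternal 𝒜).submodule_iSup_eq_top
  have hone : ∀ n, ∀ a ∈ 𝒜 n, (1 - (1 - toConv LinearMap.id) ^ (n + 1) : WithConv (A →ₗ[ℚ] A)) a =
      (1 : WithConv (A →ₗ[ℚ] A)) a := fun n a ha => by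
    change (1 : WithConv (A →ₗ[ℚ] A)) a - reducedPow A (n + 1) a = _
    rw [reducedPow_eq_zero hΔ h₀ n.lt_succ_self ha, sub_zero]
  have hid : (toConv LinearMap.id : WithConv (A →ₗ[ℚ] A)) = 1 - (1 - toConv LinearMap.id) := by abel
  have hl : toConv S * toConv LinearMap.id = (1 : WithConv (A →ₗ[ℚ] A)) :=
    conv_ext htop fun n a ha => by
      rw [conv_congr hΔ (hS' n) (fun _ _ _ _ => rfl) ha, ← hone n a ha, ← geom_sum_mul_neg, ← hid]
      rfl
  have hr : toConv LinearMap.id * toConv S = (1 : WithConv (A →ₗ[ℚ] A)) :=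
    conv_ext htop fun n a ha => by
      rw [conv_congr hΔ (fun _ _ _ _ => rfl) (hS' n) ha, ← hone n a ha, ← mul_neg_geom_sum, ← hid]
      rfl
  refine ⟨{ antipode := S
            mul_antipode_rTensor_comul := congrArg WithConv.ofConv hl
            mul_antipode_lTensor_comul := congrArg WithConv.ofConv hr }, rfl, fun n a ha => ?_⟩
  change S a ∈ 𝒜 n
  rw [hS n a ha, hP]
  exact sum_mem fun k _ => reducedPow_mem hΔ hε k ha

end Antipode

theorem isGradedHopfAlgebra_of_two_pow {A : Type u} [CommRing A] [Algebra ℚ A] {𝒜 : ℕ → Submodule ℚ A}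
    {Δ : A →ₐ[ℚ] A ⊗[ℚ] A} {ε : A →ₐ[ℚ] ℚ} {T : A →ₐ[ℚ] A}
    (hT : ∀ n, ∀ x ∈ 𝒜 n, T x = (2 : ℚ) ^ n • x) (htop : ⨆ n, 𝒜 n = ⊤) [SetLike.GradedMonoid 𝒜]
    (h₀ : ∀ a ∈ 𝒜 0, ∃ c : ℚ, a = algebraMap ℚ A c)
    (hΔ : Δ.comp T = (Algebra.TensorProduct.map T T).comp Δ) (hε : ε.comp T = ε)
    (h₁ : (Algebra.TensorProduct.assoc ℚ ℚ ℚ A A A).toAlgHom.comp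
      ((Algebra.TensorProduct.map Δ (.id ℚ A)).comp Δ) = (Algebra.TensorProduct.map (.id ℚ A) Δ).comp Δ)
    (h₂ : (Algebra.TensorProduct.map ε (.id ℚ A)).comp Δ = (Algebra.TensorProduct.lid ℚ A).symm)
    (h₃ : (Algebra.TensorProduct.map (.id ℚ A) ε).comp Δ = (Algebra.TensorProduct.rid ℚ ℚ A).symm) :
    IsGradedHopfAlgebra 𝒜 Δ ε := by
  have hε' : ∀ n, n ≠ 0 → ∀ a ∈ 𝒜 n, ε a = 0 := fun n hn a ha => by
    have h := DFunLike.congr_fun hε a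
    rw [AlgHom.comp_apply, hT n a ha, map_smul, smul_eq_mul] at h
    by_contra h'
    exact (one_lt_pow₀ (by norm_num : (1 : ℚ) < 2) hn).ne' ((mul_eq_right₀ h').1 h)
  let : GradedAlgebra 𝒜 := { (isInternal_of_two_pow (T := T.toLinearMap) hT htop).chooseDecomposition with }
  refine ⟨⟨inferInstance⟩, fun n a ha => mem_tensorPart_of_two_pow hT htop hΔ ha, hε', h₁, h₂, h₃, ?_⟩
  let := Bialgebra.ofAlgHom Δ ε h₁ h₂ h₃
  exact exists_hopfAlgebra (𝒜 := 𝒜) (fun n a ha => mem_tensorPart_of_two_pow hT htop hΔ ha) hε' h₀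

end SymbPolylog
end

noncomputable section
namespace SymbPolylog

theorem apply_of_isWeightedHomogeneous {σ : Type u} {A : Type v} [CommRing A] [Algebra ℚ A]
    {f g : MvPolynomial σ ℚ →ₐ[ℚ] A} {w : σ → ℕ} {c : ℚ} (h : ∀ i, f (.X i) = c ^ w i • g (.X i)) {n : ℕ}
    {p : MvPolynomial σ ℚ} (hp : MvPolynomial.IsWeightedHomogeneous w p n) : f p = c ^ n • g p := by
  have hf : ∀ (f : MvPolynomial σ ℚ →ₐ[ℚ] A) (d : σ →₀ ℕ) (a : ℚ), f (MvPolynomial.monomial d a) =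
      algebraMap ℚ _ a * d.prod fun i k => f (.X i) ^ k := fun f d a => by
    rw [MvPolynomial.monomial_eq, map_mul, Finsupp.prod, map_prod, Finsupp.prod]
    simp only [map_pow]
    congr 1
    exact f.commutes a
  rw [p.as_sum, map_sum, map_sum, Finset.smul_sum]
  refine Finset.sum_congr rfl fun d hd => ?_
  rw [hf, hf, ← mul_smul_comm, ← hp (MvPolynomial.mem_support_iff.1 hd), Finsupp.weight_apply]
  congr 1
  simp only [h, smul_pow, Finsupp.prod, Finsupp.sum]
  rw [Finset.prod_smul, ← Finset.prod_pow_eq_pow_sum]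
  simp only [smul_eq_mul, ← pow_mul, mul_comm]

namespace ContractionSystem

variable (X : ContractionSystem.{u})

/-- The endomorphism of `H(X)` that multiplies the symbols of weight `n` by `2 ^ n`. -/
def weightScaling : X.Alg →ₐ[ℚ] X.Alg :=
  lift (fun α => (2 : ℚ) • logSym α) (fun _ α n => (2 : ℚ) ^ (∑ r, (n r : ℕ)) • sym α n)
    (fun α _ _ _ h₁₂ h₂₃ => by rw [← smul_add, logSym_rel])

variable {X}

theorem weightScaling_mk_X (g : X.Gen) : X.weightScaling (Ideal.Quotient.mk _ (MvPolynomial.X g)) =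
    (2 : ℚ) ^ g.weight • Ideal.Quotient.mk _ (MvPolynomial.X g) := by
  change MvPolynomial.aeval _ (MvPolynomial.X g) = _
  rw [MvPolynomial.aeval_X]
  cases g with
  | log α => simp [Gen.weight, logSym]
  | poly d α n => rfl

theorem weightScaling_logSym (α : X.obj 0) : X.weightScaling (logSym α) = (2 : ℚ) • logSym α :=
  (weightScaling_mk_X (.log α)).trans (by rw [Gen.weight, pow_one]; rfl)

theorem weightScaling_sym {d : ℕ} (α : X.obj d) (n : Fin (d + 1) → ℕ+) :
    X.weightScaling (sym α n) = (2 : ℚ) ^ (∑ r, (n r : ℕ)) • sym α n :=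
  weightScaling_mk_X (.poly d α n)

theorem weightScaling_ev {N : ℕ} (α : X.obj N) :
    X.weightScaling.comp (ev α) = (ev α).comp doubling := by
  refine MvPolynomial.algHom_ext fun x => ?_
  rcases x with r | ⟨e, c, n⟩
  · rw [AlgHom.comp_apply, AlgHom.comp_apply, doubling_log, map_smul]
    simp only [ev, MvPolynomial.aeval_X]
    split_ifs with h
    · exact weightScaling_logSym _
    · simp
  · rw [AlgHom.comp_apply, AlgHom.comp_apply, doubling_poly, map_smul]
    simp only [ev, MvPolynomial.aeval_X]
    split_ifs with h
    · exact weightScaling_sym _ n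
    · simp

theorem comul_comp_weightScaling : X.comul.comp X.weightScaling =
    (Algebra.TensorProduct.map X.weightScaling X.weightScaling).comp X.comul := by
  refine algHom_ext_semiring (fun α => ?_) fun d α n => ?_
  · rw [AlgHom.comp_apply, AlgHom.comp_apply, weightScaling_logSym, map_smul, comul_logSym, map_add,
      Algebra.TensorProduct.map_tmul, Algebra.TensorProduct.map_tmul, map_one, weightScaling_logSym,
      smul_add, TensorProduct.smul_tmul', TensorProduct.tmul_smul]
  · rw [AlgHom.comp_apply, AlgHom.comp_apply, weightScaling_sym, map_smul, comul_sym, map_map_apply,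
      weightScaling_ev, ← map_map_apply, stdSym, map_doubling_comulH, map_smul]

theorem counit_comp_weightScaling : X.counit.comp X.weightScaling = X.counit := by
  refine algHom_ext_semiring (fun α => ?_) fun d α n => ?_
  · rw [AlgHom.comp_apply, weightScaling_logSym, map_smul, counit_logSym, smul_zero]
  · rw [AlgHom.comp_apply, weightScaling_sym, map_smul, counit_sym, smul_zero]

theorem weightScaling_of_mem_weightPart (n : ℕ) {x : X.Alg} (hx : x ∈ X.weightPart n) :
    X.weightScaling x = (2 : ℚ) ^ n • x := by
  obtain ⟨p, hp, rfl⟩ := hx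
  rw [SetLike.mem_coe, MvPolynomial.mem_weightedHomogeneousSubmodule] at hp
  let f : MvPolynomial X.Gen ℚ →ₐ[ℚ] X.Alg := Ideal.Quotient.mkₐ ℚ _
  change X.weightScaling.comp f p = (2 : ℚ) ^ n • f p
  exact apply_of_isWeightedHomogeneous weightScaling_mk_X hp

variable (X)

theorem iSup_weightPart : ⨆ n, X.weightPart n = ⊤ := by
  classical
  let := MvPolynomial.weightedGradedAlgebra ℚ (Gen.weight (X := X))
  have h := (DirectSum.Decomposition.isInternal
    (MvPolynomial.weightedHomogeneousSubmodule ℚ (Gen.weight (X := X)))).submodule_iSup_eq_top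
  unfold weightPart
  rw [← Submodule.map_iSup, h, Submodule.map_top, LinearMap.range_eq_top]
  exact Ideal.Quotient.mk_surjective

instance : SetLike.GradedMonoid X.weightPart where
  one_mem := ⟨1, MvPolynomial.isWeightedHomogeneous_one ℚ _, rfl⟩
  mul_mem := by
    rintro m n _ _ ⟨p, hp, rfl⟩ ⟨q, hq, rfl⟩
    exact ⟨p * q, MvPolynomial.IsWeightedHomogeneous.mul hp hq, map_mul (Ideal.Quotient.mk _) p q⟩

theorem Gen.weight_ne_zero {X : ContractionSystem.{u}} (g : X.Gen) : g.weight ≠ 0 := by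
  cases g with
  | log α => exact one_ne_zero
  | poly d α n =>
    exact (Finset.sum_pos (fun r _ => (n r).pos) Finset.univ_nonempty).ne'

theorem weightPart_zero {a : X.Alg} (ha : a ∈ X.weightPart 0) : ∃ c : ℚ, a = algebraMap ℚ _ c := by
  classical
  obtain ⟨p, hp, rfl⟩ := ha
  refine ⟨p.coeff 0, ?_⟩
  have h : p = MvPolynomial.C (p.coeff 0) := MvPolynomial.ext _ _ fun d => by
    rw [MvPolynomial.coeff_C]
    split_ifs with hd
    · rw [hd]
    · by_contra hne
      have hw := hp hne
      rw [Finsupp.weight_apply, Finsupp.sum, Finset.sum_eq_zero_iff] at hw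
      refine hd (Finsupp.ext fun g => ?_).symm
      by_contra hg
      have := hw g (Finsupp.mem_support_iff.2 hg)
      exact (mul_ne_zero hg (Gen.weight_ne_zero g)) this
  conv_lhs => rw [h]
  rfl

theorem isHopf : X.IsHopf :=
  isGradedHopfAlgebra_of_two_pow (fun n _ => weightScaling_of_mem_weightPart n) X.iSup_weightPart
    (fun _ => X.weightPart_zero) comul_comp_weightScaling counit_comp_weightScaling X.comul_coassoc
    X.counit_comul_left X.counit_comul_right

end ContractionSystem
end SymbPolylog
end

noncomputable section
namespace SymbPolylog

/-! ### Hopf monoids -/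

section HopfObj

open CategoryTheory MonoidalCategory Functor.LaxMonoidal Functor.OplaxMonoidal

/-- A braided monoidal functor sends Hopf monoids to Hopf monoids. -/
abbrev hopfObjMap {C D : Type*} [Category* C] [MonoidalCategory C] [BraidedCategory C] [Category* D]
    [MonoidalCategory D] [BraidedCategory D] (F : C ⥤ D) [F.Braided] (A : C) [HopfObj A] :
    HopfObj (F.obj A) where
  toMonObj := Functor.monObjObj A
  toComonObj := Functor.obj.instComonObj A F
  mul_comul := by
    have h := tensorμ_comp_μ_tensorHom_μ_comp_μ F A A A A
    have h' : (F.map (ComonObj.comul (X := A)) ≫ δ F A A) ≫ μ F A A = F.map (ComonObj.comul (X := A)) := by simp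
    change (μ F A A ≫ F.map (MonObj.mul (X := A))) ≫ F.map (ComonObj.comul (X := A)) ≫ δ F A A =
      ((F.map (ComonObj.comul (X := A)) ≫ δ F A A) ⊗ₘ (F.map (ComonObj.comul (X := A)) ≫ δ F A A)) ≫ tensorμ _ _ _ _ ≫
        ((μ F A A ≫ F.map (MonObj.mul (X := A))) ⊗ₘ
          (μ F A A ≫ F.map (MonObj.mul (X := A))))
    rw [← cancel_mono (μ F A A)]
    simp only [Category.assoc, Functor.Monoidal.δ_μ, Category.comp_id]
    rw [← tensorHom_comp_tensorHom (μ F A A)]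
    simp only [Category.assoc]
    rw [Functor.LaxMonoidal.μ_natural, reassoc_of% h, tensorHom_comp_tensorHom_assoc, h',
      ← Functor.map_comp, BimonObj.mul_comul, Functor.map_comp, Functor.map_comp,
      Functor.LaxMonoidal.μ_natural_assoc]
  one_comul := by
    change (ε F ≫ F.map (MonObj.one (X := A))) ≫ F.map (ComonObj.comul (X := A)) ≫ δ F A A =
      (λ_ (𝟙_ D)).inv ≫ ((ε F ≫ F.map (MonObj.one (X := A))) ⊗ₘ (ε F ≫ F.map (MonObj.one (X := A))))
    rw [← cancel_mono (μ F A A)]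
    simp only [Category.assoc, Functor.Monoidal.δ_μ, Category.comp_id]
    rw [← tensorHom_comp_tensorHom, Category.assoc, Functor.LaxMonoidal.μ_natural, ← Functor.map_comp,
      BimonObj.one_comul, MonObj.tensorObj.one_def, Functor.map_comp]
    simp [MonoidalCategory.tensorHom_def]
    rw [← unitors_equal, ← unitors_equal, Iso.inv_hom_id_assoc, ← Functor.map_comp_assoc, Iso.inv_hom_id]
    simp
  mul_counit := by
    change (μ F A A ≫ F.map (MonObj.mul (X := A))) ≫ F.map (ComonObj.counit (X := A)) ≫ η F =
      ((F.map (ComonObj.counit (X := A)) ≫ η F) ⊗ₘ (F.map (ComonObj.counit (X := A)) ≫ η F)) ≫ (λ_ (𝟙_ D)).hom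
    rw [← cancel_epi (δ F A A)]
    simp only [Category.assoc, Functor.Monoidal.δ_μ_assoc]
    rw [← tensorHom_comp_tensorHom, Category.assoc, Functor.OplaxMonoidal.δ_natural_assoc,
      ← Functor.map_comp_assoc, BimonObj.mul_counit, Comon.tensorObj_counit, Functor.map_comp]
    simp [MonoidalCategory.tensorHom_def]
  one_counit := by
    change (ε F ≫ F.map (MonObj.one (X := A))) ≫ F.map (ComonObj.counit (X := A)) ≫ η F = _
    rw [Category.assoc, ← Functor.map_comp_assoc, BimonObj.one_counit]
    simp
  antipode := F.map (HopfObj.antipode (X := A))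
  antipode_left := by
    change (F.map (ComonObj.comul (X := A)) ≫ δ F A A) ≫ (F.map (HopfObj.antipode (X := A)) ▷ F.obj A) ≫
      μ F A A ≫ F.map (MonObj.mul (X := A)) = (F.map (ComonObj.counit (X := A)) ≫ η F) ≫ ε F ≫ F.map (MonObj.one (X := A))
    simp [← Functor.map_comp]
  antipode_right := by
    change (F.map (ComonObj.comul (X := A)) ≫ δ F A A) ≫ (F.obj A ◁ F.map (HopfObj.antipode (X := A))) ≫
      μ F A A ≫ F.map (MonObj.mul (X := A)) = (F.map (ComonObj.counit (X := A)) ≫ η F) ≫ ε F ≫ F.map (MonObj.one (X := A))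
    simp [← Functor.map_comp]

/-- A functor whose values are Hopf monoids, naturally, is a Hopf monoid. -/
abbrev hopfObjOfPointwise {C D : Type*} [Category* C] [Category* D] [MonoidalCategory D] [BraidedCategory D]
    (P : C ⥤ D) [h : ∀ U, HopfObj (P.obj U)] (hP : ∀ {U V : C} (f : U ⟶ V), IsBimonHom (P.map f)) :
    HopfObj P where
  one := { app _ := MonObj.one, naturality _ _ f := (Category.id_comp _).trans (IsMonHom.one_hom (P.map f)).symm }
  mul := { app _ := MonObj.mul, naturality _ _ f := (IsMonHom.mul_hom (P.map f)).symm }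
  counit := { app _ := ComonObj.counit, naturality _ _ f := (IsComonHom.hom_counit (P.map f)).trans (Category.comp_id _).symm }
  comul := { app _ := ComonObj.comul, naturality _ _ f := IsComonHom.hom_comul (P.map f) }
  antipode := { app _ := HopfObj.antipode, naturality _ _ f := HopfObj.hom_antipode (P.map f) }
  one_mul := NatTrans.ext (funext fun U => MonObj.one_mul (P.obj U))
  mul_one := NatTrans.ext (funext fun U => MonObj.mul_one (P.obj U))
  mul_assoc := NatTrans.ext (funext fun U => MonObj.mul_assoc (P.obj U))
  counit_comul := NatTrans.ext (funext fun U => ComonObj.counit_comul (P.obj U))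
  comul_counit := NatTrans.ext (funext fun U => ComonObj.comul_counit (P.obj U))
  comul_assoc := NatTrans.ext (funext fun U => ComonObj.comul_assoc (P.obj U))
  mul_comul := NatTrans.ext (funext fun U => BimonObj.mul_comul (P.obj U))
  one_comul := NatTrans.ext (funext fun U => BimonObj.one_comul (P.obj U))
  mul_counit := NatTrans.ext (funext fun U => BimonObj.mul_counit (P.obj U))
  one_counit := NatTrans.ext (funext fun U => BimonObj.one_counit (P.obj U))
  antipode_left := NatTrans.ext (funext fun U => HopfObj.antipode_left (P.obj U))
  antipode_right := NatTrans.ext (funext fun U => HopfObj.antipode_right (P.obj U))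

theorem tensor_mul_eq (A : Type) [CommRing A] [Algebra ℚ A] (x y : A ⊗[ℚ] A) : x * y =
    TensorProduct.map (LinearMap.mul' ℚ A) (LinearMap.mul' ℚ A)
      (TensorProduct.tensorTensorTensorComm ℚ A A A A (x ⊗ₜ y)) := by
  induction x with
  | zero => simp
  | add x x' h h' => simp only [add_mul, TensorProduct.add_tmul, map_add, h, h']
  | tmul a b =>
    induction y with
    | zero => simp
    | add y y' h h' => simp only [mul_add, TensorProduct.tmul_add, map_add, h, h']
    | tmul c d => simp

/-- A Hopf algebra is a Hopf monoid in the category of modules. -/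
abbrev hopfObjOfHopfAlgebra (A : Type) [CommRing A] [HopfAlgebra ℚ A] : HopfObj (ModuleCat.of ℚ A) where
  one := ModuleCat.ofHom (Algebra.linearMap ℚ A)
  mul := ModuleCat.ofHom (LinearMap.mul' ℚ A)
  counit := ModuleCat.ofHom (Coalgebra.counit (R := ℚ) (A := A))
  comul := ModuleCat.ofHom (Coalgebra.comul (R := ℚ) (A := A))
  antipode := ModuleCat.ofHom (HopfAlgebra.antipode ℚ (A := A))
  one_mul := by
    refine ModuleCat.hom_ext (TensorProduct.ext' fun r a => ?_)
    exact (Algebra.smul_def r a).symm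
  mul_one := by
    refine ModuleCat.hom_ext (TensorProduct.ext' fun a r => ?_)
    exact ((Algebra.smul_def r a).trans (mul_comm _ _)).symm
  mul_assoc := by
    refine ModuleCat.hom_ext (TensorProduct.ext_threefold fun a b c => ?_)
    exact mul_assoc a b c
  counit_comul := ModuleCat.hom_ext Coalgebra.rTensor_counit_comp_comul
  comul_counit := ModuleCat.hom_ext Coalgebra.lTensor_counit_comp_comul
  comul_assoc := ModuleCat.hom_ext Coalgebra.coassoc.symm
  mul_comul := by
    rw [ModuleCat.MonoidalCategory.tensorμ_eq_tensorTensorTensorComm]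
    refine ModuleCat.hom_ext (TensorProduct.ext' fun a b => ?_)
    exact (Bialgebra.comul_mul a b).trans (tensor_mul_eq A _ _)
  one_comul := by
    refine ModuleCat.hom_ext (LinearMap.ext_ring ?_)
    change Coalgebra.comul (R := ℚ) (algebraMap ℚ A 1) = algebraMap ℚ A 1 ⊗ₜ algebraMap ℚ A 1
    rw [map_one, Bialgebra.comul_one]
    rfl
  mul_counit := by
    refine ModuleCat.hom_ext (TensorProduct.ext' fun a b => ?_)
    exact Bialgebra.counit_mul a b
  one_counit := by
    refine ModuleCat.hom_ext (LinearMap.ext_ring ?_)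
    exact (congrArg _ (map_one (algebraMap ℚ A))).trans Bialgebra.counit_one
  antipode_left := ModuleCat.hom_ext HopfAlgebra.mul_antipode_rTensor_comul
  antipode_right := ModuleCat.hom_ext HopfAlgebra.mul_antipode_lTensor_comul

end HopfObj

end SymbPolylog
end

noncomputable section
namespace SymbPolylog

theorem exists_antipode {A : Type u} [CommRing A] [B : Bialgebra ℚ A]
    (h : ∃ H : HopfAlgebra ℚ A, H.toBialgebra = B) : ∃ S : A →ₗ[ℚ] A,
      LinearMap.mul' ℚ A ∘ₗ S.rTensor A ∘ₗ Coalgebra.comul = Algebra.linearMap ℚ A ∘ₗ Coalgebra.counit ∧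
      LinearMap.mul' ℚ A ∘ₗ S.lTensor A ∘ₗ Coalgebra.comul = Algebra.linearMap ℚ A ∘ₗ Coalgebra.counit := by
  obtain ⟨H, rfl⟩ := h
  exact ⟨H.antipode, H.mul_antipode_rTensor_comul, H.mul_antipode_lTensor_comul⟩

namespace ContractionSystem

variable (X : ContractionSystem.{u})

/-- The bialgebra `H(X)`. -/
abbrev bialgebra : Bialgebra ℚ X.Alg :=
  Bialgebra.ofAlgHom X.comul X.counit X.comul_coassoc X.counit_comul_left X.counit_comul_right

theorem exists_hopfAlgebra_toBialgebra_eq : ∃ H : HopfAlgebra ℚ X.Alg, H.toBialgebra = X.bialgebra := by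
  obtain ⟨_, _, _, H, h, -⟩ := X.isHopf.hopf
  exact ⟨H, h⟩

/-- The Hopf algebra `H(X)`. -/
abbrev hopfAlgebra : HopfAlgebra ℚ X.Alg :=
  { X.bialgebra with
    antipode := (exists_antipode (B := X.bialgebra) X.exists_hopfAlgebra_toBialgebra_eq).choose
    mul_antipode_rTensor_comul :=
      (exists_antipode (B := X.bialgebra) X.exists_hopfAlgebra_toBialgebra_eq).choose_spec.1
    mul_antipode_lTensor_comul :=
      (exists_antipode (B := X.bialgebra) X.exists_hopfAlgebra_toBialgebra_eq).choose_spec.2 }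

end ContractionSystem

section Sheaf

open CategoryTheory TopologicalSpace Opposite MonoidalCategory

attribute [local instance] CategoryTheory.Sheaf.monoidalCategory
  CategoryTheory.Sheaf.braidedCategory

variable (E M : Type) [NormedAddCommGroup E] [NormedSpace ℂ E] [TopologicalSpace M] [ChartedSpace E M]

/-- The presheaf `U ↦ H(X(U))` of Hopf algebras. -/
abbrev hopfObjPresheaf : HopfObj (presheaf E M) :=
  let h (U : (Opens (TopCat.of M))ᵒᵖ) : HopfObj ((presheaf E M).obj U) :=
    @hopfObjOfHopfAlgebra (ContractionSystem.ofOpen E (M := M) U.unop).Alg _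
      (ContractionSystem.ofOpen E (M := M) U.unop).hopfAlgebra
  hopfObjOfPointwise (presheaf E M) (h := h) fun f =>
    let r := restrict (E := E) (M := M) (leOfHom f.unop)
    { one_hom := ModuleCat.hom_ext (LinearMap.ext_ring (r.map.commutes 1))
      mul_hom := ModuleCat.hom_ext (TensorProduct.ext' r.map.map_mul')
      hom_counit := ModuleCat.hom_ext
        (congrArg AlgHom.toLinearMap (ContractionSystem.counit_comp_map r))
      hom_comul := ModuleCat.hom_ext
        (congrArg AlgHom.toLinearMap (ContractionSystem.comul_comp_map r)) }

theorem isSheafOfHopfAlgebras : IsSheafOfHopfAlgebras E M :=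
  ⟨hopfObjPresheaf E M,
    @hopfObjMap _ _ _ _ _ _ _ _ (presheafToSheaf _ _) _ (presheaf E M) (hopfObjPresheaf E M),
    fun _ => ⟨rfl, rfl, rfl, rfl⟩, rfl, rfl, rfl, rfl⟩

end Sheaf
end SymbPolylog
end

open SymbPolylog ContractionSystem in
theorem mainTheorem8 :
    -- the free contraction algebra of an arbitrary contraction system
    (∀ X : ContractionSystem.{u},
      (∀ α : X.obj 0, X.comul (logSym α) = 1 ⊗ₜ logSym α + logSym α ⊗ₜ 1) ∧
      (∀ (d : ℕ) (α : X.obj d) (n : Fin (d + 1) → ℕ+),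
        comulH (stdSym n) ∈ (Algebra.TensorProduct.map
          (Hsymb.first (d + 1)).val (Hsymb.first (d + 1)).val).range ∧
        X.comul (sym α n) =
          Algebra.TensorProduct.map (ev α) (ev α) (comulH (stdSym n))) ∧
      X.IsHopf) ∧
    -- the structure is natural in the contraction system
    (∀ (X Y : ContractionSystem.{u}) (f : X.Hom Y),
      Y.comul.comp f.map = (Algebra.TensorProduct.map f.map f.map).comp X.comul ∧
      Y.counit.comp f.map = X.counit) ∧
    -- fields
    (∀ (F : Type u) [Field F], (ofField F).IsHopf) ∧
    -- fields with a torsion free extension of their multiplicative group by the integers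
    (∀ (F : Type v) [Field F] (E : Type u) [AddCommGroup E] (π : E →+ Additive Fˣ),
      IsTorsionFreeExtension π → (ofExtension π).IsHopf) ∧
    -- complex manifolds
    (∀ (E : Type) [NormedAddCommGroup E] [NormedSpace ℂ E] [FiniteDimensional ℂ E]
      (M : Type) [TopologicalSpace M] [ChartedSpace E M] [IsManifold 𝓘(ℂ, E) ω M],
      (∀ U : TopologicalSpace.Opens M, (ofOpen E U).IsHopf) ∧ IsSheafOfHopfAlgebras E M) ∧
    -- semisimplicial sets and simplicial sets
    (∀ S : CategoryTheory.Functor SemiSimplexCategoryᵒᵖ (Type u), (ofSemisimplicial S).IsHopf) ∧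
    (∀ S : SSet.{u}, (ofSimplicial S).IsHopf) := by
  refine ⟨fun X => ⟨fun α => (comul_logSym α).trans (add_comm _ _),
    fun d α n => ⟨comulH_stdSym_mem n, comul_sym α n⟩, X.isHopf⟩,
    fun X Y f => ⟨comul_comp_map f, counit_comp_map f⟩, fun F _ => isHopf _,
    fun F _ E _ π _ => isHopf _, fun E _ _ _ M _ _ _ => ⟨fun U => isHopf _, isSheafOfHopfAlgebras E M⟩,
    fun S => isHopf _, fun S => isHopf _⟩
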